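/- Setting. Let $M$ be a filtered manifold: a smooth ($\sigma$-compact, Hausdorff) manifold with smooth subbundles $M\times\{0\}=H^0\subseteq H^1\subseteq\dots\subseteq H^s=TM$, $H^i=TM$ for $i>s$, such that $[\Gamma(H^i),\Gamma(H^j)]\subseteq\Gamma(H^{i+j})$; let $TM$ carry a Riemannian metric. Each $\mathrm{gr}(T_xM)=\bigoplus_{i=1}^s H^i_x/H^{i-1}_x$ carries the osculating Lie bracket $[\langle X\rangle_i,\langle Y\rangle_j]=\langle[X,Y]\rangle_{i+j}$ ($X\in\Gamma(H^i)$, $Y\in\Gamma(H^j)$, $\langle X\rangle_i=X(x)\bmod H^{i-1}_x$); let $d_{\mathfrak g_xM}$ be its Chevalley–Eilenberg differential on $\wedge^\bullet\mathrm{gr}(T_xM)^*$ (zero in degree $0$), and $d_{\mathfrak g_xM}^t$ its transpose for the scalar product induced by the metric (quotient scalar products on the mutually orthogonal pieces $H^i_x/H^{i-1}_x$). Assume that for every $k$ the rank of $d_{\mathfrak g_xM}$ on $\wedge^k\mathrm{gr}(T_xM)^*$ is a locally constant function of $x\in M$. Let $\Omega^{\bullet}(M)$ be the space of smooth forms and $\Omega^{k,\ge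 w}(M)$ the space of smooth $k$-forms that vanish on $V_1\in H^{i_1},\dots,V_k\in H^{i_k}$ whenever $i_1+\dots+i_k<w$. For a map respecting this filtration, $\mathrm{gr}$ denotes the induced map on $\wedge^\bullet\mathrm{gr}(T_xM)^*$. Let $(d_0,\delta_0)$ be a pair of base differential and codifferential: smooth algebraic (that is, acting pointwise and linearly) operators on $\Omega^\bullet(M)$, of degree $+1$ and $-1$, with $d_0^2=0=\delta_0^2$, respecting the filtration, disjoint (for all $\alpha\in\Omega^\bullet(M)$: $\delta_0d_0\alpha=0\Rightarrow d_0\alpha=0$ and $d_0\delta_0\alpha=0\Rightarrow\delta_0\alpha=0$), and with $\mathrm{gr}(d_0)=d_{\mathfrak gM}$, $\mathrm{gr}(\delta_0)=d_{\mathfrak gM}^t$. With $d$ the exterior derivative put $\Box_0=d_0\delta_0+\delta_0d_0$, $\Box=d\delta_0+\delta_0d$, and let $\Pi_0$, $P$ be the generalised kernel projections of $\Box_0$ and $\Box$ on $\Omega^\bullet(M)$, where the generalised kernel projection of $T$ is the projection onto $\bigcup_n\ker T^n$ along $\bigcap_n\mathrm{Im}\,T^n$. Put $$L=P\Pi_0+(I-P)(I-\Pi_0),\qquad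 C=L^{-1}dL(I-\Pi_0),\qquad F_0=\mathrm{Im}\,d_0+\mathrm{Im}\,\delta_0,\qquad F_0^k=F_0\cap\Omega^k(M).$$ Statement. 1. These objects are well defined: $\Omega^\bullet(M)=\bigcup_n\ker T^n\oplus\bigcap_n\mathrm{Im}\,T^n$ for $T=\Box_0$ and for $T=\Box$; $L$ is invertible on $\Omega^\bullet(M)$; and $\Box_0$ restricts to an invertible operator on $F_0$. 2. $d_0$ and $C$ map $F_0^k$ to $F_0^{k+1}$ for every $k\ge 0$, and $d_0^2=0$, $C^2=0$ on $F_0^k$; that is, $(F_0^\bullet,d_0)$ and $(F_0^\bullet,C)$ are complexes. 3. $g=C\delta_0\Box_0^{-1}+\delta_0\Box_0^{-1}d_0$ is an invertible linear operator $F_0\to F_0$, and $Cg=gd_0$ on $F_0$. 4. For every $k\ge0$ the $k$-th cohomology spaces of $(F_0^\bullet,C)$ and $(F_0^\bullet,d_0)$ are isomorphic, and both are zero. -/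

import Mathlib

open scoped Manifold ContDiff Bundle Topology

noncomputable section

namespace FilteredComplex

section LinearAlgebra

variable {V : Type*} [AddCommGroup V] [Module ℝ V]

/-- The `(i+1)`-st piece `F (i+1) / F i` of the graded space of a filtration `F`. -/
abbrev GrPiece (F : ℕ → Submodule ℝ V) (i : ℕ) : Type _ :=
  ↥(F (i + 1)) ⧸ (F i).submoduleOf (F (i + 1))

/-- The graded space `⨁_{1 ≤ i ≤ s} F i / F (i-1)` of a filtration of depth `s`. -/
abbrev Gr (F : ℕ → Submodule ℝ V) (s : ℕ) : Type _ := ∀ i : Fin s, GrPiece F i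

/-- The class `⟨v⟩_j = v mod F (j-1)` in `Gr F s` of a vector `v ∈ F j`
(it is `0` if `j = 0` or `j > s`). -/
def grClass (F : ℕ → Submodule ℝ V) (s : ℕ) (j : ℕ) (v : V) (hv : v ∈ F j) : Gr F s := fun i =>
  if h : (i : ℕ) + 1 = j then Submodule.Quotient.mk ⟨v, h ▸ hv⟩ else 0

/-- The `k`-covector `α` has weight at least `w`: it vanishes on `v₁ ∈ F j₁, …, v_k ∈ F j_k`
whenever `j₁ + … + j_k < w`. -/
def HasWeightGE (F : ℕ → Submodule ℝ V) (w : ℕ) {k : ℕ} (α : (Fin k → V) → ℝ) : Prop :=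
  ∀ (j : Fin k → ℕ) (v : Fin k → V), (∀ i, v i ∈ F (j i)) → ∑ i, j i < w → α v = 0

/-- `α` has weight at least `w`, and `β`, a `k`-covector on the graded space that is pure of
weight `w`, is the class of `α` modulo the `k`-covectors of weight at least `w + 1`. -/
def HasSymbol (F : ℕ → Submodule ℝ V) (s w : ℕ) {k : ℕ} (α : (Fin k → V) → ℝ)
    (β : Gr F s [⋀^Fin k]→ₗ[ℝ] ℝ) : Prop :=
  HasWeightGE F w α ∧
  ∀ (j : Fin k → ℕ) (v : Fin k → V) (hv : ∀ i, v i ∈ F (j i)),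
    β (fun i => grClass F s (j i) (v i) (hv i)) = if ∑ i, j i = w then α v else 0

/-- The Chevalley--Eilenberg differential of a bracket `b`; it vanishes in degree `0`, and
`ceDiff_apply` is the usual formula in positive degrees. -/
def ceDiff {G : Type*} [AddCommGroup G] [Module ℝ G] (b : G →ₗ[ℝ] G →ₗ[ℝ] G) :
    (k : ℕ) → (G [⋀^Fin k]→ₗ[ℝ] ℝ) →ₗ[ℝ] (G [⋀^Fin (k + 1)]→ₗ[ℝ] ℝ)
  | 0 => 0
  | _ + 1 =>
    { toFun := fun β => -(1 / 2 : ℝ) • AlternatingMap.alternatizeUncurryFin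
        (AlternatingMap.alternatizeUncurryFinLM ∘ₗ b.compr₂ β.curryLeft)
      map_add' := fun β γ => by
        ext v
        simp [AlternatingMap.alternatizeUncurryFin_apply, Finset.sum_add_distrib, mul_add]
        try ring
      map_smul' := fun c β => by
        ext v
        simp [AlternatingMap.alternatizeUncurryFin_apply, Finset.mul_sum]
        try simp only [mul_left_comm] }

/-- With `j' = j + 1`, this reads
`dβ(v₀, …) = ∑_{i < j'} (-1)^(i + j') β([v_i, v_{j'}], v₀, …, v̂_i, …, v̂_{j'}, …)`. -/
theorem ceDiff_apply {G : Type*} [AddCommGroup G] [Module ℝ G] (b : G →ₗ[ℝ] G →ₗ[ℝ] G)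
    (hb : ∀ u v, b u v = - b v u) {k : ℕ} (β : G [⋀^Fin (k + 1)]→ₗ[ℝ] ℝ) (v : Fin (k + 2) → G) :
    ceDiff b (k + 1) β v = - ∑ i : Fin (k + 1), ∑ j ≥ i, (-1 : ℝ) ^ (i + j : ℕ) *
      β (Matrix.vecCons (b (v i.castSucc) (v j.succ))
        (j.removeNth (i.castSucc.removeNth v))) := by
  simp only [ceDiff, LinearMap.coe_mk, AddHom.coe_mk, AlternatingMap.smul_apply,
    AlternatingMap.alternatizeUncurryFin_alternatizeUncurryFinLM_comp_apply]
  rw [Finset.smul_sum, ← Finset.sum_neg_distrib]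
  refine Finset.sum_congr rfl fun i _ => ?_
  rw [Finset.smul_sum, ← Finset.sum_neg_distrib]
  refine Finset.sum_congr rfl fun j _ => ?_
  have h : β (Matrix.vecCons (b (v j.succ) (v i.castSucc))
      (j.removeNth (i.castSucc.removeNth v))) = - β (Matrix.vecCons (b (v i.castSucc) (v j.succ))
      (j.removeNth (i.castSucc.removeNth v))) := by
    rw [hb (v j.succ), ← neg_one_smul ℝ, AlternatingMap.map_vecCons_smul]; simp
  simp only [LinearMap.compr₂_apply, AlternatingMap.curryLeft_apply_apply, h]
  simp only [zsmul_eq_mul, smul_eq_mul]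
  push_cast
  ring

end LinearAlgebra

section Metric

/-- The scalar product on `k`-covectors of a Euclidean space `G` induced by that of `G`: the
elementary covectors of an orthonormal basis are orthonormal (so that
`⟨α₁ ∧ … ∧ α_k, β₁ ∧ … ∧ β_k⟩ = det ⟨α_i, β_j⟩`). It does not depend on the basis. -/
def altInner {G : Type*} [NormedAddCommGroup G] [InnerProductSpace ℝ G] [FiniteDimensional ℝ G]
    {k : ℕ} (α β : (Fin k → G) → ℝ) : ℝ :=
  ∑ I : Fin k ↪o Fin (Module.finrank ℝ G),
    α (fun i => stdOrthonormalBasis ℝ G (I i)) * β (fun i => stdOrthonormalBasis ℝ G (I i))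

variable {V : Type*} [NormedAddCommGroup V] [InnerProductSpace ℝ V] [FiniteDimensional ℝ V]

instance isClosed_submoduleOf (F : ℕ → Submodule ℝ V) (i : ℕ) :
    IsClosed ((F i).submoduleOf (F (i + 1)) : Set ↥(F (i + 1))) :=
  Submodule.closed_of_finiteDimensional _

/-- The scalar product on `k`-covectors of the graded space of a filtered Euclidean space. The
pieces are mutually orthogonal, and `F (i+1) / F i` carries the quotient scalar product, that is,
the one of the orthogonal complement of `F i` in `F (i+1)`. -/
def grAltInner (F : ℕ → Submodule ℝ V) (s : ℕ) {k : ℕ} (α β : Gr F s [⋀^Fin k]→ₗ[ℝ] ℝ) : ℝ :=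
  altInner (G := PiLp 2 fun i : Fin s => GrPiece F i)
    (fun v => α fun i => WithLp.ofLp (v i)) (fun v => β fun i => WithLp.ofLp (v i))

/-- `T'` is the transpose of `T` for the scalar products of covectors of the graded space. -/
def IsTranspose (F : ℕ → Submodule ℝ V) (s : ℕ) {k l : ℕ}
    (T : (Gr F s [⋀^Fin k]→ₗ[ℝ] ℝ) →ₗ[ℝ] (Gr F s [⋀^Fin l]→ₗ[ℝ] ℝ))
    (T' : (Gr F s [⋀^Fin l]→ₗ[ℝ] ℝ) →ₗ[ℝ] (Gr F s [⋀^Fin k]→ₗ[ℝ] ℝ)) : Prop :=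
  ∀ α β, grAltInner F s (T α) β = grAltInner F s α (T' β)

end Metric

section Forms

variable {E : Type*} [NormedAddCommGroup E] [NormedSpace ℝ E]
  {M : Type*} [TopologicalSpace M] [ChartedSpace E M]

variable (E) in
/-- The alternating `k`-forms on the tangent space at `x`. -/
abbrev AltTangent (k : ℕ) (x : M) : Type _ :=
  TangentSpace 𝓘(ℝ, E) x [⋀^Fin k]→L[ℝ] Bundle.Trivial M ℝ x

variable [IsManifold 𝓘(ℝ, E) ∞ M]

/-- The expression of the form `η` in the preferred chart at `x₀`. -/
def localRep {k : ℕ} (η : ∀ x : M, AltTangent E k x) (x₀ : M) (y : E) :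
    E [⋀^Fin k]→L[ℝ] ℝ :=
  ContinuousAlternatingMap.compContinuousLinearMap (η ((chartAt E x₀).symm y))
    ((trivializationAt E (TangentSpace 𝓘(ℝ, E)) x₀).symmL ℝ ((chartAt E x₀).symm y))

/-- The exterior derivative at `x`, computed in the preferred chart at `x`. By
`localRep_extDerivForm` it is given in every preferred chart by the exterior derivative of the
expression of `η` in that chart. -/
def extDerivForm {k : ℕ} (η : ∀ x : M, AltTangent E k x) (x : M) : AltTangent E (k + 1) x :=
  ContinuousAlternatingMap.compContinuousLinearMap (extDeriv (localRep η x) (chartAt E x x))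
    ((trivializationAt E (TangentSpace 𝓘(ℝ, E)) x).continuousLinearMapAt ℝ x)

theorem contMDiffAt_form_iff [FiniteDimensional ℝ E] {k : ℕ} (η : ∀ x : M, AltTangent E k x) (x₀ : M) :
    ContMDiffAt 𝓘(ℝ, E) (𝓘(ℝ, E).prod 𝓘(ℝ, E [⋀^Fin k]→L[ℝ] ℝ)) ∞
      (fun x => Bundle.TotalSpace.mk' (E [⋀^Fin k]→L[ℝ] ℝ) x (η x)) x₀ ↔
      ContDiffAt ℝ ∞ (localRep η x₀) (chartAt E x₀ x₀) := by
  rw [Bundle.contMDiffAt_section]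
  rw [contMDiffAt_iff_source_of_mem_source (mem_chart_source E x₀)]
  simp only [mfld_simps]
  rw [contMDiffWithinAt_univ, contMDiffAt_iff_contDiffAt]
  have h : ((fun x => (trivializationAt (E [⋀^Fin k]→L[ℝ] ℝ)
      (fun x : M => TangentSpace 𝓘(ℝ, E) x [⋀^Fin k]→L[ℝ] Bundle.Trivial M ℝ x) x₀
        ⟨x, η x⟩).2) ∘ (chartAt E x₀).symm) = localRep η x₀ := by
    funext y
    rw [Function.comp_apply, FiberBundle.trivializationAt_continuousAlternatingMap_apply]
    ext v
    simp [localRep, ContinuousAlternatingMap.inCoordinates]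
  rw [h]

theorem fderiv_chart_change (x₀ x : M) {z : E}
    (hz : z ∈ ((chartAt E x₀).symm.trans (chartAt E x)).source) :
    fderiv ℝ (chartAt E x ∘ (chartAt E x₀).symm) z =
      ((trivializationAt E (TangentSpace 𝓘(ℝ, E)) x).continuousLinearMapAt ℝ
        ((chartAt E x₀).symm z)).comp
      ((trivializationAt E (TangentSpace 𝓘(ℝ, E)) x₀).symmL ℝ ((chartAt E x₀).symm z)) := by
  have hz1 : z ∈ (chartAt E x₀).target := by simpa using hz.1
  have hz2 : (chartAt E x₀).symm z ∈ (chartAt E x).source := hz.2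
  have hz0 : (chartAt E x₀).symm z ∈ (chartAt E x₀).source := (chartAt E x₀).map_target hz1
  rw [TangentBundle.continuousLinearMapAt_trivializationAt_eq_core hz2,
    TangentBundle.symmL_trivializationAt_eq_core hz0]
  ext v
  have := (tangentBundleCore 𝓘(ℝ, E) M).coordChange_comp (achart E x₀)
    (achart E ((chartAt E x₀).symm z)) (achart E x) ((chartAt E x₀).symm z)
    ⟨⟨hz0, mem_chart_source _ _⟩, hz2⟩ v
  refine Eq.trans ?_ this.symm
  rw [tangentBundleCore_coordChange]
  simp only [mfld_simps]
  rw [(chartAt E x₀).right_inv hz1, fderivWithin_univ]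

theorem localRep_eq {k : ℕ} (η : ∀ x : M, AltTangent E k x) (x₀ x : M) {z : E}
    (hz : z ∈ ((chartAt E x₀).symm.trans (chartAt E x)).source) :
    localRep η x₀ z =
      (localRep η x ((chartAt E x ∘ (chartAt E x₀).symm) z)).compContinuousLinearMap
        (fderiv ℝ (chartAt E x ∘ (chartAt E x₀).symm) z) := by
  have hz2 : (chartAt E x₀).symm z ∈ (chartAt E x).source := hz.2
  rw [fderiv_chart_change x₀ x hz]
  ext v
  simp only [localRep, Function.comp_apply]
  rw [(chartAt E x).left_inv hz2]
  change η _ _ = η _ _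
  congr 1
  funext i
  exact ((trivializationAt E (TangentSpace 𝓘(ℝ, E)) x).symmL_continuousLinearMapAt
    (R := ℝ) hz2 _).symm

theorem contDiffAt_chart_change (x₀ x : M) {z : E}
    (hz : z ∈ ((chartAt E x₀).symm.trans (chartAt E x)).source) :
    ContDiffAt ℝ ∞ (chartAt E x ∘ (chartAt E x₀).symm) z := by
  have h := contDiffOn_ext_coord_change (I := 𝓘(ℝ, E)) (n := ∞) x x₀
  simp only [mfld_simps] at h
  refine (h z ?_).contDiffAt ?_
  · simpa using hz
  · refine IsOpen.mem_nhds ?_ (by simpa using hz)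
    simpa using ((chartAt E x₀).symm.trans (chartAt E x)).open_source

theorem localRep_extDerivForm [FiniteDimensional ℝ E] {k : ℕ} (η : ∀ x : M, AltTangent E k x)
    (hη : ContMDiff 𝓘(ℝ, E) (𝓘(ℝ, E).prod 𝓘(ℝ, E [⋀^Fin k]→L[ℝ] ℝ)) ∞
      (fun x => Bundle.TotalSpace.mk' (E [⋀^Fin k]→L[ℝ] ℝ) x (η x)))
    (x₀ : M) {y : E} (hy : y ∈ (chartAt E x₀).target) :
    localRep (extDerivForm η) x₀ y = extDeriv (localRep η x₀) y := by
  set x := (chartAt E x₀).symm y with hx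
  have hxs : x ∈ (chartAt E x).source := mem_chart_source E x
  have hz : y ∈ ((chartAt E x₀).symm.trans (chartAt E x)).source := by
    exact ⟨hy, hxs⟩
  have hev : localRep η x₀ =ᶠ[𝓝 y] fun z =>
      (localRep η x ((chartAt E x ∘ (chartAt E x₀).symm) z)).compContinuousLinearMap
        (fderiv ℝ (chartAt E x ∘ (chartAt E x₀).symm) z) := by
    filter_upwards [((chartAt E x₀).symm.trans (chartAt E x)).open_source.mem_nhds hz] with z hz
    exact localRep_eq η x₀ x hz
  have hd : DifferentiableAt ℝ (localRep η x) ((chartAt E x ∘ (chartAt E x₀).symm) y) :=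
    ((contMDiffAt_form_iff η x).1 (hη x)).differentiableAt (by simp)
  rw [hev.extDeriv_eq, extDeriv_pullback hd (contDiffAt_chart_change x₀ x hz)
      (by simpa using ENat.LEInfty.out),
    fderiv_chart_change x₀ x hz]
  rfl

theorem contMDiff_extDerivForm [FiniteDimensional ℝ E] {k : ℕ} (η : ∀ x : M, AltTangent E k x)
    (hη : ContMDiff 𝓘(ℝ, E) (𝓘(ℝ, E).prod 𝓘(ℝ, E [⋀^Fin k]→L[ℝ] ℝ)) ∞
      (fun x => Bundle.TotalSpace.mk' (E [⋀^Fin k]→L[ℝ] ℝ) x (η x))) :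
    ContMDiff 𝓘(ℝ, E) (𝓘(ℝ, E).prod 𝓘(ℝ, E [⋀^Fin (k + 1)]→L[ℝ] ℝ)) ∞
      (fun x => Bundle.TotalSpace.mk' (E [⋀^Fin (k + 1)]→L[ℝ] ℝ) x (extDerivForm η x)) := by
  intro x₀
  rw [contMDiffAt_form_iff]
  have hx : chartAt E x₀ x₀ ∈ (chartAt E x₀).target := mem_chart_target E x₀
  have hev : localRep (extDerivForm η) x₀ =ᶠ[𝓝 (chartAt E x₀ x₀)] extDeriv (localRep η x₀) := by
    filter_upwards [(chartAt E x₀).open_target.mem_nhds hx] with y hy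
    exact localRep_extDerivForm η hη x₀ hy
  refine ContDiffAt.congr_of_eventuallyEq ?_ hev
  have h := (contMDiffAt_form_iff η x₀).1 (hη x₀)
  have h1 : ContDiffAt ℝ ∞ (fderiv ℝ (localRep η x₀)) (chartAt E x₀ x₀) :=
    h.fderiv_right (by simp)
  exact (ContinuousAlternatingMap.alternatizeUncurryFinCLM ℝ E ℝ).contDiff.contDiffAt.comp _ h1

/-- The space `Ω^k(M)` of smooth `k`-forms. -/
abbrev DiffForm (E : Type*) [NormedAddCommGroup E] [NormedSpace ℝ E] 
  (M : Type*) [TopologicalSpace M] [ChartedSpace E M] [IsManifold 𝓘(ℝ, E) ∞ M] (k : ℕ) : Type _ :=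
  Cₛ^∞⟮𝓘(ℝ, E); E [⋀^Fin k]→L[ℝ] ℝ, fun x : M => AltTangent E k x⟯

theorem extDerivForm_add {k : ℕ} (η ζ : ∀ x : M, AltTangent E k x) (x : M)
    (hη : DifferentiableAt ℝ (localRep η x) (chartAt E x x))
    (hζ : DifferentiableAt ℝ (localRep ζ x) (chartAt E x x)) :
    extDerivForm (η + ζ) x = extDerivForm η x + extDerivForm ζ x := by
  have h : localRep (η + ζ) x = localRep η x + localRep ζ x := rfl
  simp only [extDerivForm, h, extDeriv_add hη hζ]
  rfl

theorem extDerivForm_smul {k : ℕ} (c : ℝ) (η : ∀ x : M, AltTangent E k x) (x : M) :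
    extDerivForm (c • η) x = c • extDerivForm η x := by
  have h : localRep (c • η) x = c • localRep η x := rfl
  simp only [extDerivForm, h, extDeriv_smul]
  rfl

theorem differentiableAt_localRep [FiniteDimensional ℝ E] {k : ℕ} (η : DiffForm E M k) (x : M) :
    DifferentiableAt ℝ (localRep η x) (chartAt E x x) :=
  ((contMDiffAt_form_iff η x).1 (η.contMDiff x)).differentiableAt (by simp)

/-- The exterior derivative on smooth `k`-forms. -/
def extD [FiniteDimensional ℝ E] (k : ℕ) : DiffForm E M k →ₗ[ℝ] DiffForm E M (k + 1) where
  toFun η := ⟨extDerivForm η, contMDiff_extDerivForm η η.contMDiff⟩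
  map_add' η ζ := ContMDiffSection.ext fun x =>
    extDerivForm_add η ζ x (differentiableAt_localRep η x) (differentiableAt_localRep ζ x)
  map_smul' c η := ContMDiffSection.ext fun x => extDerivForm_smul c η x

section Algebraic

/-- A smooth algebraic operator from `k`-forms to `l`-forms: a field of linear maps acting
pointwise and mapping smooth forms to smooth forms. -/
structure AlgOp (E : Type*) [NormedAddCommGroup E] [NormedSpace ℝ E]
    (M : Type*) [TopologicalSpace M] [ChartedSpace E M] [IsManifold 𝓘(ℝ, E) ∞ M] (k l : ℕ) where
  fib : ∀ x : M, AltTangent E k x →ₗ[ℝ] AltTangent E l x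
  smooth : ∀ α : DiffForm E M k,
    ContMDiff 𝓘(ℝ, E) (𝓘(ℝ, E).prod 𝓘(ℝ, E [⋀^Fin l]→L[ℝ] ℝ)) ∞
      (fun x => Bundle.TotalSpace.mk' (E [⋀^Fin l]→L[ℝ] ℝ) x (fib x (α x)))

/-- The action of an algebraic operator on smooth forms. -/
def AlgOp.onForms {k l : ℕ} (T : AlgOp E M k l) : DiffForm E M k →ₗ[ℝ] DiffForm E M l where
  toFun α := ⟨fun x => T.fib x (α x), T.smooth α⟩
  map_add' α β := by
    ext1 x
    exact (T.fib x).map_add (α x) (β x)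
  map_smul' c α := by
    ext1 x
    exact (T.fib x).map_smul c (α x)

end Algebraic

section Filtered

/-- The vector field `X` on `M` is smooth. -/
def IsSmoothField (X : ∀ x : M, TangentSpace 𝓘(ℝ, E) x) : Prop :=
  ContMDiff 𝓘(ℝ, E) 𝓘(ℝ, E).tangent ∞ (fun x => (⟨x, X x⟩ : TangentBundle 𝓘(ℝ, E) M))

/-- A structure of filtered manifold on `M`: smooth subbundles
`0 = H 0 ⊆ H 1 ⊆ … ⊆ H depth = TM` (and `H i = TM` for `i > depth`) such that the bracket of a
section of `H i` and a section of `H j` is a section of `H (i + j)`. -/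
structure FilteredManifold (E : Type*) [NormedAddCommGroup E] [NormedSpace ℝ E]
    (M : Type*) [TopologicalSpace M] [ChartedSpace E M] [IsManifold 𝓘(ℝ, E) ∞ M] where
  H : ℕ → ∀ x : M, Submodule ℝ (TangentSpace 𝓘(ℝ, E) x)
  depth : ℕ
  zero : ∀ x, H 0 x = ⊥
  mono : ∀ x, Monotone fun i => H i x
  top : ∀ x, H depth x = ⊤
  /-- The `H i` are smooth subbundles: near each point there is a smooth frame of `TM` adapted to
  them, the part of the frame of weight at most `i` being a frame of `H i`. -/
  smooth : ∀ x₀ : M, ∃ (U : Set M) (n : ℕ) (X : Fin n → ∀ x : M, TangentSpace 𝓘(ℝ, E) x)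
    (υ : Fin n → ℕ), IsOpen U ∧ x₀ ∈ U ∧ IsLocalFrameOn 𝓘(ℝ, E) E ∞ X U ∧
      ∀ x ∈ U, ∀ i, H i x = Submodule.span ℝ {v | ∃ a, υ a ≤ i ∧ X a x = v}
  lie_mem : ∀ (i j : ℕ) (X Y : ∀ x : M, TangentSpace 𝓘(ℝ, E) x),
    IsSmoothField X → IsSmoothField Y → (∀ x, X x ∈ H i x) → (∀ x, Y x ∈ H j x) →
      ∀ x, VectorField.mlieBracket 𝓘(ℝ, E) X Y x ∈ H (i + j) x

namespace FilteredManifold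

variable (𝓗 : FilteredManifold E M)

/-- The fibre at `x` of the filtration of the tangent bundle. -/
abbrev fil (x : M) : ℕ → Submodule ℝ (TangentSpace 𝓘(ℝ, E) x) := fun i => 𝓗.H i x

/-- `gr (T_x M)`. -/
abbrev gr (x : M) : Type _ := Gr (𝓗.fil x) 𝓗.depth

/-- `b` is the osculating bracket at `x`: `[⟨X⟩_i, ⟨Y⟩_j] = ⟨[X, Y]⟩_{i + j}` for all smooth
sections `X` of `H i` and `Y` of `H j`. -/
def IsOscBracket (x : M) (b : 𝓗.gr x →ₗ[ℝ] 𝓗.gr x →ₗ[ℝ] 𝓗.gr x) : Prop :=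
  ∀ (i j : ℕ) (X Y : ∀ x : M, TangentSpace 𝓘(ℝ, E) x) (hX : IsSmoothField X)
    (hY : IsSmoothField Y) (hXi : ∀ x, X x ∈ 𝓗.H i x) (hYj : ∀ x, Y x ∈ 𝓗.H j x),
    b (grClass (𝓗.fil x) 𝓗.depth i (X x) (hXi x)) (grClass (𝓗.fil x) 𝓗.depth j (Y x) (hYj x)) =
      grClass (𝓗.fil x) 𝓗.depth (i + j) (VectorField.mlieBracket 𝓘(ℝ, E) X Y x)
        (𝓗.lie_mem i j X Y hX hY hXi hYj x)

open Classical in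
/-- The osculating Lie bracket on `gr (T_x M)`: the bilinear map satisfying `IsOscBracket`. It is
unique because every vector of `H i` at `x` extends to a smooth section of `H i`, and it exists
because `[X, Y] mod H (i + j - 1)` depends only on the classes of `X` and `Y` at `x`. -/
def oscBracket (x : M) : 𝓗.gr x →ₗ[ℝ] 𝓗.gr x →ₗ[ℝ] 𝓗.gr x :=
  if h : ∃ b, 𝓗.IsOscBracket x b then h.choose else 0

/-- The osculating differential: the Chevalley--Eilenberg differential of the osculating Lie
algebra at `x`. -/
def oscDiff (x : M) (k : ℕ) :
    (𝓗.gr x [⋀^Fin k]→ₗ[ℝ] ℝ) →ₗ[ℝ] (𝓗.gr x [⋀^Fin (k + 1)]→ₗ[ℝ] ℝ) :=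
  ceDiff (𝓗.oscBracket x) k

/-- The forms of weight at least `w`. -/
def FormWeightGE (w : ℕ) {k : ℕ} (α : DiffForm E M k) : Prop :=
  ∀ x, HasWeightGE (𝓗.fil x) w fun v => α x v

/-- At the point `x`, `T` is the graded map of the filtration-preserving map `D`: for every
weight `w`, if `β` is the class of a `k`-covector `α` of weight at least `w`, then `T β` is the
class of `D α`. -/
def IsGr (x : M) {k l : ℕ} (D : AltTangent E k x →ₗ[ℝ] AltTangent E l x)
    (T : (𝓗.gr x [⋀^Fin k]→ₗ[ℝ] ℝ) →ₗ[ℝ] (𝓗.gr x [⋀^Fin l]→ₗ[ℝ] ℝ)) : Prop :=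
  ∀ (w : ℕ) (α : AltTangent E k x) (β : 𝓗.gr x [⋀^Fin k]→ₗ[ℝ] ℝ),
    HasSymbol (𝓗.fil x) 𝓗.depth w (fun v => α v) β →
      HasSymbol (𝓗.fil x) 𝓗.depth w (fun v => D α v) (T β)

end FilteredManifold

end Filtered

section Complexes

/-- The space `Ω^•(M)` of all smooth forms. As there are no nonzero forms of degree larger than
the dimension, the product over all degrees is the direct sum. -/
def AllForms (E : Type*) [NormedAddCommGroup E] [NormedSpace ℝ E]
    (M : Type*) [TopologicalSpace M] [ChartedSpace E M] [IsManifold 𝓘(ℝ, E) ∞ M] : Type _ :=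
  ∀ k : ℕ, DiffForm E M k

instance : AddCommGroup (AllForms E M) :=
  inferInstanceAs (AddCommGroup (∀ k : ℕ, DiffForm E M k))

instance : Module ℝ (AllForms E M) :=
  inferInstanceAs (Module ℝ (∀ k : ℕ, DiffForm E M k))

/-- The operator on `Ω^•(M)` with the components `T k : Ω^k(M) → Ω^{k+1}(M)`. -/
def raise (T : ∀ k, DiffForm E M k →ₗ[ℝ] DiffForm E M (k + 1)) :
    Module.End ℝ (AllForms E M) where
  toFun α := fun k => match k with
    | 0 => 0
    | k + 1 => T k (α k)
  map_add' α β := by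
    funext k
    cases k with
    | zero => exact (add_zero _).symm
    | succ k => exact (T k).map_add (α k) (β k)
  map_smul' c α := by
    funext k
    cases k with
    | zero => exact ((LinearMap.lsmul ℝ (DiffForm E M 0) c).map_zero).symm
    | succ k => exact (T k).map_smul c (α k)

/-- The operator on `Ω^•(M)` with the components `T k : Ω^{k+1}(M) → Ω^k(M)`, zero on `Ω^0(M)`. -/
def lower (T : ∀ k, DiffForm E M (k + 1) →ₗ[ℝ] DiffForm E M k) :
    Module.End ℝ (AllForms E M) where
  toFun α := fun k => T k (α (k + 1))
  map_add' α β := funext fun k => (T k).map_add (α (k + 1)) (β (k + 1))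
  map_smul' c α := funext fun k => (T k).map_smul c (α (k + 1))

/-- The forms of degree `k` in `Ω^•(M)`. -/
def degreePart (E : Type*) [NormedAddCommGroup E] [NormedSpace ℝ E]
    (M : Type*) [TopologicalSpace M] [ChartedSpace E M] [IsManifold 𝓘(ℝ, E) ∞ M] (k : ℕ) :
    Submodule ℝ (AllForms E M) where
  carrier := {α | ∀ l, l ≠ k → α l = 0}
  add_mem' hα hβ := fun l hl =>
    (congrArg₂ (· + ·) (hα l hl) (hβ l hl)).trans (add_zero _)
  zero_mem' := fun _ _ => rfl
  smul_mem' c _ hα := fun l hl => (congrArg (c • ·) (hα l hl)).trans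
    (LinearMap.lsmul ℝ (DiffForm E M l) c).map_zero

/-- The de Rham differential on `Ω^•(M)`. -/
def deRham [FiniteDimensional ℝ E] : Module.End ℝ (AllForms E M) := raise extD

/-- The `k`-th cohomology of the complex formed by the homogeneous parts of the graded subspace
`S` of `Ω^•(M)` and the operator `T` of degree `1` on it: the cocycles
`{α ∈ S^k | T α = 0}` modulo the coboundaries `T (S^{k-1})` (none in degree `0`). -/
abbrev Cohomology (S : Submodule ℝ (AllForms E M)) (T : Module.End ℝ (AllForms E M)) (k : ℕ) :
    Type _ :=
  ↥(S ⊓ degreePart E M k ⊓ LinearMap.ker T) ⧸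
    (⨆ (j : ℕ) (_ : j + 1 = k), (S ⊓ degreePart E M j).map T).submoduleOf
      (S ⊓ degreePart E M k ⊓ LinearMap.ker T)

end Complexes

section Base

variable [FiniteDimensional ℝ E]

instance finiteDimensional_tangentSpace (x : M) :
    FiniteDimensional ℝ (TangentSpace 𝓘(ℝ, E) x) :=
  inferInstanceAs (FiniteDimensional ℝ E)

variable [Bundle.RiemannianBundle (fun x : M => TangentSpace 𝓘(ℝ, E) x)]

/-- A pair `(d₀, δ₀)` of base differential and codifferential: algebraic complexes of degree `1`
and `-1` that respect the filtration, are disjoint, and have the graded maps below. `dOp k` is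
`d₀` on `k`-forms, `deltaOp k` is `δ₀` on `(k+1)`-forms. -/
structure BasePair (𝓗 : FilteredManifold E M) where
  dOp : ∀ k : ℕ, AlgOp E M k (k + 1)
  deltaOp : ∀ k : ℕ, AlgOp E M (k + 1) k
  dOp_sq : ∀ k (α : DiffForm E M k), (dOp (k + 1)).onForms ((dOp k).onForms α) = 0
  deltaOp_sq : ∀ k (α : DiffForm E M (k + 2)), (deltaOp k).onForms ((deltaOp (k + 1)).onForms α) = 0
  dOp_weight : ∀ k w (α : DiffForm E M k),
    𝓗.FormWeightGE w α → 𝓗.FormWeightGE w ((dOp k).onForms α)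
  deltaOp_weight : ∀ k w (α : DiffForm E M (k + 1)),
    𝓗.FormWeightGE w α → 𝓗.FormWeightGE w ((deltaOp k).onForms α)
  /-- `d₀` and `δ₀` are disjoint. -/
  disjoint_dOp : ∀ α : AllForms E M,
    lower (fun k => (deltaOp k).onForms) (raise (fun k => (dOp k).onForms) α) = 0 →
      raise (fun k => (dOp k).onForms) α = 0
  disjoint_deltaOp : ∀ α : AllForms E M,
    raise (fun k => (dOp k).onForms) (lower (fun k => (deltaOp k).onForms) α) = 0 →
      lower (fun k => (deltaOp k).onForms) α = 0
  /-- The graded map of `d₀` is the osculating differential. -/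
  gr_dOp : ∀ k x, 𝓗.IsGr x ((dOp k).fib x) (𝓗.oscDiff x k)
  /-- The graded map of `δ₀` is the transpose of the osculating differential. -/
  gr_deltaOp : ∀ k x, ∃ T, IsTranspose (𝓗.fil x) 𝓗.depth (𝓗.oscDiff x k) T ∧
      𝓗.IsGr x ((deltaOp k).fib x) T

open Classical in
/-- The generalised kernel projection of an operator `T`: the projection onto
`⋃ n, ker (T ^ n)` along `⋂ n, range (T ^ n)`, when these are complementary (else `0`). -/
def genKerProj {W : Type*} [AddCommGroup W] [Module ℝ W] (T : Module.End ℝ W) :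
    Module.End ℝ W :=
  if h : IsCompl (⨆ n : ℕ, LinearMap.ker (T ^ n)) (⨅ n : ℕ, LinearMap.range (T ^ n)) then
    Submodule.projection _ _ h
  else 0

namespace BasePair

variable {𝓗 : FilteredManifold E M} (B : BasePair 𝓗)

/-- `d₀` on `Ω^•(M)`. -/
def d0 : Module.End ℝ (AllForms E M) := raise fun k => (B.dOp k).onForms

/-- `δ₀` on `Ω^•(M)`. -/
def delta0 : Module.End ℝ (AllForms E M) := lower fun k => (B.deltaOp k).onForms

/-- The base box `□₀ = d₀ δ₀ + δ₀ d₀`. -/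
def box0 : Module.End ℝ (AllForms E M) := B.d0 * B.delta0 + B.delta0 * B.d0

/-- The box `□ = d δ₀ + δ₀ d`. -/
def box : Module.End ℝ (AllForms E M) := deRham * B.delta0 + B.delta0 * deRham

/-- The base kernel projection `Π₀`. -/
def Pi0 : Module.End ℝ (AllForms E M) := genKerProj B.box0

/-- The generalised kernel projection `P` of `□`. -/
def P : Module.End ℝ (AllForms E M) := genKerProj B.box

/-- `L = P Π₀ + (1 - P) (1 - Π₀)`. -/
def L : Module.End ℝ (AllForms E M) := B.P * B.Pi0 + (1 - B.P) * (1 - B.Pi0)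

/-- `C = L⁻¹ d L (1 - Π₀)`. -/
def C : Module.End ℝ (AllForms E M) := Ring.inverse B.L * deRham * B.L * (1 - B.Pi0)

/-- `F₀ = Im d₀ + Im δ₀`. -/
def F0 : Submodule ℝ (AllForms E M) := LinearMap.range B.d0 ⊔ LinearMap.range B.delta0

theorem box0_mem (α : AllForms E M) (_ : α ∈ B.F0) : B.box0 α ∈ B.F0 :=
  Submodule.add_mem_sup ⟨_, rfl⟩ ⟨_, rfl⟩

theorem d0_mem (α : AllForms E M) (_ : α ∈ B.F0) : B.d0 α ∈ B.F0 :=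
  Submodule.mem_sup_left ⟨_, rfl⟩

/-- The restriction of `□₀` to `F₀`. -/
def box0F : Module.End ℝ B.F0 := B.box0.restrict B.box0_mem

/-- The restriction of `d₀` to `F₀`. -/
def d0F : Module.End ℝ B.F0 := B.d0.restrict B.d0_mem

/-- `□₀⁻¹ : F₀ → F₀`. -/
def boxInv : Module.End ℝ B.F0 := Ring.inverse B.box0F

/-- `g = C δ₀ □₀⁻¹ + δ₀ □₀⁻¹ d₀` on `F₀`. -/
def g : B.F0 →ₗ[ℝ] AllForms E M :=
  B.C ∘ₗ B.delta0 ∘ₗ B.F0.subtype ∘ₗ B.boxInv +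
    B.delta0 ∘ₗ B.F0.subtype ∘ₗ B.boxInv ∘ₗ B.d0F

end BasePair

end Base

end Forms

end FilteredComplex

end

open FilteredComplex

open scoped Manifold ContDiff Bundle Topology

noncomputable section

namespace FilteredComplex

section

/-! ### Fitting decompositions in infinite dimension, and their stability under perturbation -/

section Fitting

variable {W : Type*} [AddCommGroup W] [Module ℝ W]

/-! Forms are filtered by weight. The filtration is finite: weight at least `0` is no condition, and
a nonzero form has weight at most `dim E * depth`. Everything follows from the fact that `d - d₀`
raises the weight. By Cartan's formula the symbol of `d` is the Chevalley–Eilenberg differential of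
the osculating algebra (`hasSymbol_extD`), and `d₀` has the same symbol by assumption. Hence `□ - □₀
= (d - d₀)δ₀ + δ₀(d - d₀)` raises the weight as well.

The unperturbed operator splits. Disjointness gives `ker □₀² = ker □₀` algebraically. The equality
of the ranges of `□₀` and `□₀²`, in each weight, needs smooth solutions (`exists_box0_box0`). By
Cayley–Hamilton, `□₀` is inverted away from its generalised kernel by a polynomial in `□₀` with
coefficients rational in those of the fibrewise characteristic polynomial. These coefficients are
smooth provided the multiplicity of the root `0` is locally constant. The graded map of `□₀` is a
Hodge Laplacian, so this multiplicity equals the dimension of its kernel, that is, the dimension of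
the space of forms minus two ranks of the osculating differential. These ranks are locally constant
by hypothesis.

Perturbation theory in a finite filtration (`FilteredPerturbation`) then gives a Fitting
decomposition for `□`, and `P - Π₀` raises the weight. So `L - 1` raises the weight, and `L` is
invertible because `L - 1` is nilpotent. Since `L Π₀ = P L` and `d` commutes with `P`, the conjugate
`L⁻¹ d L` commutes with `Π₀`, and `C` is its restriction to `F₀ = ker Π₀ = Im □₀`, extended by zero.
This gives `C² = 0`.

On `F₀` one has `1 = d₀ δ₀ □₀⁻¹ + δ₀ □₀⁻¹ d₀`, so `g - 1 = (C - d₀) δ₀ □₀⁻¹` raises the weight and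
`g` is invertible. From `C² = 0 = d₀²` both `C g` and `g d₀` equal `C δ₀ □₀⁻¹ d₀`. The first
identity is a contracting homotopy for `d₀` on `F₀`, and `g` carries the acyclicity over to `C`. -/

theorem iSup_ker_pow_eq {T : Module.End ℝ W} {n : ℕ}
    (hker : ∀ k v, (T ^ k) v = 0 → (T ^ n) v = 0) :
    (⨆ k : ℕ, LinearMap.ker (T ^ k)) = LinearMap.ker (T ^ n) :=
  le_antisymm (iSup_le fun k v hv => hker k v hv) (le_iSup (fun k => LinearMap.ker (T ^ k)) n)

theorem exists_pow_eq_pow_add {T : Module.End ℝ W} {n : ℕ} {S : Submodule ℝ W}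
    (hran : ∀ v ∈ S, ∃ u ∈ S, (T ^ n) v = (T ^ (n + 1)) u) (k : ℕ) :
    ∀ v ∈ S, ∃ u ∈ S, (T ^ n) v = (T ^ (n + k)) u := by
  induction k with
  | zero => exact fun v hv => ⟨v, hv, rfl⟩
  | succ k ih =>
    intro v hv
    obtain ⟨u, hu, h⟩ := ih v hv
    obtain ⟨t, ht, h'⟩ := hran u hu
    refine ⟨t, ht, ?_⟩
    rw [h, add_comm n k, pow_add, Module.End.mul_apply, h', ← Module.End.mul_apply, ← pow_add]
    congr 2
    ring

theorem iInf_range_pow_eq {T : Module.End ℝ W} {n : ℕ}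
    (hran : ∀ v, ∃ u, (T ^ n) v = (T ^ (n + 1)) u) :
    (⨅ k : ℕ, LinearMap.range (T ^ k)) = LinearMap.range (T ^ n) := by
  refine le_antisymm (iInf_le (fun k => LinearMap.range (T ^ k)) n) (le_iInf fun k => ?_)
  rintro _ ⟨v, rfl⟩
  obtain ⟨u, -, h⟩ := exists_pow_eq_pow_add (S := ⊤) (fun v _ => by simpa using hran v) k v trivial
  rw [h, add_comm, pow_add]
  exact ⟨_, rfl⟩

/-- Fitting's lemma. The two chains must be assumed stationary separately, since no dimension is
finite. Then `ker T^(2n) = ker T^n` makes the intersection trivial, and `T^n v = T^(2n) u` splits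
`v` as `(v - T^n u) + T^n u`. -/
theorem isCompl_iSup_ker_iInf_range {T : Module.End ℝ W} {n : ℕ}
    (hker : ∀ k v, (T ^ k) v = 0 → (T ^ n) v = 0) (hran : ∀ v, ∃ u, (T ^ n) v = (T ^ (n + 1)) u) :
    IsCompl (⨆ k : ℕ, LinearMap.ker (T ^ k)) (⨅ k : ℕ, LinearMap.range (T ^ k)) := by
  rw [iSup_ker_pow_eq hker, iInf_range_pow_eq hran]
  constructor
  · rw [Submodule.disjoint_def]
    rintro _ hv ⟨u, rfl⟩
    rw [LinearMap.mem_ker, ← Module.End.mul_apply, ← pow_add] at hv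
    exact hker _ _ hv
  · rw [codisjoint_iff, eq_top_iff]
    intro v _
    obtain ⟨u, -, h⟩ := exists_pow_eq_pow_add (S := ⊤) (fun v _ => by simpa using hran v) n v trivial
    refine Submodule.mem_sup.2 ⟨v - (T ^ n) u, ?_, (T ^ n) u, ⟨u, rfl⟩, sub_add_cancel _ _⟩
    rw [LinearMap.mem_ker, map_sub, h, pow_add, Module.End.mul_apply, sub_self]

section GenKerProj

variable {T : Module.End ℝ W}
  (h : IsCompl (⨆ k : ℕ, LinearMap.ker (T ^ k)) (⨅ k : ℕ, LinearMap.range (T ^ k)))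
include h

theorem genKerProj_eq_self {v : W} {k : ℕ} (hv : (T ^ k) v = 0) : genKerProj T v = v := by
  rw [genKerProj, dif_pos h]
  exact Submodule.projection_apply_left h
    ⟨v, (le_iSup (fun k => LinearMap.ker (T ^ k)) k) hv⟩

theorem genKerProj_eq_zero {v : W} (hv : v ∈ ⨅ k : ℕ, LinearMap.range (T ^ k)) :
    genKerProj T v = 0 := by
  rw [genKerProj, dif_pos h]
  exact (Submodule.projection_apply_eq_zero_iff h).2 hv

/-- An operator commuting with `T` preserves both summands. This is the source of `d P = P d`, of
`Π₀ d₀ = d₀ Π₀`, and of the compatibility of both projections with the degree. -/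
theorem genKerProj_comm {S : Module.End ℝ W} (hS : S * T = T * S) :
    S * genKerProj T = genKerProj T * S := by
  ext v
  have hp : ∀ k, S * T ^ k = T ^ k * S := fun k => (Commute.pow_right hS k : Commute S (T ^ k))
  obtain ⟨a, ha, b, hb, rfl⟩ := Submodule.mem_sup.1 (h.sup_eq_top ▸ Submodule.mem_top (x := v))
  have ha' : S a ∈ ⨆ k : ℕ, LinearMap.ker (T ^ k) := by
    have : (⨆ k : ℕ, LinearMap.ker (T ^ k)) ≤ (⨆ k : ℕ, LinearMap.ker (T ^ k)).comap S := by
      refine iSup_le fun k v hv => (le_iSup (fun k => LinearMap.ker (T ^ k)) k) ?_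
      rw [LinearMap.mem_ker, ← Module.End.mul_apply, ← hp, Module.End.mul_apply, hv, map_zero]
    exact this ha
  have hb' : S b ∈ ⨅ k : ℕ, LinearMap.range (T ^ k) := by
    rw [Submodule.mem_iInf] at hb ⊢
    intro k
    obtain ⟨u, rfl⟩ := hb k
    exact ⟨S u, by rw [← Module.End.mul_apply, ← hp, Module.End.mul_apply]⟩
  have key : ∀ c ∈ ⨆ k : ℕ, LinearMap.ker (T ^ k), genKerProj T c = c := fun c hc => by
    rw [genKerProj, dif_pos h]
    exact Submodule.projection_apply_left h ⟨c, hc⟩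
  simp only [Module.End.mul_apply, map_add, key a ha, key _ ha', genKerProj_eq_zero h hb,
    genKerProj_eq_zero h hb', map_zero]

theorem genKerProj_idem : genKerProj T * genKerProj T = genKerProj T := by
  rw [genKerProj, dif_pos h]
  exact Submodule.isIdempotentElem_projection h

end GenKerProj

/-- With respect to the decreasing filtration `Ω`, with `Ω 0 = ⊤` and `Ω n = ⊥`, the operator `B`
agrees with `A` up to higher weight, and `A` splits every `Ω w` into its kernel and its range. -/
structure FilteredPerturbation (Ω : ℕ → Submodule ℝ W) (n : ℕ) (A B : Module.End ℝ W) : Prop where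
  anti : Antitone Ω
  zero : Ω 0 = ⊤
  last : Ω n = ⊥
  mem : ∀ w, ∀ v ∈ Ω w, A v ∈ Ω w
  ker : ∀ v, A (A v) = 0 → A v = 0
  range : ∀ w, ∀ v ∈ Ω w, ∃ u ∈ Ω w, A v = A (A u)
  sub : ∀ w, ∀ v ∈ Ω w, B v - A v ∈ Ω (w + 1)

/-! ### Perturbations that raise the weight -/

namespace FilteredPerturbation

variable {Ω : ℕ → Submodule ℝ W} {n : ℕ} {A B : Module.End ℝ W} (h : FilteredPerturbation Ω n A B)
include h

theorem refl : FilteredPerturbation Ω n A A :=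
  { h with sub := fun w v _ => by simp }

theorem mem_right {w : ℕ} {v : W} (hv : v ∈ Ω w) : B v ∈ Ω w := by
  rw [← sub_add_cancel (B v) (A v)]
  exact add_mem (h.anti (Nat.le_succ w) (h.sub w v hv)) (h.mem w v hv)

theorem pow_mem_right {w : ℕ} {v : W} (hv : v ∈ Ω w) (k : ℕ) : (B ^ k) v ∈ Ω w := by
  induction k with
  | zero => exact hv
  | succ k ih => rw [pow_succ', Module.End.mul_apply]; exact h.mem_right ih

theorem range_mod {w : ℕ} {v : W} (hv : v ∈ Ω w) : ∃ u ∈ Ω w, B v - B (B u) ∈ Ω (w + 1) := by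
  obtain ⟨u, hu, e⟩ := h.range w v hv
  refine ⟨u, hu, ?_⟩
  have : B v - B (B u) = (B v - A v) - (B (B u) - A (B u)) - A (B u - A u) := by
    rw [map_sub, e]; abel
  rw [this]
  exact sub_mem (sub_mem (h.sub _ _ hv) (h.sub _ _ (h.mem_right hu)))
    (h.mem _ _ (h.sub _ _ hu))

/-- Strictness of `A` with respect to the filtration: an element of weight `w` in the range of `A²`
forces `A v` itself to have weight `w`. The splitting is used twice to replace `v` by some `u1 ∈ Ω
w` with the same image under `A`. -/
theorem mem_succ_of_A {w : ℕ} {v : W} (hA : A (A v) ∈ Ω w) : A v ∈ Ω w := by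
  obtain ⟨u, hu, e⟩ := h.range w _ hA
  obtain ⟨u1, hu1, e1⟩ := h.range w _ hu
  have h1 : A (A (A v - u)) = 0 := by rw [map_sub, map_sub, e, sub_self]
  have h2 : A (A v) = A u := by simpa [sub_eq_zero] using h.ker _ h1
  have h3 : A (A (v - u1)) = 0 := by rw [map_sub, map_sub, h2, e1, sub_self]
  have h4 : A v = A u1 := by simpa [sub_eq_zero] using h.ker _ h3
  rw [h4]
  exact h.mem _ _ hu1

theorem mem_succ_of_B {w : ℕ} {v : W} (hv : v ∈ Ω w) (hB : B (B v) ∈ Ω (w + 1)) :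
    B v ∈ Ω (w + 1) := by
  have h1 : A (A v) ∈ Ω (w + 1) := by
    have : A (A v) = B (B v) - (B (B v) - A (B v)) - A (B v - A v) := by rw [map_sub]; abel
    rw [this]
    exact sub_mem (sub_mem hB (h.sub _ _ (h.mem_right hv))) (h.mem _ _ (h.sub _ _ hv))
  rw [← sub_add_cancel (B v) (A v)]
  exact add_mem (h.sub _ _ hv) (h.mem_succ_of_A h1)

theorem mem_succ_of_pow {w : ℕ} {v : W} (hv : v ∈ Ω w) (k : ℕ) (hB : (B ^ k) v ∈ Ω (w + 1)) :
    B v ∈ Ω (w + 1) := by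
  induction k generalizing v with
  | zero => exact h.mem_right hB
  | succ k ih =>
    rw [pow_succ, Module.End.mul_apply] at hB
    exact h.mem_succ_of_B hv (ih (h.mem_right hv) hB)

/-- On the generalised kernel every application of `B` gains one weight, so `B ^ n` already vanishes
there. -/
theorem pow_mem_of_ker {k : ℕ} {v : W} (hv : (B ^ k) v = 0) (w : ℕ) : (B ^ w) v ∈ Ω w := by
  induction w with
  | zero => rw [h.zero]; trivial
  | succ w ih =>
    rw [pow_succ', Module.End.mul_apply]
    refine h.mem_succ_of_pow ih k ?_
    rw [← Module.End.mul_apply, ← pow_add, add_comm k w, pow_add, Module.End.mul_apply, hv, map_zero]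
    exact zero_mem _

theorem ker_stable (k : ℕ) (v : W) (hv : (B ^ k) v = 0) : (B ^ n) v = 0 := by
  simpa [h.last] using h.pow_mem_of_ker hv n

/-- Descending induction on the weight, where `j` bounds the number of weights left before the
filtration reaches `0`. Modulo weight `w + 1` the solution is the one for `A`, and the error is
handled one weight higher. -/
theorem range_aux (j : ℕ) : ∀ w, n ≤ w + j → ∀ v ∈ Ω w, ∃ u ∈ Ω w, (B ^ j) v = (B ^ (j + 1)) u := by
  induction j with
  | zero =>
    intro w hw v hv
    have : v = 0 := by simpa [h.last] using h.anti hw hv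
    exact ⟨0, zero_mem _, by simp [this]⟩
  | succ j ih =>
    intro w hw v hv
    obtain ⟨u, hu, e⟩ := h.range_mod hv
    obtain ⟨t, ht, e1⟩ := ih (w + 1) (by omega) _ e
    -- A single use of the induction hypothesis yields only `B ^ (j + 1) t`. The second one gains
    -- the missing power of `B`.
    obtain ⟨s, hs, e2⟩ := ih (w + 1) (by omega) _ ht
    refine ⟨u + s, add_mem hu (h.anti (Nat.le_succ w) hs), ?_⟩
    have e3 : (B ^ (j + 1)) t = (B ^ (j + 2)) s := by
      rw [pow_succ', Module.End.mul_apply, e2, ← Module.End.mul_apply, ← pow_succ']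
    have e4 : (B ^ j) (B v) = (B ^ (j + 1)) v := by rw [← Module.End.mul_apply, ← pow_succ]
    have e5 : (B ^ j) (B (B u)) = (B ^ (j + 2)) u := by
      rw [← Module.End.mul_apply, ← Module.End.mul_apply, mul_assoc, ← pow_two, ← pow_add]
    rw [map_sub, e3, e4, e5] at e1
    rw [map_add, ← e1]
    abel

theorem range_stable {w : ℕ} {v : W} (hv : v ∈ Ω w) :
    ∃ u ∈ Ω w, (B ^ n) v = (B ^ (n + 1)) u :=
  h.range_aux n w (by omega) v hv

theorem isCompl :
    IsCompl (⨆ k : ℕ, LinearMap.ker (B ^ k)) (⨅ k : ℕ, LinearMap.range (B ^ k)) :=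
  isCompl_iSup_ker_iInf_range h.ker_stable fun v => by
    obtain ⟨u, -, e⟩ := h.range_stable (w := 0) (v := v) (h.zero ▸ trivial)
    exact ⟨u, e⟩

/-- The Fitting decomposition is compatible with weights because the preimages under powers of `B`
can be chosen in the same `Ω w`. -/
theorem exists_decomp {w : ℕ} {v : W} (hv : v ∈ Ω w) :
    ∃ a ∈ Ω w, ∃ c ∈ Ω w, (B ^ n) a = 0 ∧ v = a + (B ^ n) c ∧ genKerProj B v = a := by
  obtain ⟨c, hc, e⟩ := exists_pow_eq_pow_add (fun v hv => h.range_stable (w := w) hv) n v hv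
  have ha : (B ^ n) (v - (B ^ n) c) = 0 := by
    rw [map_sub, e, pow_add, Module.End.mul_apply, sub_self]
  refine ⟨v - (B ^ n) c, sub_mem hv (h.pow_mem_right hc n), c, hc, ha, by abel, ?_⟩
  have hc' : (B ^ n) c ∈ ⨅ k : ℕ, LinearMap.range (B ^ k) := by
    rw [iInf_range_pow_eq (n := n) fun v => ?_]
    · exact ⟨c, rfl⟩
    · obtain ⟨u, -, e⟩ := h.range_stable (w := 0) (v := v) (h.zero ▸ trivial)
      exact ⟨u, e⟩
  have := genKerProj_eq_self h.isCompl ha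
  rwa [map_sub, genKerProj_eq_zero h.isCompl hc', sub_zero] at this

theorem genKerProj_mem {w : ℕ} {v : W} (hv : v ∈ Ω w) : genKerProj B v ∈ Ω w := by
  obtain ⟨a, ha, c, -, -, -, e⟩ := h.exists_decomp hv
  rwa [e]

theorem pow_sub_mem {w : ℕ} {v : W} (hv : v ∈ Ω w) (k : ℕ) : (B ^ k) v - (A ^ k) v ∈ Ω (w + 1) := by
  induction k with
  | zero => simp
  | succ k ih =>
    rw [pow_succ', pow_succ', Module.End.mul_apply, Module.End.mul_apply]
    have : B ((B ^ k) v) - A ((A ^ k) v) =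
      (B ((B ^ k) v) - A ((B ^ k) v)) + A ((B ^ k) v - (A ^ k) v) := by rw [map_sub]; abel
    rw [this]
    exact add_mem (h.sub _ _ (h.pow_mem_right hv k)) (h.mem _ _ ih)

theorem ker_apply {v : W} {k : ℕ} (hv : (A ^ k) v = 0) : A v = 0 := by
  induction k with
  | zero => rw [show v = 0 from hv, map_zero]
  | succ k ih =>
    cases k with
    | zero => simpa using hv
    | succ k =>
      refine ih ?_
      rw [pow_succ', Module.End.mul_apply]
      refine h.ker _ ?_
      rwa [pow_succ', pow_succ', Module.End.mul_apply, Module.End.mul_apply] at hv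

theorem isCompl_left :
    IsCompl (⨆ k : ℕ, LinearMap.ker (A ^ k)) (⨅ k : ℕ, LinearMap.range (A ^ k)) :=
  h.refl.isCompl

theorem iInf_range_left : (⨅ k : ℕ, LinearMap.range (A ^ k)) = LinearMap.range A := by
  conv_rhs => rw [← pow_one A]
  refine iInf_range_pow_eq fun v => ?_
  obtain ⟨u, -, e⟩ := h.range 0 v (h.zero ▸ trivial)
  exact ⟨u, by simpa [pow_two] using e⟩

theorem A_genKerProj (v : W) : A (genKerProj A v) = 0 := by
  obtain ⟨a, -, c, -, h1, -, e⟩ := h.refl.exists_decomp (w := 0) (v := v) (h.zero ▸ trivial)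
  rw [e]
  exact h.ker_apply h1

theorem genKerProj_of_ker {v : W} (hv : A v = 0) : genKerProj A v = v :=
  genKerProj_eq_self h.isCompl_left (k := 1) (by simpa using hv)

theorem genKerProj_of_range (v : W) : genKerProj A (A v) = 0 :=
  genKerProj_eq_zero h.isCompl_left (h.iInf_range_left ▸ ⟨v, rfl⟩)

/-- Decompose `v = a + B^n c` for `B`. Since `A^n a ≡ B^n a = 0` modulo higher weight, strictness
puts `A a` in higher weight, so the projection for `A` nearly fixes `a`. It nearly kills `B^n c ≡
A^n c`. -/
theorem genKerProj_sub_mem {w : ℕ} {v : W} (hv : v ∈ Ω w) :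
    genKerProj B v - genKerProj A v ∈ Ω (w + 1) := by
  obtain ⟨a, ha, c, hc, h1, h2, e⟩ := h.exists_decomp hv
  obtain ⟨a', ha', c', hc', h1', h2', e'⟩ := h.refl.exists_decomp ha
  have hAa : A a ∈ Ω (w + 1) := by
    refine h.refl.mem_succ_of_pow ha n ?_
    have := h.pow_sub_mem ha n
    rw [h1, zero_sub, neg_mem_iff] at this
    exact this
  have h3 : genKerProj A a - a ∈ Ω (w + 1) := by
    obtain ⟨u, hu, e1⟩ := h.range _ _ hAa
    have h5 : A (a - u) = 0 := h.ker (a - u) (by rw [map_sub, map_sub, ← e1, sub_self])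
    have h6 := h.genKerProj_of_ker h5
    rw [map_sub] at h6
    have h7 : genKerProj A a - a = genKerProj A u - u := by
      rw [← sub_eq_zero] at h6 ⊢
      rw [← h6]
      abel
    rw [h7]
    exact sub_mem (h.refl.genKerProj_mem hu) hu
  have h4 : genKerProj A ((B ^ n) c) ∈ Ω (w + 1) := by
    have h5 : genKerProj A ((A ^ n) c) = 0 := by
      refine genKerProj_eq_zero h.isCompl_left ?_
      rw [iInf_range_pow_eq (n := n) fun v => ?_]
      · exact ⟨c, rfl⟩
      · obtain ⟨u, -, e⟩ := h.refl.range_stable (w := 0) (v := v) (h.zero ▸ trivial)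
        exact ⟨u, e⟩
    have h6 := h.refl.genKerProj_mem (h.pow_sub_mem hc n)
    rwa [map_sub, h5, sub_zero] at h6
  have : genKerProj B v - genKerProj A v = -(genKerProj A a - a) - genKerProj A ((B ^ n) c) := by
    rw [e]
    conv_lhs => rw [h2, map_add]
    abel
  rw [this]
  exact sub_mem (neg_mem h3) h4

end FilteredPerturbation

/-! ### Unipotent operators of a finite filtration -/

section Unipotent

variable {Ω : ℕ → Submodule ℝ W} {n : ℕ} {U : Module.End ℝ W} (h0 : Ω 0 = ⊤) (hn : Ω n = ⊥)
  (hU : ∀ w, ∀ v ∈ Ω w, U v - v ∈ Ω (w + 1))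
include h0 hn hU

theorem isUnit_of_sub_mem : IsUnit U := by
  have h : IsNilpotent (U - 1) := by
    refine ⟨n, ?_⟩
    ext v
    have : ∀ w, ((U - 1) ^ w) v ∈ Ω w := fun w => by
      induction w with
      | zero => rw [h0]; trivial
      | succ w ih => rw [pow_succ', Module.End.mul_apply]; exact hU _ _ ih
    simpa [hn] using this n
  simpa using h.isUnit_add_one

theorem inverse_mem {w : ℕ} {v : W} (hv : v ∈ Ω w) (anti : Antitone Ω) :
    Ring.inverse U v ∈ Ω w := by
  have h1 : U (Ring.inverse U v) = v := by
    rw [← Module.End.mul_apply, Ring.mul_inverse_cancel _ (isUnit_of_sub_mem h0 hn hU)]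
    rfl
  -- With `x = U⁻¹ v`, the difference `v - x = U x - x` is one weight better than `x`, so the weight
  -- of `x` climbs until it reaches that of `v`.
  have : ∀ k ≤ w, Ring.inverse U v ∈ Ω k := by
    intro k
    induction k with
    | zero => intro _; rw [h0]; trivial
    | succ k ih =>
      intro hk
      have h2 := hU _ _ (ih (by omega))
      rw [h1] at h2
      have := sub_mem (anti hk hv) h2
      rwa [sub_sub_cancel] at this
  exact this w le_rfl

theorem inverse_sub_mem {w : ℕ} {v : W} (hv : v ∈ Ω w) (anti : Antitone Ω) :
    Ring.inverse U v - v ∈ Ω (w + 1) := by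
  have h1 : U (Ring.inverse U v) = v := by
    rw [← Module.End.mul_apply, Ring.mul_inverse_cancel _ (isUnit_of_sub_mem h0 hn hU)]
    rfl
  have h2 := hU _ _ (inverse_mem h0 hn hU hv anti)
  rw [h1] at h2
  simpa using neg_mem h2

end Unipotent

/-! ### The intertwiner of two generalised kernel projections -/

section Intertwiner

/-- The operator intertwining the generalised kernel projections of `A` and `B`. -/
def intertwiner (A B : Module.End ℝ W) : Module.End ℝ W :=
  genKerProj B * genKerProj A + (1 - genKerProj B) * (1 - genKerProj A)

namespace FilteredPerturbation

variable {Ω : ℕ → Submodule ℝ W} {n : ℕ} {A B : Module.End ℝ W} (h : FilteredPerturbation Ω n A B)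
include h

theorem genKerProj_idem_left : genKerProj A * genKerProj A = genKerProj A :=
  genKerProj_idem h.isCompl_left

/-- With `Π` and `P` the projections for `A` and `B`, idempotence of `Π` gives `L - 1 = (P - Π) Π -
(P - Π)(1 - Π)`, and `P - Π` raises the weight. -/
theorem intertwiner_sub_mem (w : ℕ) (v : W) (hv : v ∈ Ω w) :
    intertwiner A B v - v ∈ Ω (w + 1) := by
  have hi : genKerProj A (genKerProj A v) = genKerProj A v := congrArg (· v) h.genKerProj_idem_left
  have hm : genKerProj A v ∈ Ω w := h.refl.genKerProj_mem hv
  have : intertwiner A B v - v = (genKerProj B (genKerProj A v) - genKerProj A (genKerProj A v)) -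
      (genKerProj B (v - genKerProj A v) - genKerProj A (v - genKerProj A v)) := by
    rw [map_sub (genKerProj A), hi]
    change genKerProj B (genKerProj A v) +
      ((v - genKerProj A v) - genKerProj B (v - genKerProj A v)) - v = _
    abel
  rw [this]
  exact sub_mem (h.genKerProj_sub_mem hm) (h.genKerProj_sub_mem (sub_mem hv hm))

theorem isUnit_intertwiner : IsUnit (intertwiner A B) :=
  isUnit_of_sub_mem h.zero h.last h.intertwiner_sub_mem

/-- Both sides reduce to the product of the two projections. -/
theorem intertwiner_mul : intertwiner A B * genKerProj A = genKerProj B * intertwiner A B := by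
  have h1 := h.genKerProj_idem_left
  have h2 : genKerProj B * genKerProj B = genKerProj B := genKerProj_idem h.isCompl
  have h3 : (1 - genKerProj A) * genKerProj A = 0 := by rw [sub_mul, h1, one_mul, sub_self]
  have h4 : genKerProj B * (1 - genKerProj B) = 0 := by rw [mul_sub, h2, mul_one, sub_self]
  rw [intertwiner, add_mul, mul_add, mul_assoc, h1, mul_assoc, h3, mul_zero, ← mul_assoc, h2,
    ← mul_assoc, h4, zero_mul]

/-- The intertwiner maps `ker A` isomorphically onto the generalised kernel of `B`. Applied
fibrewise, this computes the multiplicity of the eigenvalue `0` from the graded map. -/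
theorem finrank_iSup_ker_pow :
    Module.finrank ℝ ↥(⨆ k : ℕ, LinearMap.ker (B ^ k)) =
      Module.finrank ℝ (LinearMap.ker A) := by
  have hL := (Module.End.isUnit_iff _).1 h.isUnit_intertwiner
  have h1 : (⨆ k : ℕ, LinearMap.ker (B ^ k)) = (LinearMap.ker A).map (intertwiner A B) := by
    rw [iSup_ker_pow_eq h.ker_stable]
    ext v
    constructor
    · intro hv
      obtain ⟨u, rfl⟩ := hL.2 v
      have h2 := genKerProj_eq_self h.isCompl hv
      rw [← Module.End.mul_apply, ← h.intertwiner_mul, Module.End.mul_apply] at h2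
      exact ⟨u, by rw [← hL.1 h2]; exact h.A_genKerProj u, rfl⟩
    · rintro ⟨u, hu, rfl⟩
      obtain ⟨a, -, c, -, h3, -, e⟩ :=
        h.exists_decomp (w := 0) (v := intertwiner A B u) (h.zero ▸ trivial)
      rw [← Module.End.mul_apply, ← h.intertwiner_mul, Module.End.mul_apply,
        h.genKerProj_of_ker hu] at e
      rw [e]
      exact h3
  rw [h1]
  exact (LinearEquiv.ofBijective _ hL).finrank_map_eq (LinearMap.ker A)

end FilteredPerturbation

end Intertwiner

end Fitting

end

section

variable {E : Type*} [NormedAddCommGroup E] [NormedSpace ℝ E]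
  {M : Type*} [TopologicalSpace M] [ChartedSpace E M] [IsManifold 𝓘(ℝ, E) ∞ M]

theorem subsingleton_quotient_submoduleOf {W : Type*} [AddCommGroup W] [Module ℝ W]
    {p q : Submodule ℝ W} (h : p ≤ q) : Subsingleton (↥p ⧸ q.submoduleOf p) := by
  rw [Submodule.Quotient.subsingleton_iff, eq_top_iff]
  exact fun v _ => h v.2

/-! ### Degrees, expressed by commutation with the degree projections -/

section Degree

/-- The projection of `Ω^•(M)` onto its part of degree `k`. -/
def degreeProj (k : ℕ) : Module.End ℝ (AllForms E M) :=
  LinearMap.single ℝ (fun k => DiffForm E M k) k ∘ₗ LinearMap.proj k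

theorem degreeProj_same (k : ℕ) (α : AllForms E M) : degreeProj k α k = α k :=
  Pi.single_eq_same (M := fun k => DiffForm E M k) k (α k)

theorem degreeProj_ne {k l : ℕ} (h : l ≠ k) (α : AllForms E M) : degreeProj k α l = 0 :=
  Pi.single_eq_of_ne (M := fun k => DiffForm E M k) h (α k)

theorem degreeProj_mem (k : ℕ) (α : AllForms E M) : degreeProj k α ∈ degreePart E M k :=
  fun _ hl => degreeProj_ne hl α

theorem mem_degreePart_iff {k : ℕ} {α : AllForms E M} :
    α ∈ degreePart E M k ↔ degreeProj k α = α := by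
  refine ⟨fun h => ?_, fun h => h ▸ degreeProj_mem k α⟩
  funext l
  by_cases hl : l = k
  · subst hl; exact degreeProj_same l α
  · rw [degreeProj_ne hl, h l hl]

theorem raise_degreeProj (T : ∀ k, DiffForm E M k →ₗ[ℝ] DiffForm E M (k + 1)) (k : ℕ) :
    raise T * degreeProj k = degreeProj (k + 1) * raise T := by
  ext1 α
  funext l
  rw [Module.End.mul_apply, Module.End.mul_apply]
  cases l with
  | zero => rw [degreeProj_ne (by omega)]; rfl
  | succ l =>
    change T l (degreeProj k α l) = _
    by_cases hl : l = k
    · subst hl; rw [degreeProj_same, degreeProj_same]; rfl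
    · rw [degreeProj_ne hl, degreeProj_ne (by omega), map_zero]

theorem lower_degreeProj (T : ∀ k, DiffForm E M (k + 1) →ₗ[ℝ] DiffForm E M k) (k : ℕ) :
    lower T * degreeProj (k + 1) = degreeProj k * lower T := by
  ext1 α
  funext l
  rw [Module.End.mul_apply, Module.End.mul_apply]
  change T l (degreeProj (k + 1) α (l + 1)) = _
  by_cases hl : l = k
  · subst hl; rw [degreeProj_same, degreeProj_same]; rfl
  · rw [degreeProj_ne (by omega), degreeProj_ne hl, map_zero]

theorem lower_degreeProj_zero (T : ∀ k, DiffForm E M (k + 1) →ₗ[ℝ] DiffForm E M k) :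
    lower T * degreeProj 0 = 0 := by
  ext1 α
  funext l
  rw [Module.End.mul_apply]
  change T l (degreeProj 0 α (l + 1)) = _
  rw [degreeProj_ne (by omega), map_zero]
  rfl

theorem degreeProj_zero_raise (T : ∀ k, DiffForm E M k →ₗ[ℝ] DiffForm E M (k + 1)) :
    degreeProj 0 * raise T = 0 := by
  ext1 α
  funext l
  rw [Module.End.mul_apply]
  by_cases hl : l = 0
  · subst hl; rw [degreeProj_same]; rfl
  · rw [degreeProj_ne hl]; rfl

/-- `T` has degree `1`. -/
structure IsRaising (T : Module.End ℝ (AllForms E M)) : Prop where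
  comm : ∀ k, T * degreeProj k = degreeProj (k + 1) * T
  zero : degreeProj 0 * T = 0

/-- `T` has degree `-1`. -/
structure IsLowering (T : Module.End ℝ (AllForms E M)) : Prop where
  comm : ∀ k, T * degreeProj (k + 1) = degreeProj k * T
  zero : T * degreeProj 0 = 0

theorem isRaising_raise (T : ∀ k, DiffForm E M k →ₗ[ℝ] DiffForm E M (k + 1)) :
    IsRaising (raise T) :=
  ⟨raise_degreeProj T, degreeProj_zero_raise T⟩

theorem isLowering_lower (T : ∀ k, DiffForm E M (k + 1) →ₗ[ℝ] DiffForm E M k) :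
    IsLowering (lower T) :=
  ⟨lower_degreeProj T, lower_degreeProj_zero T⟩

theorem IsRaising.degreeProj_mul {T S : Module.End ℝ (AllForms E M)} (hT : IsRaising T)
    (hS : IsLowering S) (k : ℕ) : degreeProj k * (T * S) = (T * S) * degreeProj k := by
  cases k with
  | zero => rw [← mul_assoc, hT.zero, mul_assoc, hS.zero, mul_zero, zero_mul]
  | succ k => rw [mul_assoc, hS.comm, ← mul_assoc, ← mul_assoc, hT.comm]

theorem IsLowering.degreeProj_mul {T S : Module.End ℝ (AllForms E M)} (hT : IsLowering T)
    (hS : IsRaising S) (k : ℕ) : degreeProj k * (T * S) = (T * S) * degreeProj k := by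
  rw [mul_assoc, hS.comm, ← mul_assoc, ← mul_assoc, hT.comm]

end Degree

variable [FiniteDimensional ℝ E]

theorem deRham_sq : (deRham * deRham : Module.End ℝ (AllForms E M)) = 0 := by
  ext1 α
  funext k
  rw [Module.End.mul_apply]
  match k with
  | 0 => rfl
  | 1 => exact map_zero (extD (E := E) (M := M) 0)
  | k + 2 =>
    change extD (k + 1) (extD k (α k)) = 0
    ext1 x
    set η := α k
    -- The exterior derivative at `x` sees only the germ at `x`, and near `x` the form `dη` is
    -- represented in the fixed chart at `x` by the derivative of the representative of `η`.
    have hev : localRep (extDerivForm η) x =ᶠ[𝓝 (chartAt E x x)] extDeriv (localRep η x) := by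
      filter_upwards [(chartAt E x).open_target.mem_nhds (mem_chart_target E x)] with y hy
      exact localRep_extDerivForm η η.contMDiff x hy
    have h := (contMDiffAt_form_iff η x).1 (η.contMDiff x)
    change ContinuousAlternatingMap.compContinuousLinearMap
      (extDeriv (localRep (extDerivForm η) x) (chartAt E x x)) _ = 0
    rw [hev.extDeriv_eq, extDeriv_extDeriv_apply h (by simpa using ENat.LEInfty.out)]
    rfl

variable [Bundle.RiemannianBundle (fun x : M => TangentSpace 𝓘(ℝ, E) x)]

/-! ### The algebra of `d₀`, `δ₀` and the two boxes -/

namespace BasePair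

variable {𝓗 : FilteredManifold E M} (B : BasePair 𝓗)

theorem d0_sq : B.d0 * B.d0 = 0 := by
  ext1 α
  funext k
  match k with
  | 0 => rfl
  | 1 => exact map_zero (B.dOp 0).onForms
  | k + 2 => exact B.dOp_sq k (α k)

theorem delta0_sq : B.delta0 * B.delta0 = 0 := by
  ext1 α
  funext k
  exact B.deltaOp_sq k (α (k + 2))

theorem d0_box0 : B.d0 * B.box0 = B.box0 * B.d0 := by
  rw [box0, mul_add, add_mul, ← mul_assoc, B.d0_sq, mul_assoc B.delta0, B.d0_sq, mul_zero,
    zero_mul, zero_add, add_zero, mul_assoc]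

theorem delta0_box0 : B.delta0 * B.box0 = B.box0 * B.delta0 := by
  rw [box0, mul_add, add_mul, ← mul_assoc B.delta0 B.delta0, B.delta0_sq, mul_assoc B.d0,
    B.delta0_sq, mul_zero, zero_mul, zero_add, add_zero, mul_assoc]

theorem deRham_box : deRham * B.box = B.box * deRham := by
  rw [box, mul_add, add_mul, ← mul_assoc, deRham_sq, mul_assoc B.delta0, deRham_sq, mul_zero,
    zero_mul, zero_add, add_zero, mul_assoc]

theorem d0_eq_zero_of_delta0_d0 {α : AllForms E M} (h : B.delta0 (B.d0 α) = 0) : B.d0 α = 0 :=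
  B.disjoint_dOp α h

theorem delta0_eq_zero_of_d0_delta0 {α : AllForms E M} (h : B.d0 (B.delta0 α) = 0) :
    B.delta0 α = 0 :=
  B.disjoint_deltaOp α h

theorem d0_d0 (α : AllForms E M) : B.d0 (B.d0 α) = 0 := congrArg (· α) B.d0_sq

theorem delta0_delta0 (α : AllForms E M) : B.delta0 (B.delta0 α) = 0 := congrArg (· α) B.delta0_sq

theorem box0_apply (α : AllForms E M) : B.box0 α = B.d0 (B.delta0 α) + B.delta0 (B.d0 α) := rfl

theorem box_apply (α : AllForms E M) : B.box α = deRham (B.delta0 α) + B.delta0 (deRham α) := rfl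

/-- Applying `d₀` to `□₀ α = 0` leaves `d₀ δ₀ d₀ α = 0`. The two disjointness conditions then strip
off `d₀` and `δ₀` in turn. -/
theorem d0_eq_zero_of_box0 {α : AllForms E M} (h : B.box0 α = 0) : B.d0 α = 0 := by
  refine B.d0_eq_zero_of_delta0_d0 (B.delta0_eq_zero_of_d0_delta0 ?_)
  have := congrArg B.d0 h
  rwa [box0_apply, map_add, B.d0_d0, zero_add, map_zero] at this

theorem delta0_eq_zero_of_box0 {α : AllForms E M} (h : B.box0 α = 0) : B.delta0 α = 0 := by
  refine B.delta0_eq_zero_of_d0_delta0 (B.d0_eq_zero_of_delta0_d0 ?_)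
  have := congrArg B.delta0 h
  rwa [box0_apply, map_add, B.delta0_delta0, add_zero, map_zero] at this

theorem box0_eq_zero_of_sq {α : AllForms E M} (h : B.box0 (B.box0 α) = 0) : B.box0 α = 0 := by
  have h1 := B.d0_eq_zero_of_box0 h
  have h2 := B.delta0_eq_zero_of_box0 h
  rw [box0_apply, map_add, B.d0_d0, zero_add] at h1
  rw [box0_apply, map_add, B.delta0_delta0, add_zero] at h2
  rw [box0_apply, B.delta0_eq_zero_of_d0_delta0 (B.d0_eq_zero_of_delta0_d0 h2),
    B.d0_eq_zero_of_delta0_d0 (B.delta0_eq_zero_of_d0_delta0 h1), map_zero, map_zero, add_zero]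

theorem isRaising_d0 : IsRaising B.d0 := isRaising_raise _

theorem isLowering_delta0 : IsLowering B.delta0 := isLowering_lower _

theorem degreeProj_box0 (k : ℕ) : degreeProj k * B.box0 = B.box0 * degreeProj k := by
  rw [box0, mul_add, add_mul, B.isRaising_d0.degreeProj_mul B.isLowering_delta0,
    B.isLowering_delta0.degreeProj_mul B.isRaising_d0]

theorem degreeProj_box (k : ℕ) : degreeProj k * B.box = B.box * degreeProj k := by
  rw [box, mul_add, add_mul, deRham, (isRaising_raise _).degreeProj_mul B.isLowering_delta0,
    B.isLowering_delta0.degreeProj_mul (isRaising_raise _)]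

/-! ### Consequences of the perturbation property for `L`, `F₀` and `C` -/

section Perturbation

variable {Ω : ℕ → Submodule ℝ (AllForms E M)} {n : ℕ}

theorem L_sub_mem (h : FilteredPerturbation Ω n B.box0 B.box) (w : ℕ) (v : AllForms E M)
    (hv : v ∈ Ω w) : B.L v - v ∈ Ω (w + 1) :=
  h.intertwiner_sub_mem w v hv

theorem isUnit_L (h : FilteredPerturbation Ω n B.box0 B.box) : IsUnit B.L :=
  h.isUnit_intertwiner

theorem box0_Pi0 (h : FilteredPerturbation Ω n B.box0 B.box) (v : AllForms E M) :
    B.box0 (B.Pi0 v) = 0 := h.A_genKerProj v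

theorem d0_Pi0 (h : FilteredPerturbation Ω n B.box0 B.box) (v : AllForms E M) :
    B.d0 (B.Pi0 v) = 0 := B.d0_eq_zero_of_box0 (B.box0_Pi0 h v)

theorem Pi0_d0 (h : FilteredPerturbation Ω n B.box0 B.box) (v : AllForms E M) :
    B.Pi0 (B.d0 v) = 0 :=
  (congrArg (· v) (genKerProj_comm h.isCompl_left B.d0_box0)).symm.trans (B.d0_Pi0 h v)

theorem Pi0_delta0 (h : FilteredPerturbation Ω n B.box0 B.box) (v : AllForms E M) :
    B.Pi0 (B.delta0 v) = 0 :=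
  (congrArg (· v) (genKerProj_comm h.isCompl_left B.delta0_box0)).symm.trans
    (B.delta0_eq_zero_of_box0 (B.box0_Pi0 h v))

/-- If `□₀ v = □₀² u`, then `v - □₀ u` lies in `ker □₀`, which `Π₀` fixes, but it is also killed by
`Π₀`. So `v = □₀ u`, and replacing `u` by `u - Π₀ u` does not change `□₀ u`. -/
theorem exists_box0_of_Pi0 (h : FilteredPerturbation Ω n B.box0 B.box) {w : ℕ} {v : AllForms E M}
    (hw : v ∈ Ω w) (hv : B.Pi0 v = 0) : ∃ u ∈ Ω w, B.Pi0 u = 0 ∧ B.box0 u = v := by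
  obtain ⟨u, hu, e⟩ := h.range w v hw
  have h1 : B.box0 (v - B.box0 u) = 0 := by rw [map_sub, e, sub_self]
  have h2 : B.Pi0 (v - B.box0 u) = v - B.box0 u := h.genKerProj_of_ker h1
  have h3 : B.Pi0 (B.box0 u) = 0 := h.genKerProj_of_range u
  rw [map_sub, h3, hv, sub_zero] at h2
  refine ⟨u - B.Pi0 u, sub_mem hu (h.refl.genKerProj_mem hu), ?_, ?_⟩
  · rw [map_sub, show B.Pi0 (B.Pi0 u) = B.Pi0 u from
      congrArg (· u) (genKerProj_idem h.isCompl_left), sub_self]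
  · rw [map_sub, B.box0_Pi0 h, sub_zero]
    exact (sub_eq_zero.1 h2.symm).symm

/-- The spaces `F₀`, `ker Π₀` and `Im □₀` coincide. In this form, membership in `F₀` is checked by
one projection that commutes with the other operators. -/
theorem mem_F0_iff (h : FilteredPerturbation Ω n B.box0 B.box) {v : AllForms E M} :
    v ∈ B.F0 ↔ B.Pi0 v = 0 := by
  constructor
  · intro hv
    obtain ⟨_, ⟨a, rfl⟩, _, ⟨b, rfl⟩, rfl⟩ := Submodule.mem_sup.1 hv
    rw [map_add, B.Pi0_d0 h, B.Pi0_delta0 h, add_zero]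
  · intro hv
    obtain ⟨u, -, -, rfl⟩ := B.exists_box0_of_Pi0 h (w := 0) (h.zero ▸ trivial) hv
    exact Submodule.add_mem_sup ⟨_, rfl⟩ ⟨_, rfl⟩

theorem eq_of_box0_eq (h : FilteredPerturbation Ω n B.box0 B.box) {u v : AllForms E M}
    (hu : u ∈ B.F0) (hv : v ∈ B.F0) (e : B.box0 u = B.box0 v) : u = v := by
  have h1 : B.box0 (u - v) = 0 := by rw [map_sub, e, sub_self]
  have h2 : B.Pi0 (u - v) = u - v := h.genKerProj_of_ker h1
  rw [map_sub, (B.mem_F0_iff h).1 hu, (B.mem_F0_iff h).1 hv, sub_zero] at h2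
  exact sub_eq_zero.1 h2.symm

theorem isUnit_box0F (h : FilteredPerturbation Ω n B.box0 B.box) : IsUnit B.box0F := by
  rw [Module.End.isUnit_iff]
  constructor
  · intro u v e
    exact Subtype.ext (B.eq_of_box0_eq h u.2 v.2 (congrArg Subtype.val e))
  · intro v
    obtain ⟨u, -, hu, e⟩ := B.exists_box0_of_Pi0 h (w := 0) (h.zero ▸ trivial)
      ((B.mem_F0_iff h).1 v.2)
    exact ⟨⟨u, (B.mem_F0_iff h).2 hu⟩, Subtype.ext e⟩

theorem box0_boxInv (h : FilteredPerturbation Ω n B.box0 B.box) (v : B.F0) :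
    B.box0 (B.boxInv v) = v :=
  congrArg Subtype.val (congrArg (· v) (Ring.mul_inverse_cancel _ (B.isUnit_box0F h)))

theorem boxInv_eq (h : FilteredPerturbation Ω n B.box0 B.box) {v : B.F0} {u : AllForms E M}
    (hu : u ∈ B.F0) (e : B.box0 u = v) : (B.boxInv v : AllForms E M) = u :=
  B.eq_of_box0_eq h (B.boxInv v).2 hu ((B.box0_boxInv h v).trans e.symm)

theorem boxInv_mem (h : FilteredPerturbation Ω n B.box0 B.box) {w : ℕ} {v : B.F0}
    (hv : (v : AllForms E M) ∈ Ω w) : (B.boxInv v : AllForms E M) ∈ Ω w := by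
  obtain ⟨u, hu, hu0, e⟩ := B.exists_box0_of_Pi0 h hv ((B.mem_F0_iff h).1 v.2)
  rwa [B.boxInv_eq h ((B.mem_F0_iff h).2 hu0) e]

theorem boxInv_d0F (h : FilteredPerturbation Ω n B.box0 B.box) (v : B.F0) :
    (B.boxInv (B.d0F v) : AllForms E M) = B.d0 (B.boxInv v) :=
  B.boxInv_eq h (B.d0_mem _ (B.boxInv v).2)
    ((congrArg (· (B.boxInv v : AllForms E M)) B.d0_box0).symm.trans
      (congrArg B.d0 (B.box0_boxInv h v)))

theorem degreeProj_Pi0 (h : FilteredPerturbation Ω n B.box0 B.box) (k : ℕ) :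
    degreeProj k * B.Pi0 = B.Pi0 * degreeProj k :=
  genKerProj_comm h.isCompl_left (B.degreeProj_box0 k)

theorem degreeProj_P (h : FilteredPerturbation Ω n B.box0 B.box) (k : ℕ) :
    degreeProj k * B.P = B.P * degreeProj k :=
  genKerProj_comm h.isCompl (B.degreeProj_box k)

theorem degreeProj_L (h : FilteredPerturbation Ω n B.box0 B.box) (k : ℕ) :
    Commute (degreeProj k) B.L :=
  .add_right (.mul_right (B.degreeProj_P h k) (B.degreeProj_Pi0 h k))
    (.mul_right (.sub_right (.one_right _) (B.degreeProj_P h k))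
      (.sub_right (.one_right _) (B.degreeProj_Pi0 h k)))

theorem isRaising_C (h : FilteredPerturbation Ω n B.box0 B.box) : IsRaising B.C := by
  have hL := B.degreeProj_L h
  have hi : ∀ k, Commute (degreeProj k) (Ring.inverse B.L) := fun k => by
    obtain ⟨u, hu⟩ := B.isUnit_L h
    have := hL k
    rw [← hu] at this ⊢
    rw [Ring.inverse_unit]
    exact this.units_inv_right
  have hp : ∀ k, Commute (degreeProj k) (B.L * (1 - B.Pi0)) := fun k =>
    .mul_right (hL k) (.sub_right (.one_right _) (B.degreeProj_Pi0 h k))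
  have hd : IsRaising (deRham : Module.End ℝ (AllForms E M)) := isRaising_raise _
  constructor
  · intro k
    rw [C, mul_assoc _ B.L, mul_assoc, ← (hp k).eq, mul_assoc, ← mul_assoc deRham, hd.comm,
      mul_assoc, ← mul_assoc, ← (hi _).eq, mul_assoc, mul_assoc]
  · rw [C, mul_assoc, mul_assoc, ← mul_assoc, (hi 0).eq, mul_assoc, ← mul_assoc _ deRham, hd.zero,
      zero_mul, mul_zero]

theorem L_Pi0 (h : FilteredPerturbation Ω n B.box0 B.box) : B.L * B.Pi0 = B.P * B.L :=
  h.intertwiner_mul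

/-- Moving `Π₀` to the right through `L⁻¹ d L` turns it into `P` and back into `Π₀`, where it meets
`1 - Π₀`. -/
theorem Pi0_C (h : FilteredPerturbation Ω n B.box0 B.box) : B.Pi0 * B.C = 0 := by
  have hL := B.isUnit_L h
  have h1 : B.Pi0 * B.Pi0 = B.Pi0 := genKerProj_idem h.isCompl_left
  have h2 : B.Pi0 * Ring.inverse B.L = Ring.inverse B.L * B.P := by
    rw [← one_mul (B.Pi0 * _), ← Ring.inverse_mul_cancel _ hL, mul_assoc, ← mul_assoc B.L,
      B.L_Pi0 h, mul_assoc, Ring.mul_inverse_cancel _ hL, mul_one]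
  have h3 : deRham * B.P = B.P * deRham := genKerProj_comm h.isCompl B.deRham_box
  rw [C, ← mul_assoc, ← mul_assoc, ← mul_assoc, h2, mul_assoc _ B.P, ← h3, mul_assoc, mul_assoc,
    mul_assoc, ← mul_assoc B.P, ← B.L_Pi0 h, mul_assoc, mul_sub B.Pi0, h1, mul_one, sub_self,
    mul_zero, mul_zero, mul_zero]

/-- By `Pi0_C` the inner factor `1 - Π₀` may be dropped, and what remains contains `L⁻¹ d L L⁻¹ d L
= L⁻¹ d² L = 0`. -/
theorem C_sq (h : FilteredPerturbation Ω n B.box0 B.box) : B.C * B.C = 0 := by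
  have h1 : (1 - B.Pi0) * B.C = B.C := by rw [sub_mul, B.Pi0_C h, one_mul, sub_zero]
  have h2 : B.C * B.C = Ring.inverse B.L * deRham * B.L * B.C := by
    conv_lhs => rw [C, mul_assoc, ← C, h1]
  rw [h2, C, ← mul_assoc, ← mul_assoc, ← mul_assoc, mul_assoc _ B.L (Ring.inverse B.L),
    Ring.mul_inverse_cancel _ (B.isUnit_L h), mul_one, mul_assoc _ deRham deRham, deRham_sq,
    mul_zero, zero_mul, zero_mul]

theorem C_mem_F0 (h : FilteredPerturbation Ω n B.box0 B.box) (v : AllForms E M) :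
    B.C v ∈ B.F0 :=
  (B.mem_F0_iff h).2 (congrArg (· v) (B.Pi0_C h))

theorem C_C (h : FilteredPerturbation Ω n B.box0 B.box) (v : AllForms E M) :
    B.C (B.C v) = 0 := congrArg (· v) (B.C_sq h)

theorem degreeProj_mem_F0 (h : FilteredPerturbation Ω n B.box0 B.box) (k : ℕ) {v : AllForms E M}
    (hv : v ∈ B.F0) : degreeProj k v ∈ B.F0 := by
  rw [B.mem_F0_iff h] at hv ⊢
  rw [← Module.End.mul_apply, ← B.degreeProj_Pi0 h, Module.End.mul_apply, hv, map_zero]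

theorem degreeProj_boxInv (h : FilteredPerturbation Ω n B.box0 B.box) {k : ℕ} {v : B.F0}
    (hv : degreeProj k (v : AllForms E M) = v) :
    degreeProj k (B.boxInv v : AllForms E M) = B.boxInv v := by
  refine (B.boxInv_eq h (B.degreeProj_mem_F0 h k (B.boxInv v).2) ?_).symm
  rw [← Module.End.mul_apply, ← B.degreeProj_box0, Module.End.mul_apply, B.box0_boxInv h, hv]

/-- If `d₀ v = 0`, then `d₀ □₀⁻¹ v = 0` as well, and `v = □₀ □₀⁻¹ v` collapses to `d₀ (δ₀ □₀⁻¹ v)`.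
The primitive has degree one less because `□₀⁻¹` preserves degrees. -/
theorem exact_d0 (h : FilteredPerturbation Ω n B.box0 B.box) {k : ℕ} {v : AllForms E M}
    (hv : v ∈ B.F0) (hk : degreeProj k v = v) (h0 : B.d0 v = 0) :
    ∃ u ∈ B.F0, B.d0 u = v ∧ ∀ j, j + 1 = k → degreeProj j u = u := by
  have h1 := B.boxInv_d0F h ⟨v, hv⟩
  have h2 := B.box0_boxInv h ⟨v, hv⟩
  have h3 : B.d0F ⟨v, hv⟩ = 0 := Subtype.ext h0
  rw [h3, map_zero] at h1
  rw [box0_apply, ← h1] at h2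
  change B.d0 _ + B.delta0 0 = v at h2
  rw [map_zero, add_zero] at h2
  refine ⟨_, Submodule.mem_sup_right ⟨_, rfl⟩, h2, ?_⟩
  rintro j rfl
  have h4 : degreeProj (j + 1) (B.boxInv ⟨v, hv⟩ : AllForms E M) = _ := B.degreeProj_boxInv h hk
  rw [← Module.End.mul_apply, ← B.isLowering_delta0.comm, Module.End.mul_apply, h4]

/-- In degree `0` the operator `δ₀` vanishes, so a `d₀`-cocycle is in `ker □₀`, which meets `F₀`
only in `0`. -/
theorem eq_zero_of_d0 (h : FilteredPerturbation Ω n B.box0 B.box) {v : AllForms E M}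
    (hv : v ∈ B.F0) (hk : degreeProj 0 v = v) (h0 : B.d0 v = 0) : v = 0 := by
  refine B.eq_of_box0_eq h hv (zero_mem _) ?_
  rw [map_zero, box0_apply, h0, ← hk, ← Module.End.mul_apply B.delta0, B.isLowering_delta0.zero]
  simp

/-! ### The isomorphism `g` and the vanishing of cohomology -/

section Exact

variable (h : FilteredPerturbation Ω n B.box0 B.box)
  (hd0 : ∀ w, ∀ v ∈ Ω w, B.d0 v ∈ Ω w) (hδ : ∀ w, ∀ v ∈ Ω w, B.delta0 v ∈ Ω w)
  (hd : ∀ w, ∀ v ∈ Ω w, deRham v - B.d0 v ∈ Ω (w + 1))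
include h hd0 hd

/-- With `y = v - Π₀ v` and `d₀ Π₀ = 0`, the difference telescopes as `(L⁻¹ - 1) d L y + d (L - 1) y
+ (d - d₀) y`, and each term gains a weight. -/
theorem C_sub_mem {w : ℕ} {v : AllForms E M} (hv : v ∈ Ω w) : B.C v - B.d0 v ∈ Ω (w + 1) := by
  have hy : v - B.Pi0 v ∈ Ω w := sub_mem hv (h.refl.genKerProj_mem hv)
  have hdm : ∀ w, ∀ v ∈ Ω w, deRham v ∈ Ω w := fun w v hv => by
    rw [← sub_add_cancel (deRham v) (B.d0 v)]
    exact add_mem (h.anti (Nat.le_succ w) (hd w v hv)) (hd0 w v hv)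
  have h1 := B.L_sub_mem h w _ hy
  have h2 := hdm _ _ h1
  have h3 := hd _ _ hy
  have hLm : B.L (v - B.Pi0 v) ∈ Ω w := by
    rw [← sub_add_cancel (B.L _) (v - B.Pi0 v)]
    exact add_mem (h.anti (Nat.le_succ w) h1) hy
  have h4 := inverse_sub_mem h.zero h.last (B.L_sub_mem h) (hdm _ _ hLm) h.anti
  rw [map_sub] at h2
  rw [map_sub B.d0, B.d0_Pi0 h, sub_zero] at h3
  have := add_mem (add_mem h4 h2) h3
  rwa [sub_add_sub_cancel, sub_add_sub_cancel] at this

omit hd0 hd in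
theorem g_apply (v : B.F0) : B.g v = B.C (B.delta0 (B.boxInv v : AllForms E M)) +
    B.delta0 (B.d0 (B.boxInv v : AllForms E M)) := by
  rw [← B.boxInv_d0F h]
  rfl

omit hd0 hd in
theorem g_mem (v : B.F0) : B.g v ∈ B.F0 := by
  rw [B.g_apply h]
  exact add_mem (B.C_mem_F0 h _) (Submodule.mem_sup_right ⟨_, rfl⟩)

include hδ in
-- Writing `v = d₀ δ₀ □₀⁻¹ v + δ₀ d₀ □₀⁻¹ v` on `F₀`, only `(C - d₀) δ₀ □₀⁻¹ v` survives in `g v -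
-- v`. So `g` is unipotent for the filtration induced on `F₀`.
theorem isUnit_g : IsUnit (B.g.codRestrict B.F0 (B.g_mem h)) := by
  refine isUnit_of_sub_mem (Ω := fun w => (Ω w).comap B.F0.subtype) (n := n)
    (by rw [h.zero]; rfl) ?_ fun w v hv => ?_
  · rw [h.last, Submodule.comap_bot, Submodule.ker_subtype]
  · change B.g v - v ∈ Ω (w + 1)
    have h1 := B.box0_boxInv h v
    have h2 := B.C_sub_mem h hd0 hd (hδ _ _ (B.boxInv_mem h (v := v) hv))
    rw [box0_apply] at h1
    rw [B.g_apply h, ← h1, add_sub_add_right_eq_sub]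
    exact h2

/-- The automorphism `g` of `F₀`. -/
def gEquiv : B.F0 ≃ₗ[ℝ] B.F0 :=
  LinearEquiv.ofBijective _ ((Module.End.isUnit_iff _).1 (B.isUnit_g h hd0 hδ hd))

theorem gEquiv_apply (v : B.F0) : (B.gEquiv h hd0 hδ hd v : AllForms E M) = B.g v := rfl

theorem C_gEquiv (v : B.F0) :
    B.C (B.gEquiv h hd0 hδ hd v) = (B.gEquiv h hd0 hδ hd (B.d0F v) : AllForms E M) := by
  rw [gEquiv_apply, gEquiv_apply, B.g_apply h, B.g_apply h, B.boxInv_d0F h, map_add, B.C_C h,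
    zero_add, B.d0_d0, map_zero, add_zero]

theorem degreeProj_gEquiv {k : ℕ} {v : B.F0} (hv : degreeProj k (v : AllForms E M) = v) :
    degreeProj k (B.gEquiv h hd0 hδ hd v : AllForms E M) = B.gEquiv h hd0 hδ hd v := by
  have h1 := (B.isRaising_C h).degreeProj_mul B.isLowering_delta0 k
  have h2 := B.isLowering_delta0.degreeProj_mul B.isRaising_d0 k
  have h3 := B.degreeProj_boxInv h hv
  have h4 := congrArg (· (B.boxInv v : AllForms E M)) h1
  have h5 := congrArg (· (B.boxInv v : AllForms E M)) h2
  simp only [Module.End.mul_apply, h3] at h4 h5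
  rw [gEquiv_apply, B.g_apply h, map_add, h4, h5]

/-- Since `g` commutes with the degree projections on all of `F₀`, injectivity of `g` passes this to
the inverse. -/
theorem degreeProj_gEquiv_symm {k : ℕ} {v : B.F0} (hv : degreeProj k (v : AllForms E M) = v) :
    degreeProj k ((B.gEquiv h hd0 hδ hd).symm v : AllForms E M) =
      (B.gEquiv h hd0 hδ hd).symm v := by
  set e := B.gEquiv h hd0 hδ hd
  have hF : ∀ (l : ℕ) (u : B.F0), degreeProj l (u : AllForms E M) ∈ B.F0 :=
    fun l u => B.degreeProj_mem_F0 h l u.2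
  have hidem : ∀ (l : ℕ) (u : AllForms E M), degreeProj l (degreeProj l u) = degreeProj l u :=
    fun l u => mem_degreePart_iff.1 (degreeProj_mem l u)
  have hcomm : ∀ (l : ℕ) (u : B.F0),
      degreeProj l (e u : AllForms E M) = e ⟨degreeProj l (u : AllForms E M), hF l u⟩ := by
    intro l u
    rw [gEquiv_apply, gEquiv_apply, B.g_apply h, B.g_apply h]
    have h3 : (B.boxInv ⟨degreeProj l (u : AllForms E M), hF l u⟩ : AllForms E M) =
        degreeProj l (B.boxInv u : AllForms E M) := by
      refine B.boxInv_eq h (B.degreeProj_mem_F0 h l (B.boxInv u).2) ?_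
      rw [← Module.End.mul_apply, ← B.degreeProj_box0, Module.End.mul_apply, B.box0_boxInv h]
    have h4 := congrArg (· (B.boxInv u : AllForms E M))
      ((B.isRaising_C h).degreeProj_mul B.isLowering_delta0 l)
    have h5 := congrArg (· (B.boxInv u : AllForms E M))
      (B.isLowering_delta0.degreeProj_mul B.isRaising_d0 l)
    simp only [Module.End.mul_apply] at h4 h5
    rw [map_add, h4, h5, h3]
  have h1 := hcomm k (e.symm v)
  rw [e.apply_symm_apply, hv] at h1
  have h2 := e.injective (Subtype.ext (h1.symm.trans
    (congrArg Subtype.val (e.apply_symm_apply v)).symm))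
  exact congrArg Subtype.val h2

omit hd0 hd in
theorem subsingleton_cohomology_d0 (k : ℕ) : Subsingleton (Cohomology B.F0 B.d0 k) := by
  refine subsingleton_quotient_submoduleOf ?_
  rintro v ⟨⟨hv, hk⟩, h0⟩
  rw [SetLike.mem_coe, mem_degreePart_iff] at hk
  cases k with
  | zero => rw [B.eq_zero_of_d0 h hv hk h0]; exact zero_mem _
  | succ k =>
    obtain ⟨u, hu, e, hk'⟩ := B.exact_d0 h hv hk h0
    exact Submodule.mem_iSup_of_mem k (Submodule.mem_iSup_of_mem rfl
      ⟨u, ⟨hu, mem_degreePart_iff.2 (hk' k rfl)⟩, e⟩)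

include hδ in
-- A `C`-cocycle `v` is `g γ` for a `d₀`-cocycle `γ` of the same degree. A primitive of `γ` for `d₀`
-- is sent by `g` to a primitive of `v` for `C`.
theorem subsingleton_cohomology_C (k : ℕ) : Subsingleton (Cohomology B.F0 B.C k) := by
  refine subsingleton_quotient_submoduleOf ?_
  rintro v ⟨⟨hv, hk⟩, h0⟩
  rw [SetLike.mem_coe, mem_degreePart_iff] at hk
  set e := B.gEquiv h hd0 hδ hd with he
  set γ := e.symm ⟨v, hv⟩ with hγ
  have hγk : degreeProj k (γ : AllForms E M) = γ := B.degreeProj_gEquiv_symm h hd0 hδ hd hk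
  have hγv : e γ = ⟨v, hv⟩ := e.apply_symm_apply _
  have h1 := B.C_gEquiv h hd0 hδ hd γ
  rw [← he, hγv] at h1
  change B.C v = _ at h1
  rw [h0] at h1
  have h2 : B.d0F γ = 0 := e.map_eq_zero_iff.1 (Subtype.ext h1.symm)
  have h3 : B.d0 (γ : AllForms E M) = 0 := congrArg Subtype.val h2
  cases k with
  | zero =>
    have h4 : γ = 0 := Subtype.ext (B.eq_zero_of_d0 h γ.2 hγk h3)
    rw [h4, map_zero] at hγv
    rw [← show (0 : AllForms E M) = v from congrArg Subtype.val hγv]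
    exact zero_mem _
  | succ k =>
    obtain ⟨u, hu, e1, hk'⟩ := B.exact_d0 h γ.2 hγk h3
    refine Submodule.mem_iSup_of_mem k (Submodule.mem_iSup_of_mem rfl
      ⟨e ⟨u, hu⟩, ⟨(e ⟨u, hu⟩).2, mem_degreePart_iff.2 ?_⟩, ?_⟩)
    · exact B.degreeProj_gEquiv h hd0 hδ hd (hk' k rfl)
    · rw [B.C_gEquiv h hd0 hδ hd]
      have : B.d0F ⟨u, hu⟩ = γ := Subtype.ext e1
      rw [this, ← he, hγv]

end Exact

end Perturbation

end BasePair

end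

section

/-! ### Noncanonical splittings of a filtered vector space -/

section Splitting

variable {V : Type*} [AddCommGroup V] [Module ℝ V]

theorem exists_grSplit (F : ℕ → Submodule ℝ V) (i : ℕ) :
    ∃ f : GrPiece F i →ₗ[ℝ] ↥(F (i + 1)),
      ((F i).submoduleOf (F (i + 1))).mkQ ∘ₗ f = LinearMap.id :=
  LinearMap.exists_rightInverse_of_surjective _ (Submodule.range_mkQ _)

/-- A linear section of the projection of `F (i + 1)` onto `F (i + 1) / F i`. -/
def grSplit (F : ℕ → Submodule ℝ V) (i : ℕ) : GrPiece F i →ₗ[ℝ] ↥(F (i + 1)) :=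
  (exists_grSplit F i).choose

theorem mk_grSplit (F : ℕ → Submodule ℝ V) (i : ℕ) (q : GrPiece F i) :
    Submodule.Quotient.mk (grSplit F i q) = q :=
  LinearMap.congr_fun (exists_grSplit F i).choose_spec q

theorem grSplit_mk_sub (F : ℕ → Submodule ℝ V) (i : ℕ) (v : F (i + 1)) :
    (v : V) - grSplit F i (Submodule.Quotient.mk v) ∈ F i := by
  have := mk_grSplit F i (Submodule.Quotient.mk v)
  have := (Submodule.Quotient.eq _).1 this.symm
  exact this

/-- The linear map from the graded space to `V` given by the sections of the pieces. -/
def grMap (F : ℕ → Submodule ℝ V) (s : ℕ) : Gr F s →ₗ[ℝ] V :=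
  ∑ i : Fin s, (F (i + 1)).subtype ∘ₗ grSplit F i ∘ₗ LinearMap.proj i

theorem grMap_apply (F : ℕ → Submodule ℝ V) (s : ℕ) (u : Gr F s) :
    grMap F s u = ∑ i : Fin s, (grSplit F i (u i) : V) := by
  simp [grMap]

variable {F : ℕ → Submodule ℝ V} {s : ℕ}

theorem grMap_single (i : Fin s) (q : GrPiece F i) :
    grMap F s (Pi.single i q) = grSplit F i q := by
  rw [grMap_apply, Finset.sum_eq_single i]
  · rw [Pi.single_eq_same]
  · intro j _ hj
    rw [Pi.single_eq_of_ne hj, map_zero, Submodule.coe_zero]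
  · simp

theorem grClass_succ (i : Fin s) (v : V) (hv : v ∈ F (i + 1)) :
    grClass F s (i + 1) v hv = Pi.single i (Submodule.Quotient.mk ⟨v, hv⟩) := by
  funext l
  by_cases hl : l = i
  · subst hl
    rw [Pi.single_eq_same, grClass, dif_pos rfl]
  · rw [Pi.single_eq_of_ne hl, grClass, dif_neg]
    exact fun h => hl (Fin.ext (by omega))

theorem grClass_eq_zero {j : ℕ} {v : V} {hv : v ∈ F j} (hj : j = 0 ∨ s < j) :
    grClass F s j v hv = 0 := by
  funext l
  rw [grClass, dif_neg (by omega)]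
  rfl

theorem grClass_grSplit (i : Fin s) (q : GrPiece F i) :
    grClass F s (i + 1) (grSplit F i q) (grSplit F i q).2 = Pi.single i q := by
  rw [grClass_succ]
  congr 1
  exact mk_grSplit F i q

/-- A filtration of `V` by a finite increasing sequence of subspaces, from `0` to `V`. -/
structure IsFiltration (F : ℕ → Submodule ℝ V) (s : ℕ) : Prop where
  zero : F 0 = ⊥
  mono : Monotone F
  top : F s = ⊤

namespace IsFiltration

variable (hF : IsFiltration F s)
include hF

/-- Components vanish from the top down. If those above `i` are zero, then the lower ones contribute
to `F i`, hence so does the `i`-th, whose class is therefore zero. -/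
theorem eq_zero_of_grMap_mem {j : ℕ} {u : Gr F s} (hu : grMap F s u ∈ F j) (i : Fin s)
    (hi : j ≤ i) : u i = 0 := by
  have key : ∀ d, ∀ m, m + d = s → j ≤ m → ∀ i : Fin s, m ≤ i → u i = 0 := by
    intro d
    induction d with
    | zero => intro m hm _ i hi; have := i.2; omega
    | succ d ih =>
      intro m hm hj i hi
      have ih' := ih (m + 1) (by omega) (by omega)
      rcases hi.eq_or_lt with hi | hi
      · have h1 : ∑ l ∈ Finset.univ.erase i, (grSplit F l (u l) : V) ∈ F i := by
          refine Submodule.sum_mem _ fun l hl => ?_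
          rcases lt_trichotomy l i with h | h | h
          · exact hF.mono (by exact_mod_cast h) (grSplit F l (u l)).2
          · exact absurd h (Finset.ne_of_mem_erase hl)
          · rw [ih' l (by have : (i : ℕ) < l := h; omega), map_zero]
            exact zero_mem _
        have h2 : (grSplit F i (u i) : V) ∈ F i := by
          have h3 := sub_mem (hF.mono (by omega : j ≤ (i : ℕ)) hu) h1
          rwa [grMap_apply, ← Finset.add_sum_erase _ _ (Finset.mem_univ i),
            add_sub_cancel_right] at h3
        rw [← mk_grSplit F i (u i)]
        exact (Submodule.Quotient.mk_eq_zero _).2 h2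
      · exact ih' i hi
  by_cases hj : j ≤ s
  · exact key (s - j) j (by omega) le_rfl i hi
  · have := i.2; omega

theorem grMap_injective : Function.Injective (grMap F s) := by
  rw [← LinearMap.ker_eq_bot, LinearMap.ker_eq_bot']
  intro u hu
  funext i
  exact hF.eq_zero_of_grMap_mem (j := 0) (by rw [hu]; exact zero_mem _) i (by simp)

theorem grMap_surjective : Function.Surjective (grMap F s) := by
  have key : ∀ j ≤ s, F j ≤ LinearMap.range (grMap F s) := by
    intro j
    induction j with
    | zero => intro _; rw [hF.zero]; exact bot_le
    | succ j ih =>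
      intro hj v hv
      have h1 := ih (by omega) (grSplit_mk_sub F j ⟨v, hv⟩)
      rw [← sub_add_cancel v (grSplit F j (Submodule.Quotient.mk ⟨v, hv⟩))]
      exact add_mem h1 ⟨_, grMap_single ⟨j, hj⟩ _⟩
  intro v
  exact key s le_rfl (hF.top ▸ Submodule.mem_top)

/-- The linear isomorphism between the graded space and `V` given by the sections of the pieces. -/
def grEquiv : Gr F s ≃ₗ[ℝ] V :=
  LinearEquiv.ofBijective (grMap F s) ⟨hF.grMap_injective, hF.grMap_surjective⟩

theorem grEquiv_single (i : Fin s) (q : GrPiece F i) :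
    hF.grEquiv (Pi.single i q) = grSplit F i q := grMap_single i q

theorem grEquiv_symm_eq_zero {j : ℕ} {v : V} (hv : v ∈ F j) (i : Fin s) (hi : j ≤ i) :
    hF.grEquiv.symm v i = 0 :=
  hF.eq_zero_of_grMap_mem
    (show hF.grEquiv (hF.grEquiv.symm v) ∈ F j by rwa [LinearEquiv.apply_symm_apply]) i hi

theorem sub_grEquiv_grClass_mem {j : ℕ} {v : V} (hv : v ∈ F j) :
    v - hF.grEquiv (grClass F s j v hv) ∈ F (j - 1) := by
  by_cases hj : j = 0 ∨ s < j
  · rw [grClass_eq_zero hj, map_zero, sub_zero]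
    rcases hj with rfl | hj
    · exact hv
    · have : F (j - 1) = ⊤ := top_le_iff.1 (hF.top ▸ hF.mono (by omega))
      rw [this]; trivial
  · obtain ⟨i, rfl⟩ : ∃ i, j = i + 1 := ⟨j - 1, by omega⟩
    rw [grClass_succ ⟨i, by omega⟩ v hv, hF.grEquiv_single]
    exact grSplit_mk_sub F i ⟨v, hv⟩

theorem grEquiv_grClass_mem {j : ℕ} {v : V} (hv : v ∈ F j) :
    hF.grEquiv (grClass F s j v hv) ∈ F j := by
  have := sub_mem hv (hF.mono (Nat.sub_le j 1) (hF.sub_grEquiv_grClass_mem hv))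
  rwa [sub_sub_cancel] at this

end IsFiltration

end Splitting

/-! ### Weights and symbols of alternating forms -/

section Weights

variable {V : Type*} [AddCommGroup V] [Module ℝ V] {F : ℕ → Submodule ℝ V} {s : ℕ} {k : ℕ}

theorem HasWeightGE.mono {w w' : ℕ} {α : (Fin k → V) → ℝ} (hα : HasWeightGE F w α) (h : w' ≤ w) :
    HasWeightGE F w' α := fun j v hv hj => hα j v hv (by omega)

/-- The alternating forms of weight at least `w`. -/
def weightSub (F : ℕ → Submodule ℝ V) (k w : ℕ) : Submodule ℝ (V [⋀^Fin k]→ₗ[ℝ] ℝ) where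
  carrier := {α | HasWeightGE F w α}
  add_mem' ha hb := fun j v hv hj => by simp [ha j v hv hj, hb j v hv hj]
  zero_mem' := fun _ _ _ _ => rfl
  smul_mem' c α ha := fun j v hv hj => by simp [ha j v hv hj]

/-- A form of weight at least `w` does not change on vectors of total weight `w` if these are
changed by vectors of smaller weight. -/
theorem HasWeightGE.eq_of_sub_mem (hF : IsFiltration F s) {w : ℕ} {α : V [⋀^Fin k]→ₗ[ℝ] ℝ}
    (hα : HasWeightGE F w α) {j : Fin k → ℕ} {v v' : Fin k → V} (hv : ∀ i, v i ∈ F (j i))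
    (hv' : ∀ i, v' i ∈ F (j i)) (hs : ∀ i, v i - v' i ∈ F (j i - 1)) (hj : ∑ i, j i ≤ w) :
    α v = α v' := by
  classical
  have key : ∀ S : Finset (Fin k), α v = α (S.piecewise v' v) := by
    intro S
    induction S using Finset.induction_on with
    | empty => simp
    | insert a S ha ih =>
      rw [ih, Finset.piecewise_insert, ← sub_eq_zero]
      have h1 : S.piecewise v' v = Function.update (S.piecewise v' v) a (v a) := by
        rw [← Finset.piecewise_eq_of_notMem S v' v ha, Function.update_eq_self]
      conv_lhs => rw [h1, Function.update_idem]
      rw [← AlternatingMap.map_update_sub]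
      rcases Nat.eq_zero_or_pos (j a) with h0 | h0
      · have h2 := hs a
        rw [h0, hF.zero, Submodule.mem_bot] at h2
        rw [h2, AlternatingMap.map_update_zero]
      · refine hα (Function.update j a (j a - 1)) _ (fun i => ?_) ?_
        · by_cases hi : i = a
          · subst hi; simpa using hs i
          · rw [Function.update_of_ne hi, Function.update_of_ne hi]
            by_cases hS : i ∈ S
            · rw [Finset.piecewise_eq_of_mem _ _ _ hS]; exact hv' i
            · rw [Finset.piecewise_eq_of_notMem _ _ _ hS]; exact hv i
        · rw [Finset.sum_update_of_mem (Finset.mem_univ a)]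
          rw [← Finset.add_sum_erase _ _ (Finset.mem_univ a)] at hj
          rw [Finset.sdiff_singleton_eq_erase]
          omega
  rw [key Finset.univ, Finset.piecewise_univ]

theorem weightSub_zero (F : ℕ → Submodule ℝ V) (k : ℕ) : weightSub F k 0 = ⊤ :=
  eq_top_iff.2 fun _ _ _ _ _ hj => absurd hj (Nat.not_lt_zero _)

theorem eq_zero_of_hasWeightGE (hF : IsFiltration F s) {w : ℕ} (hw : k * s < w)
    {α : V [⋀^Fin k]→ₗ[ℝ] ℝ} (hα : HasWeightGE F w α) : α = 0 := by
  ext v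
  exact hα (fun _ => s) v (fun i => hF.top ▸ Submodule.mem_top) (by simpa using hw)

theorem weightSub_antitone (F : ℕ → Submodule ℝ V) (k : ℕ) : Antitone (weightSub F k) :=
  fun _ _ h _ hα => HasWeightGE.mono hα h

theorem expand_single (β : Gr F s [⋀^Fin k]→ₗ[ℝ] ℝ) (u : Fin k → Gr F s) :
    β u = ∑ r : Fin k → Fin s, β fun i => Pi.single (r i) (u i (r i)) := by
  have h : u = fun i => ∑ l : Fin s, Pi.single l (u i l) := by
    funext i
    exact (Finset.univ_sum_single (u i)).symm
  conv_lhs => rw [h]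
  exact MultilinearMap.map_sum β.toMultilinearMap _

namespace HasSymbol

variable {w : ℕ} {α : V [⋀^Fin k]→ₗ[ℝ] ℝ} {β : Gr F s [⋀^Fin k]→ₗ[ℝ] ℝ}

theorem apply_single {α : (Fin k → V) → ℝ} (h : HasSymbol F s w α β) (r : Fin k → Fin s)
    (q : ∀ i, GrPiece F (r i)) :
    β (fun i => Pi.single (r i) (q i)) =
      if ∑ i, ((r i : ℕ) + 1) = w then α fun i => grSplit F (r i) (q i) else 0 := by
  rw [← h.2 (fun i => (r i : ℕ) + 1) (fun i => grSplit F (r i) (q i))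
    (fun i => (grSplit F (r i) (q i)).2)]
  congr 1
  funext i
  exact (grClass_grSplit (r i) (q i)).symm

theorem unique {α : (Fin k → V) → ℝ} {β' : Gr F s [⋀^Fin k]→ₗ[ℝ] ℝ} (h : HasSymbol F s w α β)
    (h' : HasSymbol F s w α β') : β = β' := by
  ext u
  rw [expand_single β, expand_single β']
  exact Finset.sum_congr rfl fun r _ => by rw [h.apply_single, h'.apply_single]

theorem add {α α' : (Fin k → V) → ℝ} {β β' : Gr F s [⋀^Fin k]→ₗ[ℝ] ℝ} (h : HasSymbol F s w α β)
    (h' : HasSymbol F s w α' β') : HasSymbol F s w (fun v => α v + α' v) (β + β') := by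
  refine ⟨fun j v hv hj => by simp [h.1 j v hv hj, h'.1 j v hv hj], fun j v hv => ?_⟩
  rw [AlternatingMap.add_apply, h.2, h'.2]
  split_ifs <;> simp

theorem hasWeightGE_sub {α α' : (Fin k → V) → ℝ} (h : HasSymbol F s w α β)
    (h' : HasSymbol F s w α' β) : HasWeightGE F (w + 1) fun v => α v - α' v := by
  intro j v hv hj
  rcases (Nat.lt_succ_iff.1 hj).eq_or_lt with e | e
  · have h1 := h.2 j v hv
    have h2 := h'.2 j v hv
    rw [if_pos e] at h1 h2
    simp only [← h1, ← h2, sub_self]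
  · simp [h.1 j v hv e, h'.1 j v hv e]

variable (hF : IsFiltration F s)
include hF

/-- Expand along the pieces, piece `r` having weight `r + 1`. A vector of `F j` has no component in
pieces `r ≥ j`, so only summands of total weight at most `∑ j < w` could survive, and `β` is pure of
weight `w`. -/
theorem hasWeightGE_symm {α : (Fin k → V) → ℝ} (h : HasSymbol F s w α β) :
    HasWeightGE F w (β.compLinearMap hF.grEquiv.symm.toLinearMap) := by
  intro j v hv hj
  rw [AlternatingMap.compLinearMap_apply, expand_single]
  refine Finset.sum_eq_zero fun r _ => ?_
  by_cases hr : ∃ i, j i ≤ r i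
  · obtain ⟨i, hi⟩ := hr
    refine β.map_coord_zero i ?_
    change (Pi.single (r i) (hF.grEquiv.symm (v i) (r i)) : Gr F s) = 0
    rw [hF.grEquiv_symm_eq_zero (hv i) (r i) hi, Pi.single_zero]
  · push Not at hr
    rw [h.apply_single, if_neg]
    have : ∑ i, ((r i : ℕ) + 1) ≤ ∑ i, j i := Finset.sum_le_sum fun i _ => hr i
    omega

/-- Pulling `β` back through the splitting gives a form with symbol `β`. The choice of splitting is
invisible: it changes a vector only by one of lower weight, which a form of weight at least `w` does
not notice at total weight `w`. -/
theorem symm (h : HasSymbol F s w α β) :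
    HasSymbol F s w (β.compLinearMap hF.grEquiv.symm.toLinearMap) β := by
  refine ⟨h.hasWeightGE_symm hF, fun j v hv => ?_⟩
  split_ifs with hj
  · rw [(h.hasWeightGE_symm hF).eq_of_sub_mem hF hv (fun i => hF.grEquiv_grClass_mem (hv i))
      (fun i => hF.sub_grEquiv_grClass_mem (hv i)) hj.le, AlternatingMap.compLinearMap_apply]
    congr 1
    funext i
    exact (hF.grEquiv.symm_apply_apply _).symm
  · rw [h.2, if_neg hj]

end HasSymbol

theorem alternatingMap_sum_apply {G ι : Type*} [AddCommGroup G] [Module ℝ G] (S : Finset ι)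
    (f : ι → G [⋀^Fin k]→ₗ[ℝ] ℝ) (u : Fin k → G) : (∑ a ∈ S, f a) u = ∑ a ∈ S, f a u := by
  classical
  induction S using Finset.induction_on with
  | empty => rfl
  | insert a S ha ih => rw [Finset.sum_insert ha, Finset.sum_insert ha, ← ih]; rfl

/-- A Vandermonde system: the weights `c` recover the coefficient of `t ^ w` of a polynomial of
degree at most `m` from its values at `0, …, m`. -/
theorem exists_moments (m w : ℕ) :
    ∃ c : Fin (m + 1) → ℝ, ∀ l ≤ m, ∑ j, c j * (j : ℝ) ^ l = if l = w then 1 else 0 := by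
  set A := Matrix.vandermonde (fun j : Fin (m + 1) => (j : ℝ)) with hA
  have hdet : IsUnit A.det := by
    rw [isUnit_iff_ne_zero, hA, Matrix.det_vandermonde_ne_zero_iff]
    exact fun a b h => Fin.ext (Nat.cast_injective (R := ℝ) h)
  refine ⟨Matrix.vecMul (fun l : Fin (m + 1) => if (l : ℕ) = w then (1 : ℝ) else 0) A⁻¹,
    fun l hl => ?_⟩
  have h1 := congrFun (Matrix.vecMul_vecMul
    (fun l : Fin (m + 1) => if (l : ℕ) = w then (1 : ℝ) else 0) A⁻¹ A) ⟨l, by omega⟩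
  rw [Matrix.nonsing_inv_mul _ hdet, Matrix.vecMul_one] at h1
  rw [← h1]
  rfl

/-- The dilation of the graded space acting as `t ^ (i + 1)` on the piece `F (i + 1) / F i`. -/
def dilation (F : ℕ → Submodule ℝ V) (s : ℕ) (t : ℝ) : Gr F s →ₗ[ℝ] Gr F s :=
  LinearMap.pi fun i => t ^ ((i : ℕ) + 1) • LinearMap.proj i

theorem dilation_grClass (t : ℝ) {j : ℕ} {v : V} (hv : v ∈ F j) :
    dilation F s t (grClass F s j v hv) = t ^ j • grClass F s j v hv := by
  funext i
  change t ^ ((i : ℕ) + 1) • grClass F s j v hv i = t ^ j • grClass F s j v hv i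
  by_cases hi : (i : ℕ) + 1 = j
  · exact congrArg (fun n => t ^ n • grClass F s j v hv i) hi
  · simp only [grClass, dif_neg hi, smul_zero]

/-- Transported to the graded space and pulled back by the dilation of factor `t`, the form is
polynomial in `t` of degree at most `k * s`. Its coefficient of `t ^ w` is the component of weight
`w`, and this is the symbol. -/
theorem exists_hasSymbol (hF : IsFiltration F s) {w : ℕ} {α : V [⋀^Fin k]→ₗ[ℝ] ℝ}
    (hα : HasWeightGE F w α) : ∃ β : Gr F s [⋀^Fin k]→ₗ[ℝ] ℝ, HasSymbol F s w α β := by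
  obtain ⟨c, hc⟩ := exists_moments (k * s) w
  refine ⟨∑ a, c a • α.compLinearMap (hF.grEquiv.toLinearMap ∘ₗ dilation F s (a : ℝ)), hα,
    fun j v hv => ?_⟩
  have h0 : ∑ i, j i = w → α v = α fun i => hF.grEquiv (grClass F s (j i) (v i) (hv i)) :=
    fun hj => hα.eq_of_sub_mem hF hv (fun i => hF.grEquiv_grClass_mem (hv i))
      (fun i => hF.sub_grEquiv_grClass_mem (hv i)) hj.le
  have h1 : (∑ a, c a • α.compLinearMap (hF.grEquiv.toLinearMap ∘ₗ dilation F s (a : ℝ)))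
      (fun i => grClass F s (j i) (v i) (hv i)) =
      (∑ a, c a * (a : ℝ) ^ ∑ i, j i) *
        α fun i => hF.grEquiv (grClass F s (j i) (v i) (hv i)) := by
    rw [alternatingMap_sum_apply, Finset.sum_mul]
    refine Finset.sum_congr rfl fun a _ => ?_
    rw [AlternatingMap.smul_apply, AlternatingMap.compLinearMap_apply, smul_eq_mul, mul_assoc]
    congr 1
    have : (fun i => (hF.grEquiv.toLinearMap ∘ₗ dilation F s (a : ℝ))
        (grClass F s (j i) (v i) (hv i))) =
        fun i => ((a : ℝ) ^ j i) • hF.grEquiv (grClass F s (j i) (v i) (hv i)) := by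
      funext i
      rw [LinearMap.comp_apply, dilation_grClass, map_smul]
      rfl
    rw [this, AlternatingMap.map_smul_univ, Finset.prod_pow_eq_pow_sum, smul_eq_mul]
  rw [h1]
  -- Indices `0` and those beyond `s` have class zero. They are treated apart because the moment
  -- identities only cover exponents up to `k * s`.
  by_cases hz : ∃ i, j i = 0 ∨ s < j i
  · obtain ⟨i, hi⟩ := hz
    have h2 : (α fun i => hF.grEquiv (grClass F s (j i) (v i) (hv i))) = 0 :=
      α.map_coord_zero i (by rw [grClass_eq_zero hi, map_zero])
    rw [h2, mul_zero]
    split_ifs with hj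
    · rw [h0 hj, h2]
    · rfl
  · push Not at hz
    have : ∑ i, j i ≤ k * s := by
      simpa using Finset.sum_le_card_nsmul Finset.univ j s fun i _ => (hz i).2
    rw [hc _ this]
    split_ifs with hj
    · rw [h0 hj, one_mul]
    · rw [zero_mul]

/-- The forms on `V` as forms on the graded space. -/
def IsFiltration.altEquiv (hF : IsFiltration F s) (k : ℕ) :
    (V [⋀^Fin k]→ₗ[ℝ] ℝ) ≃ₗ[ℝ] (Gr F s [⋀^Fin k]→ₗ[ℝ] ℝ) :=
  AlternatingMap.domLCongr ℝ ℝ (Fin k) ℝ hF.grEquiv.symm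

/-- A space of forms on the graded space contains all forms coming from forms of weight at least
`w` if it contains the symbols of weight at least `w`. -/
theorem altEquiv_mem_of_symbols (hF : IsFiltration F s) {w : ℕ}
    {p : Submodule ℝ (Gr F s [⋀^Fin k]→ₗ[ℝ] ℝ)}
    (hp : ∀ w' ≥ w, ∀ (α : V [⋀^Fin k]→ₗ[ℝ] ℝ) β, HasSymbol F s w' α β → β ∈ p)
    {α : V [⋀^Fin k]→ₗ[ℝ] ℝ} (hα : HasWeightGE F w α) : hF.altEquiv k α ∈ p := by
  -- Subtracting the representative of its symbol raises the weight of a form, and no nonzero form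
  -- has weight above `k * s`.
  have key : ∀ d, ∀ w' ≥ w, k * s < w' + d → ∀ α : V [⋀^Fin k]→ₗ[ℝ] ℝ,
      HasWeightGE F w' α → hF.altEquiv k α ∈ p := by
    intro d
    induction d with
    | zero =>
      intro w' _ hd α hα
      rw [eq_zero_of_hasWeightGE hF hd hα, map_zero]
      exact zero_mem _
    | succ d ih =>
      intro w' hw' hd α hα
      obtain ⟨β, hβ⟩ := exists_hasSymbol hF hα
      have h1 := ih (w' + 1) (by omega) (by omega) (α - (hF.altEquiv k).symm β)
        (hβ.hasWeightGE_sub (hβ.symm hF))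
      rw [map_sub, LinearEquiv.apply_symm_apply] at h1
      simpa using add_mem h1 (hp w' hw' α β hβ)
  exact key (k * s + 1) w le_rfl (by omega) α hα

end Weights

end

section

/-! ### Finite-dimensional Hodge theory -/

section Hodge

theorem finrank_map_of_ker {V W : Type*} [AddCommGroup V] [Module ℝ V] [AddCommGroup W]
    [Module ℝ W] {f : V →ₗ[ℝ] W} {p : Submodule ℝ V} (h : ∀ v ∈ p, f v = 0 → v = 0) :
    Module.finrank ℝ (p.map f) = Module.finrank ℝ p := by
  rw [← LinearMap.range_domRestrict]
  refine LinearMap.finrank_range_of_inj ?_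
  rw [← LinearMap.ker_eq_bot, LinearMap.ker_eq_bot']
  exact fun v hv => Subtype.ext (h v v.2 hv)

theorem natTrailingDegree_charpoly_eq {V : Type*} [AddCommGroup V] [Module ℝ V]
    [FiniteDimensional ℝ V] (φ : Module.End ℝ V) :
    φ.charpoly.natTrailingDegree = Module.finrank ℝ ↥(⨆ k : ℕ, LinearMap.ker (φ ^ k)) := by
  have h : φ.maxGenEigenspace 0 = ⨆ k : ℕ, LinearMap.ker (φ ^ k) := by
    simp [← Module.End.iSup_genEigenspace_eq, Module.End.genEigenspace_nat]
  rw [← LinearMap.finrank_maxGenEigenspace_zero_eq, h]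

/-- A bilinear form is a scalar product. -/
structure IsScalarProduct {V : Type*} [AddCommGroup V] [Module ℝ V]
    (b : V →ₗ[ℝ] V →ₗ[ℝ] ℝ) : Prop where
  comm : ∀ u v, b u v = b v u
  nonneg : ∀ v, 0 ≤ b v v
  definite : ∀ v, b v v = 0 → v = 0

variable {U V W : Type*} [AddCommGroup U] [Module ℝ U] [AddCommGroup V] [Module ℝ V]
  [AddCommGroup W] [Module ℝ W]
  {bU : U →ₗ[ℝ] U →ₗ[ℝ] ℝ} {bV : V →ₗ[ℝ] V →ₗ[ℝ] ℝ} {bW : W →ₗ[ℝ] W →ₗ[ℝ] ℝ}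
  {f : U →ₗ[ℝ] V} {g : V →ₗ[ℝ] W} {f' : V →ₗ[ℝ] U} {g' : W →ₗ[ℝ] V}

/-- `f : U → V` and `g : V → W` are linear maps between Euclidean spaces with transposes `f'`
and `g'`. -/
structure IsHodgePair (bU : U →ₗ[ℝ] U →ₗ[ℝ] ℝ) (bV : V →ₗ[ℝ] V →ₗ[ℝ] ℝ)
    (bW : W →ₗ[ℝ] W →ₗ[ℝ] ℝ) (f : U →ₗ[ℝ] V) (g : V →ₗ[ℝ] W) (f' : V →ₗ[ℝ] U)
    (g' : W →ₗ[ℝ] V) : Prop where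
  prodU : IsScalarProduct bU
  prodV : IsScalarProduct bV
  prodW : IsScalarProduct bW
  adj_f : ∀ u v, bV (f u) v = bU u (f' v)
  adj_g : ∀ v w, bW (g v) w = bV v (g' w)

namespace IsHodgePair

variable (h : IsHodgePair bU bV bW f g f' g')
include h

theorem laplacian_apply (u v : V) :
    bV ((f ∘ₗ f' + g' ∘ₗ g) u) v = bU (f' u) (f' v) + bW (g u) (g v) := by
  rw [LinearMap.add_apply, map_add, LinearMap.add_apply, LinearMap.comp_apply,
    LinearMap.comp_apply, h.adj_f, h.prodV.comm (g' _), ← h.adj_g, h.prodW.comm (g u)]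

theorem laplacian_eq_zero_iff {v : V} : (f ∘ₗ f' + g' ∘ₗ g) v = 0 ↔ f' v = 0 ∧ g v = 0 := by
  constructor
  · intro hv
    have h1 := h.laplacian_apply v v
    rw [hv, map_zero, LinearMap.zero_apply] at h1
    have h2 := h.prodU.nonneg (f' v)
    have h3 := h.prodW.nonneg (g v)
    exact ⟨h.prodU.definite _ (by linarith), h.prodW.definite _ (by linarith)⟩
  · rintro ⟨h1, h2⟩
    simp [h1, h2]

/-- The Laplacian `Δ` is symmetric, so `⟨Δ v, Δ v⟩ = ⟨Δ² v, v⟩ = 0`. -/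
theorem laplacian_sq {v : V} (hv : (f ∘ₗ f' + g' ∘ₗ g) ((f ∘ₗ f' + g' ∘ₗ g) v) = 0) :
    (f ∘ₗ f' + g' ∘ₗ g) v = 0 := by
  refine h.prodV.definite _ ?_
  rw [h.laplacian_apply, h.prodU.comm, h.prodW.comm, ← h.laplacian_apply, hv, map_zero,
    LinearMap.zero_apply]

variable [FiniteDimensional ℝ U] [FiniteDimensional ℝ V]

/-- Restrict `f'` to `ker g`. The kernel is that of the Laplacian. The range has the rank of `f`,
since `f` is injective on the range of `f'`, and `f'` on the range of `f ⊆ ker g`. -/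
theorem finrank_ker_laplacian (hgf : ∀ u, g (f u) = 0) :
    Module.finrank ℝ (LinearMap.ker (f ∘ₗ f' + g' ∘ₗ g)) + Module.finrank ℝ (LinearMap.range f) +
      Module.finrank ℝ (LinearMap.range g) = Module.finrank ℝ V := by
  have h1 := LinearMap.finrank_range_add_finrank_ker g
  have h2 := LinearMap.finrank_range_add_finrank_ker (f'.domRestrict (LinearMap.ker g))
  have h3 : Module.finrank ℝ (LinearMap.ker (f'.domRestrict (LinearMap.ker g))) =
      Module.finrank ℝ (LinearMap.ker (f ∘ₗ f' + g' ∘ₗ g)) := by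
    have e : (LinearMap.ker (f'.domRestrict (LinearMap.ker g))).map (LinearMap.ker g).subtype =
        LinearMap.ker (f ∘ₗ f' + g' ∘ₗ g) := by
      ext v
      rw [LinearMap.mem_ker, h.laplacian_eq_zero_iff]
      constructor
      · rintro ⟨⟨v, hv⟩, hv', rfl⟩
        exact ⟨hv', hv⟩
      · rintro ⟨hv', hv⟩
        exact ⟨⟨v, hv⟩, hv', rfl⟩
    rw [← e, Submodule.finrank_map_subtype_eq]
  have h4 : Module.finrank ℝ (LinearMap.range (f'.domRestrict (LinearMap.ker g))) =
      Module.finrank ℝ (LinearMap.range f) := by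
    rw [LinearMap.range_domRestrict]
    refine le_antisymm ?_ ?_
    · rw [← finrank_map_of_ker (f := f) (p := (LinearMap.ker g).map f')]
      · exact Submodule.finrank_mono (LinearMap.map_le_range)
      · rintro _ ⟨v, -, rfl⟩ hv
        refine h.prodU.definite _ ?_
        rw [← h.adj_f, hv, map_zero, LinearMap.zero_apply]
    · rw [← finrank_map_of_ker (f := f') (p := LinearMap.range f)]
      · refine Submodule.finrank_mono (Submodule.map_mono ?_)
        rintro _ ⟨u, rfl⟩
        exact hgf u
      · rintro _ ⟨u, rfl⟩ hu
        refine h.prodV.definite _ ?_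
        rw [h.adj_f, hu, map_zero]
  omega

end IsHodgePair

end Hodge

/-! ### The scalar product on covectors of the graded space -/

section Metric

instance finite_alternatingMap {G : Type*} [AddCommGroup G] [Module ℝ G] [FiniteDimensional ℝ G]
    (k : ℕ) : FiniteDimensional ℝ (G [⋀^Fin k]→ₗ[ℝ] ℝ) :=
  Module.Finite.equiv (exteriorPower.alternatingMapLinearEquiv (R := ℝ) (M := G) (N := ℝ)
    (n := k)).symm

/-- Sorting a tuple of distinct basis vectors changes the value only by a sign. This makes the
scalar product of covectors definite. -/
theorem alternatingMap_eq_zero_of_basis {G : Type*} [AddCommGroup G] [Module ℝ G] {n k : ℕ}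
    (b : Module.Basis (Fin n) ℝ G) {α : G [⋀^Fin k]→ₗ[ℝ] ℝ}
    (h : ∀ I : Fin k ↪o Fin n, α (fun i => b (I i)) = 0) : α = 0 := by
  refine b.ext_alternating fun v hv => ?_
  have hm : StrictMono (v ∘ Tuple.sort v) :=
    (Tuple.monotone_sort v).strictMono_of_injective (hv.comp (Tuple.sort v).injective)
  have h1 := α.map_perm (fun i => b (v i)) (Tuple.sort v)
  have h2 : α ((fun i => b (v i)) ∘ Tuple.sort v) = 0 := h (OrderEmbedding.ofStrictMono _ hm)
  rw [h2] at h1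
  rw [AlternatingMap.zero_apply]
  rcases Int.units_eq_one_or (Equiv.Perm.sign (Tuple.sort v)) with e | e <;> rw [e] at h1
  · simpa using h1.symm
  · simpa using h1.symm

variable {V : Type*} [NormedAddCommGroup V] [InnerProductSpace ℝ V] [FiniteDimensional ℝ V]
  (F : ℕ → Submodule ℝ V) (s k : ℕ)

/-- The scalar product of covectors of the graded space, as a bilinear map. -/
def grAltForm : (Gr F s [⋀^Fin k]→ₗ[ℝ] ℝ) →ₗ[ℝ] (Gr F s [⋀^Fin k]→ₗ[ℝ] ℝ) →ₗ[ℝ] ℝ :=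
  LinearMap.mk₂ ℝ (grAltInner F s)
    (fun α β γ => by simp [grAltInner, altInner, add_mul, Finset.sum_add_distrib])
    (fun c α β => by simp [grAltInner, altInner, Finset.mul_sum, mul_assoc])
    (fun α β γ => by simp [grAltInner, altInner, mul_add, Finset.sum_add_distrib])
    (fun c α β => by simp [grAltInner, altInner, Finset.mul_sum, mul_left_comm])

theorem isScalarProduct_grAltForm : IsScalarProduct (grAltForm F s k) where
  comm α β := Finset.sum_congr rfl fun I _ => mul_comm _ _
  nonneg α := Finset.sum_nonneg fun I _ => mul_self_nonneg _
  definite α h := by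
    have h1 := (Finset.sum_eq_zero_iff_of_nonneg fun I _ => mul_self_nonneg _).1 h
    have h2 : α.compLinearMap (WithLp.linearEquiv 2 ℝ (Gr F s)).toLinearMap = 0 := by
      refine alternatingMap_eq_zero_of_basis
        (stdOrthonormalBasis ℝ (PiLp 2 fun i : Fin s => GrPiece F i)).toBasis fun I => ?_
      have h3 := mul_self_eq_zero.1 (h1 I (Finset.mem_univ I))
      simp only [OrthonormalBasis.coe_toBasis]
      exact h3
    ext u
    exact congrArg (fun β => β fun i => WithLp.toLp 2 (u i)) h2

end Metric

end

section

theorem continuous_alternatingMap {V : Type*} [NormedAddCommGroup V] [NormedSpace ℝ V]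
    [FiniteDimensional ℝ V] {k : ℕ} (α : V [⋀^Fin k]→ₗ[ℝ] ℝ) : Continuous α := by
  set b := Module.finBasis ℝ V
  have h : ∀ v, α v = ∑ r : Fin k → Fin (Module.finrank ℝ V),
      (∏ i, b.repr (v i) (r i)) * α fun i => b (r i) := by
    intro v
    have h1 : v = fun i => ∑ l, b.repr (v i) l • b l := by
      funext i
      exact (b.sum_repr (v i)).symm
    conv_lhs => rw [h1]
    refine (MultilinearMap.map_sum α.toMultilinearMap _).trans ?_
    refine Finset.sum_congr rfl fun r _ => ?_
    exact α.toMultilinearMap.map_smul_univ (fun i => b.repr (v i) (r i)) fun i => b (r i)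
  have h2 : (α : (Fin k → V) → ℝ) = fun v => ∑ r : Fin k → Fin (Module.finrank ℝ V),
      (∏ i, b.repr (v i) (r i)) * α fun i => b (r i) := funext h
  rw [h2]
  refine continuous_finsetSum _ fun r _ => (continuous_finsetProd _ fun i _ => ?_).mul
    continuous_const
  exact (LinearMap.continuous_of_finiteDimensional (b.coord (r i))).comp (continuous_apply i)

variable {E : Type*} [NormedAddCommGroup E] [NormedSpace ℝ E] [FiniteDimensional ℝ E]
  {M : Type*} [TopologicalSpace M] [ChartedSpace E M]

theorem toAlternatingMapLinear_bijective (k : ℕ) (x : M) : Function.Bijective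
    (ContinuousAlternatingMap.toAlternatingMapLinear (R := ℝ) :
      AltTangent E k x →ₗ[ℝ] (TangentSpace 𝓘(ℝ, E) x [⋀^Fin k]→ₗ[ℝ] ℝ)) :=
  ⟨ContinuousAlternatingMap.toAlternatingMap_injective, fun α =>
    ⟨{ α with cont := continuous_alternatingMap (V := E) α }, rfl⟩⟩

/-- In finite dimension all alternating forms are continuous. -/
def altTangentEquiv (k : ℕ) (x : M) :
    AltTangent E k x ≃ₗ[ℝ] (TangentSpace 𝓘(ℝ, E) x [⋀^Fin k]→ₗ[ℝ] ℝ) :=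
  LinearEquiv.ofBijective _ (toAlternatingMapLinear_bijective k x)

instance finite_altTangent (k : ℕ) (x : M) : FiniteDimensional ℝ (AltTangent E k x) :=
  Module.Finite.equiv (altTangentEquiv k x).symm

variable [IsManifold 𝓘(ℝ, E) ∞ M]

/-! ### Symbols and graded maps at a point -/

namespace FilteredManifold

variable (𝓗 : FilteredManifold E M)

omit [FiniteDimensional ℝ E] in
theorem isFiltration (x : M) : IsFiltration (𝓗.fil x) 𝓗.depth :=
  ⟨𝓗.zero x, 𝓗.mono x, 𝓗.top x⟩

/-- The forms at `x` as forms on the graded space. -/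
def symbolEquiv (k : ℕ) (x : M) : AltTangent E k x ≃ₗ[ℝ] (𝓗.gr x [⋀^Fin k]→ₗ[ℝ] ℝ) :=
  (altTangentEquiv k x).trans ((𝓗.isFiltration x).altEquiv k)

/-- The forms on the graded space of weight at least `w`. -/
def grWeight (k : ℕ) (x : M) (w : ℕ) : Submodule ℝ (𝓗.gr x [⋀^Fin k]→ₗ[ℝ] ℝ) :=
  (weightSub (𝓗.fil x) k w).map ((𝓗.isFiltration x).altEquiv k).toLinearMap

variable {𝓗} {x : M}

theorem mem_of_symbols {k w : ℕ} {p : Submodule ℝ (𝓗.gr x [⋀^Fin k]→ₗ[ℝ] ℝ)}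
    (hp : ∀ w' ≥ w, ∀ (α : AltTangent E k x) β,
      HasSymbol (𝓗.fil x) 𝓗.depth w' (fun v => α v) β → β ∈ p) : 𝓗.grWeight k x w ≤ p := by
  rintro _ ⟨α, hα, rfl⟩
  refine altEquiv_mem_of_symbols (𝓗.isFiltration x) (fun w' hw' α β h => ?_) hα
  obtain ⟨α, rfl⟩ := (altTangentEquiv k x).surjective α
  exact hp w' hw' α β h

omit [FiniteDimensional ℝ E] in
theorem grWeight_zero (𝓗 : FilteredManifold E M) (k : ℕ) (x : M) : 𝓗.grWeight k x 0 = ⊤ := by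
  rw [grWeight, weightSub_zero, Submodule.map_top]
  exact LinearEquiv.range _

omit [FiniteDimensional ℝ E] in
theorem mem_grWeight_of_hasSymbol {k w : ℕ} {α : (Fin k → TangentSpace 𝓘(ℝ, E) x) → ℝ}
    {β : 𝓗.gr x [⋀^Fin k]→ₗ[ℝ] ℝ} (h : HasSymbol (𝓗.fil x) 𝓗.depth w α β) :
    β ∈ 𝓗.grWeight k x w :=
  ⟨_, h.hasWeightGE_symm (𝓗.isFiltration x),
    ((𝓗.isFiltration x).altEquiv k).apply_symm_apply β⟩

theorem symbolEquiv_sub_mem {k w : ℕ} {α : AltTangent E k x} {β : 𝓗.gr x [⋀^Fin k]→ₗ[ℝ] ℝ}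
    (h : HasSymbol (𝓗.fil x) 𝓗.depth w (fun v => α v) β) :
    𝓗.symbolEquiv k x α - β ∈ 𝓗.grWeight k x (w + 1) := by
  refine ⟨altTangentEquiv k x α - ((𝓗.isFiltration x).altEquiv k).symm β,
    h.hasWeightGE_sub (α := altTangentEquiv k x α)
      (HasSymbol.symm (𝓗.isFiltration x) (α := altTangentEquiv k x α) h), ?_⟩
  rw [map_sub]
  congr 1
  exact ((𝓗.isFiltration x).altEquiv k).apply_symm_apply β

theorem exists_symbol {k w : ℕ} {α : AltTangent E k x}
    (hα : HasWeightGE (𝓗.fil x) w fun v => α v) :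
    ∃ β, HasSymbol (𝓗.fil x) 𝓗.depth w (fun v => α v) β :=
  exists_hasSymbol (𝓗.isFiltration x) (α := altTangentEquiv k x α) hα

namespace IsGr

omit [FiniteDimensional ℝ E] in
theorem comp {k l m : ℕ} {D : AltTangent E k x →ₗ[ℝ] AltTangent E l x}
    {T : (𝓗.gr x [⋀^Fin k]→ₗ[ℝ] ℝ) →ₗ[ℝ] (𝓗.gr x [⋀^Fin l]→ₗ[ℝ] ℝ)}
    {D' : AltTangent E l x →ₗ[ℝ] AltTangent E m x}
    {T' : (𝓗.gr x [⋀^Fin l]→ₗ[ℝ] ℝ) →ₗ[ℝ] (𝓗.gr x [⋀^Fin m]→ₗ[ℝ] ℝ)}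
    (h' : 𝓗.IsGr x D' T') (h : 𝓗.IsGr x D T) : 𝓗.IsGr x (D' ∘ₗ D) (T' ∘ₗ T) :=
  fun w α β hβ => h' w (D α) (T β) (h w α β hβ)

omit [FiniteDimensional ℝ E] in
theorem add {k l : ℕ} {D D' : AltTangent E k x →ₗ[ℝ] AltTangent E l x}
    {T T' : (𝓗.gr x [⋀^Fin k]→ₗ[ℝ] ℝ) →ₗ[ℝ] (𝓗.gr x [⋀^Fin l]→ₗ[ℝ] ℝ)}
    (h : 𝓗.IsGr x D T) (h' : 𝓗.IsGr x D' T') : 𝓗.IsGr x (D + D') (T + T') :=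
  fun w α β hβ => (h w α β hβ).add (h' w α β hβ)

theorem eq_zero {k l : ℕ} {T : (𝓗.gr x [⋀^Fin k]→ₗ[ℝ] ℝ) →ₗ[ℝ] (𝓗.gr x [⋀^Fin l]→ₗ[ℝ] ℝ)}
    (h : 𝓗.IsGr x (0 : AltTangent E k x →ₗ[ℝ] AltTangent E l x) T) : T = 0 := by
  rw [← LinearMap.ker_eq_top, eq_top_iff, ← 𝓗.grWeight_zero k x]
  refine mem_of_symbols fun w _ α β hβ => ?_
  exact (h w α β hβ).unique
    ⟨fun _ _ _ _ => rfl, fun _ _ _ => by simp⟩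

theorem hasWeightGE {k l w : ℕ} {D : AltTangent E k x →ₗ[ℝ] AltTangent E l x}
    {T : (𝓗.gr x [⋀^Fin k]→ₗ[ℝ] ℝ) →ₗ[ℝ] (𝓗.gr x [⋀^Fin l]→ₗ[ℝ] ℝ)}
    (h : 𝓗.IsGr x D T) {α : AltTangent E k x} (hα : HasWeightGE (𝓗.fil x) w fun v => α v) :
    HasWeightGE (𝓗.fil x) w fun v => D α v := by
  obtain ⟨β, hβ⟩ := exists_symbol hα
  exact (h w α β hβ).1

variable {k : ℕ} {D : AltTangent E k x →ₗ[ℝ] AltTangent E k x}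
  {T : (𝓗.gr x [⋀^Fin k]→ₗ[ℝ] ℝ) →ₗ[ℝ] (𝓗.gr x [⋀^Fin k]→ₗ[ℝ] ℝ)}

theorem map_mem (h : 𝓗.IsGr x D T) (w : ℕ) {β : 𝓗.gr x [⋀^Fin k]→ₗ[ℝ] ℝ}
    (hβ : β ∈ 𝓗.grWeight k x w) : T β ∈ 𝓗.grWeight k x w := by
  refine mem_of_symbols (p := (𝓗.grWeight k x w).comap T) (fun w' hw' α β hβ => ?_) hβ
  exact Submodule.map_mono (weightSub_antitone _ _ hw') (mem_grWeight_of_hasSymbol (h w' α β hβ))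

instance finite_gr (𝓗 : FilteredManifold E M) (k : ℕ) (x : M) :
    FiniteDimensional ℝ (𝓗.gr x [⋀^Fin k]→ₗ[ℝ] ℝ) :=
  Module.Finite.equiv (𝓗.symbolEquiv k x)

/-- Read through a splitting, a filtration-preserving map agrees with its graded map up to higher
weight. -/
theorem filteredPerturbation (h : 𝓗.IsGr x D T) (hT : ∀ β, T (T β) = 0 → T β = 0) :
    FilteredPerturbation (𝓗.grWeight k x) (k * 𝓗.depth + 1) T
      ((𝓗.symbolEquiv k x).conj D) where
  anti := fun _ _ hw => Submodule.map_mono (weightSub_antitone _ _ hw)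
  zero := 𝓗.grWeight_zero k x
  last := by
    rw [eq_bot_iff]
    rintro _ ⟨α, hα, rfl⟩
    rw [eq_zero_of_hasWeightGE (𝓗.isFiltration x) (Nat.lt_succ_self _) hα]
    exact map_zero _
  mem := fun w v hv => h.map_mem w hv
  ker := hT
  range := by
    intro w v hv
    -- `T` preserves this finite-dimensional space and is injective on its image, so image and
    -- second image have the same dimension.
    have h1 : ((𝓗.grWeight k x w).map T).map T = (𝓗.grWeight k x w).map T := by
      refine Submodule.eq_of_le_of_finrank_eq ?_ ?_
      · refine Submodule.map_mono ?_
        rintro _ ⟨u, hu, rfl⟩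
        exact h.map_mem w hu
      · refine finrank_map_of_ker ?_
        rintro _ ⟨u, -, rfl⟩ hu
        exact hT u hu
    have h2 : T v ∈ ((𝓗.grWeight k x w).map T).map T := by
      rw [h1]
      exact ⟨v, hv, rfl⟩
    obtain ⟨_, ⟨u, hu, rfl⟩, e⟩ := h2
    exact ⟨u, hu, e.symm⟩
  sub := by
    rintro w _ ⟨α, hα, rfl⟩
    obtain ⟨α, rfl⟩ := (altTangentEquiv k x).surjective α
    obtain ⟨β, hβ⟩ := exists_symbol (α := α) hα
    have h1 := symbolEquiv_sub_mem (h w α β hβ)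
    have h2 := h.map_mem _ (symbolEquiv_sub_mem hβ)
    rw [map_sub] at h2
    have h3 := sub_mem h1 h2
    rw [sub_sub_sub_cancel_right] at h3
    have h4 : (𝓗.symbolEquiv k x).conj D (𝓗.symbolEquiv k x α) = 𝓗.symbolEquiv k x (D α) := by
      simp [LinearEquiv.conj_apply]
    rw [← h4] at h3
    exact h3

/-- The left side is the dimension of the generalised kernel of `D`. It depends only on the graded
map, although `D` itself need not be symmetric for any scalar product. -/
theorem natTrailingDegree_charpoly (h : 𝓗.IsGr x D T) (hT : ∀ β, T (T β) = 0 → T β = 0) :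
    (LinearMap.charpoly D).natTrailingDegree = Module.finrank ℝ (LinearMap.ker T) := by
  rw [← (h.filteredPerturbation hT).finrank_iSup_ker_pow,
    ← LinearEquiv.charpoly_conj (𝓗.symbolEquiv k x), natTrailingDegree_charpoly_eq]

end IsGr

end FilteredManifold

end

section

variable {E : Type*} [NormedAddCommGroup E] [NormedSpace ℝ E] [FiniteDimensional ℝ E]
  {M : Type*} [TopologicalSpace M] [ChartedSpace E M] [IsManifold 𝓘(ℝ, E) ∞ M]

/-! ### Global smooth forms with prescribed local expression -/

section ConstantForms

theorem exists_smooth_bump [T2Space M] {x : M} {U : Set M} (hU : U ∈ 𝓝 x) :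
    ∃ f : M → ℝ, ContMDiff 𝓘(ℝ, E) 𝓘(ℝ, ℝ) ∞ f ∧ (∀ᶠ y in 𝓝 x, f y = 1) ∧ tsupport f ⊆ U := by
  obtain ⟨f, -, hf⟩ := (SmoothBumpFunction.nhds_basis_tsupport (I := 𝓘(ℝ, E)) x).mem_iff.1 hU
  exact ⟨f, f.contMDiff, f.eventuallyEq_one, hf⟩

instance finite_continuousAlternatingMap (k : ℕ) : FiniteDimensional ℝ (E [⋀^Fin k]→L[ℝ] ℝ) :=
  Module.Finite.of_injective (ContinuousAlternatingMap.toAlternatingMapLinear (R := ℝ) :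
    (E [⋀^Fin k]→L[ℝ] ℝ) →ₗ[ℝ] (E [⋀^Fin k]→ₗ[ℝ] ℝ))
    ContinuousAlternatingMap.toAlternatingMap_injective

theorem contDiffAt_of_apply {k : ℕ} {g : E → E [⋀^Fin k]→L[ℝ] ℝ} {y : E}
    (h : ∀ v : Fin k → E, ContDiffAt ℝ ∞ (fun z => g z v) y) : ContDiffAt ℝ ∞ g y := by
  set b := Module.finBasis ℝ E
  set ev : (E [⋀^Fin k]→L[ℝ] ℝ) →ₗ[ℝ] ((Fin k → Fin (Module.finrank ℝ E)) → ℝ) :=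
    { toFun := fun c r => c fun i => b (r i)
      map_add' := fun _ _ => rfl
      map_smul' := fun _ _ => rfl }
  have hev : LinearMap.ker ev = ⊥ := by
    rw [LinearMap.ker_eq_bot']
    intro c hc
    refine ContinuousAlternatingMap.toAlternatingMap_injective (b.ext_alternating fun r _ => ?_)
    exact congrFun hc r
  obtain ⟨l, hl⟩ := ev.exists_leftInverse_of_injective hev
  have h1 : g = fun z => LinearMap.toContinuousLinearMap l (ev (g z)) := by
    funext z
    exact (LinearMap.congr_fun hl (g z)).symm
  rw [h1]
  refine (LinearMap.toContinuousLinearMap l).contDiff.contDiffAt.comp y ?_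
  rw [contDiffAt_pi]
  exact fun r => h _

/-- The form which in the preferred chart at `x₀` is the constant `c`. -/
def constForm {k : ℕ} (x₀ : M) (c : E [⋀^Fin k]→L[ℝ] ℝ) (x : M) : AltTangent E k x :=
  ContinuousAlternatingMap.compContinuousLinearMap c
    ((trivializationAt E (TangentSpace 𝓘(ℝ, E)) x₀).continuousLinearMapAt ℝ x)

theorem contDiffAt_localRep_constForm {k : ℕ} (x₀ : M) (c : E [⋀^Fin k]→L[ℝ] ℝ) {x : M}
    (hx : x ∈ (chartAt E x₀).source) :
    ContDiffAt ℝ ∞ (localRep (constForm x₀ c) x) (chartAt E x x) := by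
  have hz : chartAt E x x ∈ ((chartAt E x).symm.trans (chartAt E x₀)).source := by
    refine ⟨mem_chart_target E x, ?_⟩
    change (chartAt E x).symm (chartAt E x x) ∈ (chartAt E x₀).source
    rwa [(chartAt E x).left_inv (mem_chart_source E x)]
  refine contDiffAt_of_apply fun v => ?_
  have hev : (fun z => localRep (constForm x₀ c) x z v) =ᶠ[𝓝 (chartAt E x x)] fun z =>
      c fun i => fderiv ℝ (chartAt E x₀ ∘ (chartAt E x).symm) z (v i) := by
    filter_upwards [((chartAt E x).symm.trans (chartAt E x₀)).open_source.mem_nhds hz] with z hz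
    rw [fderiv_chart_change x x₀ hz]
    rfl
  refine ContDiffAt.congr_of_eventuallyEq ?_ hev
  have h1 : ContDiffAt ℝ ∞ (fderiv ℝ (chartAt E x₀ ∘ (chartAt E x).symm)) (chartAt E x x) :=
    (contDiffAt_chart_change x x₀ hz).fderiv_right (by simp)
  refine (c.toContinuousMultilinearMap.contDiff.contDiffAt).comp (chartAt E x x) ?_
  rw [contDiffAt_pi]
  exact fun i => h1.clm_apply contDiffAt_const

theorem contMDiffOn_constForm {k : ℕ} (x₀ : M) (c : E [⋀^Fin k]→L[ℝ] ℝ) :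
    ContMDiffOn 𝓘(ℝ, E) (𝓘(ℝ, E).prod 𝓘(ℝ, E [⋀^Fin k]→L[ℝ] ℝ)) ∞
      (fun x => Bundle.TotalSpace.mk' (E [⋀^Fin k]→L[ℝ] ℝ) x (constForm x₀ c x))
      (chartAt E x₀).source := fun x hx =>
  ((contMDiffAt_form_iff _ x).2 (contDiffAt_localRep_constForm x₀ c hx)).contMDiffWithinAt

variable [T2Space M]

/-- Algebraic operators are only known to be smooth on global forms. Cutting off chart-constant
forms gives global forms that are a local frame near `x₀`. -/
theorem exists_form_eq_constForm {k : ℕ} (x₀ : M) (c : E [⋀^Fin k]→L[ℝ] ℝ) :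
    ∃ η : DiffForm E M k, ∀ᶠ x in 𝓝 x₀, η x = constForm x₀ c x := by
  obtain ⟨f, hf, hf1, hfU⟩ := exists_smooth_bump (E := E)
    ((chartAt E x₀).open_source.mem_nhds (mem_chart_source E x₀))
  refine ⟨⟨f • constForm x₀ c, ContMDiffOn.smul_section_of_tsupport hf.contMDiffOn
    (chartAt E x₀).open_source hfU (contMDiffOn_constForm x₀ c)⟩, ?_⟩
  filter_upwards [hf1] with x hx
  change f x • constForm x₀ c x = _
  rw [hx, one_smul]

/-- The forms at `x` in the preferred chart at `x₀`. -/
def coordEquiv {k : ℕ} (x₀ : M) {x : M} (hx : x ∈ (chartAt E x₀).source) :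
    AltTangent E k x ≃ₗ[ℝ] (E [⋀^Fin k]→L[ℝ] ℝ) where
  toFun α := ContinuousAlternatingMap.compContinuousLinearMap α
    ((trivializationAt E (TangentSpace 𝓘(ℝ, E)) x₀).symmL ℝ x)
  map_add' _ _ := rfl
  map_smul' _ _ := rfl
  invFun c := constForm x₀ c x
  left_inv α := by
    ext v
    change α _ = α v
    congr 1
    funext i
    exact (trivializationAt E (TangentSpace 𝓘(ℝ, E)) x₀).symmL_continuousLinearMapAt
      (R := ℝ) hx _
  right_inv c := by
    ext v
    change c _ = c v
    congr 1
    funext i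
    exact (trivializationAt E (TangentSpace 𝓘(ℝ, E)) x₀).continuousLinearMapAt_symmL
      (R := ℝ) hx _

omit [T2Space M] in
theorem contMDiffAt_coord {k : ℕ} (η : DiffForm E M k) (x₀ : M)
    (l : (E [⋀^Fin k]→L[ℝ] ℝ) →ₗ[ℝ] ℝ) :
    ContMDiffAt 𝓘(ℝ, E) 𝓘(ℝ, ℝ) ∞ (fun x => l (localRep η x₀ (chartAt E x₀ x))) x₀ := by
  have h1 : ContDiffAt ℝ ∞ (fun y => LinearMap.toContinuousLinearMap l (localRep η x₀ y))
      (chartAt E x₀ x₀) :=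
    (LinearMap.toContinuousLinearMap l).contDiff.contDiffAt.comp _
      ((contMDiffAt_form_iff η x₀).1 (η.contMDiff x₀))
  have h2 : ContMDiffAt 𝓘(ℝ, E) 𝓘(ℝ, E) ∞ (chartAt E x₀) x₀ :=
    contMDiffAt_of_mem_maximalAtlas (IsManifold.chart_mem_maximalAtlas x₀) (mem_chart_source E x₀)
  exact h1.contMDiffAt.comp x₀ h2

theorem exists_form_eq {k : ℕ} (x₀ : M) (α : AltTangent E k x₀) :
    ∃ η : DiffForm E M k, η x₀ = α := by
  obtain ⟨c, rfl⟩ := (coordEquiv x₀ (mem_chart_source E x₀)).symm.surjective α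
  obtain ⟨η, hη⟩ := exists_form_eq_constForm x₀ c
  exact ⟨η, hη.self_of_nhds⟩

end ConstantForms

/-! ### Smoothness of characteristic polynomials -/

section Charpoly

open Polynomial in
omit [FiniteDimensional ℝ E] [IsManifold 𝓘(ℝ, E) ∞ M] in
theorem contMDiffAt_coeff_prod {ι : Type*} (s : Finset ι) {p : ι → M → ℝ[X]} {x₀ : M}
    (h : ∀ a ∈ s, ∀ i, ContMDiffAt 𝓘(ℝ, E) 𝓘(ℝ, ℝ) ∞ (fun x => (p a x).coeff i) x₀) (i : ℕ) :
    ContMDiffAt 𝓘(ℝ, E) 𝓘(ℝ, ℝ) ∞ (fun x => (∏ a ∈ s, p a x).coeff i) x₀ := by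
  classical
  induction s using Finset.induction_on generalizing i with
  | empty => simpa using contMDiffAt_const
  | insert a s ha ih =>
    simp only [Finset.prod_insert ha, Polynomial.coeff_mul]
    refine ContMDiffAt.sum fun q _ => ?_
    exact (h a (Finset.mem_insert_self _ _) q.1).mul
      (ih (fun b hb => h b (Finset.mem_insert_of_mem hb)) q.2)

omit [FiniteDimensional ℝ E] [IsManifold 𝓘(ℝ, E) ∞ M] in
theorem contMDiffAt_coeff_charpoly {ι : Type*} [Fintype ι] [DecidableEq ι]
    {A : M → Matrix ι ι ℝ} {x₀ : M}
    (h : ∀ a b, ContMDiffAt 𝓘(ℝ, E) 𝓘(ℝ, ℝ) ∞ (fun x => A x a b) x₀) (i : ℕ) :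
    ContMDiffAt 𝓘(ℝ, E) 𝓘(ℝ, ℝ) ∞ (fun x => (A x).charpoly.coeff i) x₀ := by
  simp only [Matrix.charpoly, Matrix.det_apply, Polynomial.finsetSum_coeff, Units.smul_def,
    Polynomial.coeff_smul]
  refine ContMDiffAt.sum fun σ _ => ?_
  simp only [zsmul_eq_mul]
  refine contMDiffAt_const.mul (contMDiffAt_coeff_prod _ (fun a _ j => ?_) i)
  by_cases e : σ a = a
  · simp only [e, Matrix.charmatrix_apply_eq, Polynomial.coeff_sub, Polynomial.coeff_C]
    refine contMDiffAt_const.sub ?_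
    split_ifs
    · exact h _ _
    · exact contMDiffAt_const
  · simp only [Matrix.charmatrix_apply_ne _ _ _ e, Polynomial.coeff_neg, Polynomial.coeff_C]
    refine ContMDiffAt.neg ?_
    split_ifs
    · exact h _ _
    · exact contMDiffAt_const

/-- The coefficients of the characteristic polynomial of a field of endomorphisms that maps smooth
forms to smooth forms are smooth. -/
theorem contMDiff_coeff_charpoly_alternating [T2Space M] {k : ℕ}
    (A : ∀ x : M, Module.End ℝ (AltTangent E k x))
    (hA : ∀ η : DiffForm E M k, ∃ ζ : DiffForm E M k, ∀ x, ζ x = A x (η x)) (i : ℕ) :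
    ContMDiff 𝓘(ℝ, E) 𝓘(ℝ, ℝ) ∞ fun x => (LinearMap.charpoly (A x)).coeff i := by
  intro x₀
  set b := Module.finBasis ℝ (E [⋀^Fin k]→L[ℝ] ℝ)
  -- The images of a local frame by global forms are smooth, and their chart coordinates are the
  -- matrix entries of `A` near `x₀`.
  choose η hη using fun j => exists_form_eq_constForm (M := M) x₀ (b j)
  choose ζ hζ using fun j => hA (η j)
  have h1 : ∀ᶠ x in 𝓝 x₀, LinearMap.charpoly (A x) =
      Matrix.charpoly (Matrix.of fun a j => b.coord a (localRep (ζ j) x₀ (chartAt E x₀ x))) := by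
    filter_upwards [Filter.eventually_all.2 hη,
      (chartAt E x₀).open_source.mem_nhds (mem_chart_source E x₀)] with x hx hxs
    rw [← LinearEquiv.charpoly_conj (coordEquiv x₀ hxs), ← LinearMap.charpoly_toMatrix _ b]
    congr 1
    ext a j
    rw [LinearMap.toMatrix_apply, Matrix.of_apply, Module.Basis.coord_apply]
    congr 2
    have h2 : (coordEquiv x₀ hxs).symm (b j) = η j x := (hx j).symm
    rw [LinearEquiv.conj_apply, LinearMap.comp_apply, LinearMap.comp_apply,
      LinearEquiv.coe_coe, LinearEquiv.coe_coe, h2, ← hζ]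
    change _ = ContinuousAlternatingMap.compContinuousLinearMap
      (ζ j ((chartAt E x₀).symm (chartAt E x₀ x))) _
    rw [(chartAt E x₀).left_inv hxs]
    rfl
  refine (contMDiffAt_coeff_charpoly
    (fun a j => contMDiffAt_coord (ζ j) x₀ (b.coord a)) i).congr_of_eventuallyEq ?_
  filter_upwards [h1] with x hx
  rw [hx]
  rfl

end Charpoly

end

/-! ### Smooth inversion of the base box by Cayley–Hamilton -/

section

open Polynomial in
/-- By the Cayley--Hamilton theorem, the operator `A` can be inverted on the range of a power of `A`
by a polynomial in `A` whose coefficients are rational in those of the characteristic polynomial. -/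
theorem pow_eq_pow_succ_sum {V : Type*} [AddCommGroup V] [Module ℝ V] [FiniteDimensional ℝ V]
    (A : Module.End ℝ V) {m : ℕ} (hm : A.charpoly.natTrailingDegree = m) {N : ℕ}
    (hN : Module.finrank ℝ V = N) (v : V) :
    (A ^ N) v = (A ^ (N + 1)) (∑ i ∈ Finset.range (N + 1),
      (-(A.charpoly.coeff (m + i + 1) / A.charpoly.coeff m)) • (A ^ i) v) := by
  have hp : A.charpoly ≠ 0 := A.charpoly_monic.ne_zero
  have h0 : A.charpoly.coeff m ≠ 0 := by
    rwa [← hm, Ne, coeff_natTrailingDegree_eq_zero]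
  have hdeg : A.charpoly.natDegree = N := by rw [LinearMap.charpoly_natDegree, hN]
  have hmN : m ≤ N := by rw [← hm, ← hdeg]; exact natTrailingDegree_le_natDegree _
  -- The characteristic polynomial is `X ^ m * q` with `q(0) ≠ 0`. Writing `q = X r + q(0)`, one
  -- gets `A ^ m = -q(0)⁻¹ A ^ (m + 1) r(A)`.
  obtain ⟨q, hq⟩ : X ^ m ∣ A.charpoly :=
    X_pow_dvd_iff.2 fun d hd => coeff_eq_zero_of_lt_natTrailingDegree (hm ▸ hd)
  have hc : ∀ i, q.coeff i = A.charpoly.coeff (m + i) := fun i => by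
    rw [hq, add_comm, coeff_X_pow_mul]
  have hqd : q.divX.natDegree < N + 1 := by
    refine Nat.lt_succ_of_le (natDegree_divX_le.trans ?_)
    rw [← hdeg, hq, (monic_X_pow m).natDegree_mul', natDegree_X_pow]
    · exact Nat.le_add_left _ _
    · rintro rfl
      rw [mul_zero] at hq
      exact hp hq
  have h1 : aeval A (X ^ m * (q.divX * X + C (q.coeff 0))) = 0 := by
    rw [divX_mul_X_add, ← hq, A.aeval_self_charpoly]
  rw [map_mul, map_add, map_mul, aeval_X, aeval_C, map_pow, aeval_X,
    aeval_eq_sum_range' hqd] at h1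
  have h2 : A ^ m * A * (∑ i ∈ Finset.range (N + 1), q.divX.coeff i • A ^ i) =
      -(A.charpoly.coeff m • A ^ m) := by
    have h3 : (∑ i ∈ Finset.range (N + 1), q.divX.coeff i • A ^ i) * A =
        A * ∑ i ∈ Finset.range (N + 1), q.divX.coeff i • A ^ i := by
      rw [Finset.sum_mul, Finset.mul_sum]
      refine Finset.sum_congr rfl fun i _ => ?_
      rw [smul_mul_assoc, mul_smul_comm, ← pow_succ, ← pow_succ']
    rw [mul_add, h3, ← mul_assoc] at h1
    rw [eq_neg_of_add_eq_zero_left h1, hc, add_zero, Algebra.algebraMap_eq_smul_one,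
      mul_smul_comm, mul_one]
  have h4 : (A ^ (m + 1)) (∑ i ∈ Finset.range (N + 1),
      (-(A.charpoly.coeff (m + i + 1) / A.charpoly.coeff m)) • (A ^ i) v) = (A ^ m) v := by
    have h5 : (A ^ m * A) ((∑ i ∈ Finset.range (N + 1), q.divX.coeff i • A ^ i) v) =
        -(A.charpoly.coeff m • (A ^ m) v) := LinearMap.congr_fun h2 v
    have h6 : (A ^ m) v = (A ^ m * A)
        (-((A.charpoly.coeff m)⁻¹ • (∑ i ∈ Finset.range (N + 1), q.divX.coeff i • A ^ i) v)) := by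
      rw [map_neg, map_smul, h5, smul_neg, neg_neg, smul_smul, inv_mul_cancel₀ h0, one_smul]
    rw [h6, ← pow_succ]
    congr 1
    rw [LinearMap.sum_apply, Finset.smul_sum, ← Finset.sum_neg_distrib]
    refine Finset.sum_congr rfl fun i _ => ?_
    rw [LinearMap.smul_apply, smul_smul, coeff_divX, hc, neg_smul, div_eq_inv_mul, add_assoc]
  -- The exponent `m` varies with the operator, so it is replaced by `N ≥ m`, which depends on the
  -- dimension only.
  have h6 : A ^ (N + 1) = A ^ (N - m) * A ^ (m + 1) := by
    rw [← pow_add]; congr 1; omega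
  rw [h6, Module.End.mul_apply, h4, ← Module.End.mul_apply, ← pow_add]
  congr 2
  omega

variable {E : Type*} [NormedAddCommGroup E] [NormedSpace ℝ E] [FiniteDimensional ℝ E]
  {M : Type*} [TopologicalSpace M] [ChartedSpace E M] [IsManifold 𝓘(ℝ, E) ∞ M]

/-- The filtration of `Ω^•(M)` by weight. -/
def FilteredManifold.formFiltration (𝓗 : FilteredManifold E M) (w : ℕ) :
    Submodule ℝ (AllForms E M) where
  carrier := {α | ∀ k, 𝓗.FormWeightGE w (α k)}
  add_mem' {α β} hα hβ := fun k x j v hv hj => by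
    change α k x v + β k x v = 0
    exact (congrArg₂ (· + ·) (hα k x j v hv hj) (hβ k x j v hv hj)).trans (add_zero _)
  zero_mem' := fun _ _ _ _ _ _ => rfl
  smul_mem' c α hα := fun k x j v hv hj => by
    change c * α k x v = 0
    exact (congrArg (c * ·) (hα k x j v hv hj)).trans (mul_zero c)

namespace FilteredManifold

variable (𝓗 : FilteredManifold E M)

omit [FiniteDimensional ℝ E] in
theorem formFiltration_antitone : Antitone 𝓗.formFiltration :=
  fun _ _ h _ hα k x => (hα k x).mono h

omit [FiniteDimensional ℝ E] in
theorem formFiltration_zero : 𝓗.formFiltration 0 = ⊤ :=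
  eq_top_iff.2 fun _ _ _ _ _ _ _ hj => absurd hj (Nat.not_lt_zero _)

theorem formFiltration_eq_bot :
    𝓗.formFiltration (Module.finrank ℝ E * 𝓗.depth + 1) = ⊥ := by
  refine eq_bot_iff.2 fun α hα => ?_
  refine funext fun k => ContMDiffSection.ext fun x => ?_
  refine ContinuousAlternatingMap.toAlternatingMap_injective ?_
  -- Above the dimension there are no nonzero forms at all, so the bound `k * depth` on weights is
  -- needed only for `k ≤ dim E`.
  by_cases hk : k ≤ Module.finrank ℝ E
  · exact eq_zero_of_hasWeightGE (𝓗.isFiltration x)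
      (Nat.lt_succ_of_le (Nat.mul_le_mul_right _ hk)) (hα k x)
  · ext v
    refine AlternatingMap.map_linearDependent _ v fun hv => hk ?_
    have h : Fintype.card (Fin k) ≤ Module.finrank ℝ E :=
      hv.fintype_card_le_finrank (M := TangentSpace 𝓘(ℝ, E) x)
    rwa [Fintype.card_fin] at h

end FilteredManifold

variable [Bundle.RiemannianBundle (fun x : M => TangentSpace 𝓘(ℝ, E) x)]

/-! ### The base box as a smooth field of endomorphisms -/

namespace BasePair

variable {𝓗 : FilteredManifold E M} (B : BasePair 𝓗)

/-- The base box on the `k`-forms at `x`. -/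
def boxFib (x : M) : (k : ℕ) → Module.End ℝ (AltTangent E k x)
  | 0 => (B.deltaOp 0).fib x ∘ₗ (B.dOp 0).fib x
  | k + 1 => (B.dOp k).fib x ∘ₗ (B.deltaOp k).fib x +
      (B.deltaOp (k + 1)).fib x ∘ₗ (B.dOp (k + 1)).fib x

theorem box0_apply_apply (α : AllForms E M) (k : ℕ) (x : M) :
    B.box0 α k x = B.boxFib x k (α k x) := by
  cases k with
  | zero => exact zero_add _
  | succ k => rfl

theorem box0_pow_apply_apply (α : AllForms E M) (k : ℕ) (x : M) (n : ℕ) :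
    (B.box0 ^ n) α k x = (B.boxFib x k ^ n) (α k x) := by
  induction n with
  | zero => rfl
  | succ n ih =>
    rw [pow_succ', pow_succ', Module.End.mul_apply, Module.End.mul_apply, box0_apply_apply, ih]

theorem box0_eq_zero_of_pow {n : ℕ} {α : AllForms E M} (h : (B.box0 ^ n) α = 0) :
    B.box0 α = 0 := by
  induction n generalizing α with
  | zero => rw [show α = 0 from h, map_zero]
  | succ n ih =>
    rw [pow_succ, Module.End.mul_apply] at h
    exact B.box0_eq_zero_of_sq (ih h)

variable [T2Space M]

include B in
-- The identity is inherited from `d₀² = 0` by passing to graded maps, without using the Jacobi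
-- identity. Every covector at `x` extends to a global form, which makes `d₀² = 0` available in the
-- fibre.
theorem oscDiff_oscDiff (x : M) (k : ℕ) : 𝓗.oscDiff x (k + 1) ∘ₗ 𝓗.oscDiff x k = 0 := by
  refine FilteredManifold.IsGr.eq_zero (k := k) (l := k + 2) ?_
  have h : (B.dOp (k + 1)).fib x ∘ₗ (B.dOp k).fib x = 0 := by
    ext1 α
    obtain ⟨η, rfl⟩ := exists_form_eq x α
    exact congrArg (fun ζ : DiffForm E M (k + 2) => ζ x) (B.dOp_sq k η)
  rw [← h]
  exact (B.gr_dOp (k + 1) x).comp (B.gr_dOp k x)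

/-- The graded map of the base box is the Laplacian of the osculating differential. -/
theorem exists_isGr_boxFib (x : M) (k : ℕ) : ∃ T, 𝓗.IsGr x (B.boxFib x k) T ∧
    (∀ β, T (T β) = 0 → T β = 0) ∧
    Module.finrank ℝ (LinearMap.ker T) +
      (k.casesOn 0 fun k => Module.finrank ℝ (LinearMap.range (𝓗.oscDiff x k))) +
      Module.finrank ℝ (LinearMap.range (𝓗.oscDiff x k)) =
      Module.finrank ℝ (AltTangent E k x) := by
  rw [(𝓗.symbolEquiv k x).finrank_eq]
  have hprod := fun k => isScalarProduct_grAltForm (𝓗.fil x) 𝓗.depth k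
  cases k with
  | zero =>
    obtain ⟨T, hT, hT'⟩ := B.gr_deltaOp 0 x
    -- In degree `0` nothing comes in, and the zero map serves as incoming differential.
    have h : IsHodgePair (grAltForm (𝓗.fil x) 𝓗.depth 0) (grAltForm (𝓗.fil x) 𝓗.depth 0)
        (grAltForm (𝓗.fil x) 𝓗.depth 1) 0 (𝓗.oscDiff x 0) 0 T :=
      ⟨hprod 0, hprod 0, hprod 1, fun _ _ => by simp, hT⟩
    refine ⟨T ∘ₗ 𝓗.oscDiff x 0, hT'.comp (B.gr_dOp 0 x), fun β hβ => ?_, ?_⟩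
    · have h1 := h.laplacian_sq (v := β)
      rw [LinearMap.zero_comp, zero_add] at h1
      exact h1 hβ
    · have h1 := h.finrank_ker_laplacian fun _ => map_zero _
      rw [LinearMap.zero_comp, zero_add, LinearMap.range_zero, finrank_bot] at h1
      exact h1
  | succ k =>
    obtain ⟨S, hS, hS'⟩ := B.gr_deltaOp k x
    obtain ⟨T, hT, hT'⟩ := B.gr_deltaOp (k + 1) x
    have h : IsHodgePair (grAltForm (𝓗.fil x) 𝓗.depth k) (grAltForm (𝓗.fil x) 𝓗.depth (k + 1))
        (grAltForm (𝓗.fil x) 𝓗.depth (k + 2)) (𝓗.oscDiff x k) (𝓗.oscDiff x (k + 1)) S T :=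
      ⟨hprod _, hprod _, hprod _, hS, hT⟩
    refine ⟨𝓗.oscDiff x k ∘ₗ S + T ∘ₗ 𝓗.oscDiff x (k + 1),
      ((B.gr_dOp k x).comp hS').add (hT'.comp (B.gr_dOp (k + 1) x)), fun β => h.laplacian_sq,
      h.finrank_ker_laplacian fun β => LinearMap.congr_fun (B.oscDiff_oscDiff x k) β⟩

/-- The multiplicity of the root `0` is the dimension of the kernel of the osculating Laplacian,
which rank counting expresses through two locally constant ranks. -/
theorem isLocallyConstant_natTrailingDegree (hreg : ∀ k, IsLocallyConstant fun x : M =>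
      Module.finrank ℝ (LinearMap.range (𝓗.oscDiff x k))) (k : ℕ) :
    IsLocallyConstant fun x : M => (LinearMap.charpoly (B.boxFib x k)).natTrailingDegree := by
  rw [IsLocallyConstant.iff_eventually_eq]
  intro x₀
  have h : ∀ x, (LinearMap.charpoly (B.boxFib x k)).natTrailingDegree +
      (k.casesOn 0 fun k => Module.finrank ℝ (LinearMap.range (𝓗.oscDiff x k))) +
      Module.finrank ℝ (LinearMap.range (𝓗.oscDiff x k)) =
      Module.finrank ℝ (E [⋀^Fin k]→L[ℝ] ℝ) := fun x => by
    obtain ⟨T, h1, h2, h3⟩ := B.exists_isGr_boxFib x k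
    rw [h1.natTrailingDegree_charpoly h2]
    exact h3
  cases k with
  | zero =>
    filter_upwards [(IsLocallyConstant.iff_eventually_eq _).1 (hreg 0) x₀] with x hx
    have h1 : _ + 0 + _ = _ := h x
    have h2 : _ + 0 + _ = _ := h x₀
    omega
  | succ k =>
    filter_upwards [(IsLocallyConstant.iff_eventually_eq _).1 (hreg k) x₀,
      (IsLocallyConstant.iff_eventually_eq _).1 (hreg (k + 1)) x₀] with x hx hx'
    have h1 : _ + Module.finrank ℝ (LinearMap.range (𝓗.oscDiff x k)) + _ = _ := h x
    have h2 : _ + Module.finrank ℝ (LinearMap.range (𝓗.oscDiff x₀ k)) + _ = _ := h x₀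
    omega

theorem hasWeightGE_boxFib {x : M} {k w : ℕ} {α : AltTangent E k x}
    (hα : HasWeightGE (𝓗.fil x) w fun v => α v) :
    HasWeightGE (𝓗.fil x) w fun v => B.boxFib x k α v := by
  obtain ⟨T, hT, -⟩ := B.exists_isGr_boxFib x k
  exact hT.hasWeightGE hα

/-- The Cayley–Hamilton solution is applied in every fibre. It is a combination of the forms `□₀ ^ i
α` with smooth coefficients, so it is smooth, and it keeps the weight of `α`. -/
theorem exists_box0_box0 (hreg : ∀ k, IsLocallyConstant fun x : M =>
      Module.finrank ℝ (LinearMap.range (𝓗.oscDiff x k))) (w : ℕ) (α : AllForms E M)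
    (hα : α ∈ 𝓗.formFiltration w) :
    ∃ u ∈ 𝓗.formFiltration w, B.box0 α = B.box0 (B.box0 u) := by
  have hfib : ∀ k (η : DiffForm E M k), ∃ ζ : DiffForm E M k, ∀ x, ζ x = B.boxFib x k (η x) :=
    fun k η => ⟨B.box0 (Pi.single (M := fun k => DiffForm E M k) k η) k, fun x =>
      (B.box0_apply_apply _ k x).trans (congrArg (fun ζ : DiffForm E M k => B.boxFib x k (ζ x))
        (Pi.single_eq_same (M := fun k => DiffForm E M k) k η))⟩
  set m : ℕ → M → ℕ := fun k x => (LinearMap.charpoly (B.boxFib x k)).natTrailingDegree with hm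
  set c : ℕ → ℕ → M → ℝ := fun k i x =>
    -((LinearMap.charpoly (B.boxFib x k)).coeff (m k x + i + 1) /
      (LinearMap.charpoly (B.boxFib x k)).coeff (m k x)) with hc
  have hcs : ∀ k i, ContMDiff 𝓘(ℝ, E) 𝓘(ℝ, ℝ) ∞ (c k i) := by
    intro k i x₀
    -- Near `x₀` the order `m k x` is constant, so each coefficient is a quotient of two fixed
    -- smooth coefficients. The denominator is the lowest nonzero one and does not vanish at `x₀`.
    have h1 := contMDiff_coeff_charpoly_alternating (fun x => B.boxFib x k) (hfib k)
    have h2 := (IsLocallyConstant.iff_eventually_eq _).1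
      (B.isLocallyConstant_natTrailingDegree hreg k) x₀
    have h3 : ContMDiffAt 𝓘(ℝ, E) 𝓘(ℝ, ℝ) ∞ (fun x =>
        -((LinearMap.charpoly (B.boxFib x k)).coeff (m k x₀ + i + 1) /
          (LinearMap.charpoly (B.boxFib x k)).coeff (m k x₀))) x₀ := by
      refine ((h1 _ x₀).div₀ (h1 _ x₀) ?_).neg
      rw [hm, Ne, Polynomial.coeff_natTrailingDegree_eq_zero]
      exact (LinearMap.charpoly_monic _).ne_zero
    refine h3.congr_of_eventuallyEq ?_
    filter_upwards [h2] with x hx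
    simp only [hc, hm] at hx ⊢
    rw [hx]
  set N : ℕ → ℕ := fun k => Module.finrank ℝ (E [⋀^Fin k]→L[ℝ] ℝ)
  set u : AllForms E M := fun k => ⟨fun x => ∑ i ∈ Finset.range (N k + 1),
    (c k i • fun x => (B.box0 ^ i) α k x) x, ContMDiff.sum_section fun i _ =>
      (hcs k i).smul_section ((B.box0 ^ i) α k).contMDiff⟩ with hu
  have hux : ∀ k x, u k x = ∑ i ∈ Finset.range (N k + 1),
      c k i x • (B.boxFib x k ^ i) (α k x) := fun k x =>
    (show u k x = ∑ i ∈ Finset.range (N k + 1), c k i x • (B.box0 ^ i) α k x from rfl).trans <|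
    Finset.sum_congr rfl fun i _ => congrArg (c k i x • ·) (B.box0_pow_apply_apply α k x i)
  refine ⟨u, fun k x => ?_, ?_⟩
  · have hA : ∀ i, HasWeightGE (𝓗.fil x) w fun v => (B.boxFib x k ^ i) (α k x) v := by
      intro i
      induction i with
      | zero => exact hα k x
      | succ i ih =>
        rw [pow_succ']
        exact B.hasWeightGE_boxFib ih
    intro j v hv hj
    change u k x v = 0
    rw [hux]
    refine (ContinuousAlternatingMap.sum_apply _ _).trans (Finset.sum_eq_zero fun i _ => ?_)
    exact (congrArg (c k i x * ·) (hA i j v hv hj)).trans (mul_zero _)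
  · rw [← sub_eq_zero, ← map_sub]
    -- The exponent `N k` depends on the degree, so one degree is isolated at a time. Disjointness
    -- then reduces `□₀ ^ N k` to `□₀`.
    have h1 : ∀ k, B.box0 (degreeProj k (α - B.box0 u)) = 0 := by
      intro k
      refine B.box0_eq_zero_of_pow (n := N k) ?_
      refine funext fun l => ContMDiffSection.ext fun x => ?_
      rw [box0_pow_apply_apply]
      by_cases hl : l = k
      · subst hl
        rw [degreeProj_same]
        change (B.boxFib x l ^ N l) (α l x - B.box0 u l x) = 0
        rw [map_sub, sub_eq_zero, box0_apply_apply, ← Module.End.mul_apply, ← pow_succ, hux]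
        exact pow_eq_pow_succ_sum _ rfl rfl _
      · rw [degreeProj_ne hl]
        exact map_zero _
    refine funext fun k => ?_
    have h2 := congrArg (fun β : AllForms E M => β k) (h1 k)
    rw [← Module.End.mul_apply, ← degreeProj_box0, Module.End.mul_apply, degreeProj_same] at h2
    exact h2

end BasePair

end

section

/-! ### Classes in the graded space and induced brackets -/

section LinearAlgebra

variable {V : Type*} [AddCommGroup V] [Module ℝ V] {F : ℕ → Submodule ℝ V} {s : ℕ}

theorem grClass_eq_of_sub_mem {j : ℕ} {v v' : V} (hv : v ∈ F j) (hv' : v' ∈ F j)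
    (h : v - v' ∈ F (j - 1)) : grClass F s j v hv = grClass F s j v' hv' := by
  funext i
  unfold grClass
  split_ifs with e
  · subst e
    exact (Submodule.Quotient.eq _).2 h
  · rfl

theorem grClass_congr {j j' : ℕ} (e : j = j') {v v' : V} (hv : v ∈ F j) (hv' : v' ∈ F j')
    (h : v = v') : grClass F s j v hv = grClass F s j' v' hv' := by
  subst e h
  rfl

/-- The class in the graded space as a linear map. -/
def grClassLin (F : ℕ → Submodule ℝ V) (s j : ℕ) : ↥(F j) →ₗ[ℝ] Gr F s where
  toFun v := grClass F s j v v.2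
  map_add' u v := by
    funext i
    simp only [grClass, Pi.add_apply]
    split_ifs with e
    · subst e; rfl
    · exact (add_zero _).symm
  map_smul' c v := by
    funext i
    simp only [grClass, Pi.smul_apply]
    split_ifs with e
    · subst e; rfl
    · exact (smul_zero c).symm

theorem grClass_zero (j : ℕ) : grClass F s j 0 (zero_mem _) = 0 := (grClassLin F s j).map_zero

theorem grClass_neg {j : ℕ} {v : V} (hv : v ∈ F j) :
    grClass F s j (-v) (neg_mem hv) = - grClass F s j v hv :=
  (grClassLin F s j).map_neg ⟨v, hv⟩

theorem eq_sum_grClass (u : Gr F s) :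
    u = ∑ i : Fin s, grClass F s (i + 1) (grSplit F i (u i)) (grSplit F i (u i)).2 := by
  simp only [grClass_grSplit]
  exact (Finset.univ_sum_single u).symm

/-- A bilinear map that respects a filtration induces a bilinear map on the graded space. -/
theorem exists_grBracket (hF : IsFiltration F s) (B : V →ₗ[ℝ] V →ₗ[ℝ] V)
    (hB : ∀ i j, ∀ u ∈ F i, ∀ v ∈ F j, B u v ∈ F (i + j)) :
    ∃ b : Gr F s →ₗ[ℝ] Gr F s →ₗ[ℝ] Gr F s, ∀ i j u v (hu : u ∈ F i) (hv : v ∈ F j),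
      b (grClass F s i u hu) (grClass F s j v hv) =
        grClass F s (i + j) (B u v) (hB i j u hu v hv) := by
  set C : ∀ i l : ℕ, ↥(F i) →ₗ[ℝ] ↥(F l) →ₗ[ℝ] ↥(F (i + l)) := fun i l =>
    LinearMap.mk₂ ℝ (fun u v => ⟨B u v, hB _ _ _ u.2 _ v.2⟩)
      (fun u u' v => Subtype.ext (by simp)) (fun c u v => Subtype.ext (by simp))
      (fun u v v' => Subtype.ext (by simp)) (fun c u v => Subtype.ext (by simp)) with hC
  set b : Gr F s →ₗ[ℝ] Gr F s →ₗ[ℝ] Gr F s := ∑ i : Fin s, ∑ l : Fin s,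
    ((C (i + 1) (l + 1)).compl₁₂ (grSplit F i ∘ₗ LinearMap.proj i)
      (grSplit F l ∘ₗ LinearMap.proj l)).compr₂ (grClassLin F s (i + 1 + (l + 1))) with hb
  have hbs : ∀ (i l : Fin s) q q', b (Pi.single i q) (Pi.single l q') =
      grClassLin F s (i + 1 + (l + 1)) (C (i + 1) (l + 1) (grSplit F i q) (grSplit F l q')) := by
    intro i l q q'
    simp only [hb, LinearMap.sum_apply]
    rw [Finset.sum_eq_single i, Finset.sum_eq_single l]
    · simp
    · intro l' _ hl
      simp [Pi.single_eq_of_ne hl]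
    · simp
    · intro i' _ hi
      simp [Pi.single_eq_of_ne hi]
    · simp
  refine ⟨b, fun i j u v hu hv => ?_⟩
  -- If an index is outside `1, …, s`, then one class is zero. The class of the bracket is zero too,
  -- either because a vector of `F 0` is `0` or because the total index exceeds `s`.
  by_cases h : (i = 0 ∨ s < i) ∨ (j = 0 ∨ s < j)
  · have h0 : b (grClass F s i u hu) (grClass F s j v hv) = 0 := by
      rcases h with h | h <;> simp [grClass_eq_zero h]
    rw [h0]
    have hbot : ∀ w ∈ F 0, w = 0 := fun w hw => by
      rw [hF.zero] at hw
      exact hw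
    rcases h with (rfl | h) | (rfl | h)
    · rw [← grClass_zero (F := F) (s := s) (0 + j)]
      exact grClass_congr rfl _ _ (by rw [hbot u hu]; simp)
    · rw [grClass_eq_zero (by omega)]
    · rw [← grClass_zero (F := F) (s := s) (i + 0)]
      exact grClass_congr rfl _ _ (by rw [hbot v hv]; simp)
    · rw [grClass_eq_zero (by omega)]
  · push Not at h
    obtain ⟨i, rfl⟩ : ∃ p : Fin s, i = p + 1 := ⟨⟨i - 1, by omega⟩, by simp; omega⟩
    obtain ⟨j, rfl⟩ : ∃ p : Fin s, j = p + 1 := ⟨⟨j - 1, by omega⟩, by simp; omega⟩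
    rw [grClass_succ, grClass_succ, hbs]
    refine grClass_eq_of_sub_mem (Subtype.property _) _ ?_
    have h1 := grSplit_mk_sub F i ⟨u, hu⟩
    have h2 := grSplit_mk_sub F j ⟨v, hv⟩
    set u' := grSplit F i (Submodule.Quotient.mk ⟨u, hu⟩)
    set v' := grSplit F j (Submodule.Quotient.mk ⟨v, hv⟩)
    have h3 : B u' v' - B u v = -(B (u - u') v + B u' (v - v')) := by
      simp only [map_sub, LinearMap.sub_apply]
      abel
    change B u' v' - B u v ∈ _
    rw [h3]
    refine neg_mem (add_mem ?_ ?_)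
    · exact hF.mono (by omega) (hB _ _ _ h1 _ hv)
    · exact hF.mono (by omega) (hB _ _ _ u'.2 _ h2)

end LinearAlgebra

variable {E : Type*} [NormedAddCommGroup E] [NormedSpace ℝ E] [FiniteDimensional ℝ E]
  {M : Type*} [TopologicalSpace M] [ChartedSpace E M] [IsManifold 𝓘(ℝ, E) ∞ M]

/-! ### Existence of the osculating bracket -/

namespace FilteredManifold

variable (𝓗 : FilteredManifold E M)

/-- `X` is a smooth section of `H i`. -/
structure IsSection (i : ℕ) (X : ∀ x : M, TangentSpace 𝓘(ℝ, E) x) : Prop where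
  smooth : IsSmoothField X
  mem : ∀ x, X x ∈ 𝓗.H i x

variable {𝓗}

/-- A global version of the adapted frames. -/
theorem exists_frame [T2Space M] (𝓗 : FilteredManifold E M) (x₀ : M) :
    ∃ (n : ℕ) (b : Module.Basis (Fin n) ℝ (TangentSpace 𝓘(ℝ, E) x₀))
      (X : Fin n → ∀ x : M, TangentSpace 𝓘(ℝ, E) x) (υ : Fin n → ℕ),
      (∀ a, 𝓗.IsSection (υ a) (X a)) ∧ (∀ a, X a x₀ = b a) ∧
      ∀ᶠ x in 𝓝 x₀, LinearIndependent ℝ (X · x) ∧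
        ∀ i, 𝓗.H i x = Submodule.span ℝ ((X · x) '' {a | υ a ≤ i}) := by
  obtain ⟨U, n, X, υ, hU, hx₀, hX, hH⟩ := 𝓗.smooth x₀
  obtain ⟨f, hf, hf1, hfU⟩ := exists_smooth_bump (E := E) (hU.mem_nhds hx₀)
  have hspan : ∀ x ∈ U, ∀ i, 𝓗.H i x = Submodule.span ℝ ((X · x) '' {a | υ a ≤ i}) := by
    intro x hx i
    rw [hH x hx i]
    rfl
  refine ⟨n, hX.toBasisAt hx₀, fun a => f • X a, υ, fun a => ⟨?_, fun x => ?_⟩, fun a => ?_, ?_⟩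
  · exact ContMDiffOn.smul_section_of_tsupport hf.contMDiffOn hU hfU (hX.contMDiffOn a)
  · by_cases hx : x ∈ U
    · refine Submodule.smul_mem _ _ ?_
      rw [hspan x hx]
      exact Submodule.subset_span ⟨a, le_refl (υ a), rfl⟩
    · have h0 : f x = 0 := by
        by_contra h
        exact hx (hfU (subset_tsupport f h))
      change f x • X a x ∈ _
      rw [h0, zero_smul]
      exact zero_mem _
  · change f x₀ • X a x₀ = _
    rw [hf1.self_of_nhds, one_smul, IsLocalFrameOn.toBasisAt_coe]
  · filter_upwards [hf1, hU.mem_nhds hx₀] with x hx hxU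
    have h1 : (fun a => (f • X a) x) = fun a => X a x := by
      funext a
      change f x • X a x = _
      rw [hx, one_smul]
    rw [h1]
    exact ⟨hX.linearIndependent hxU, hspan x hxU⟩

/-- Tangent vectors at `x₀` extend linearly to vector fields, and those in `H i` to sections of
`H i`. -/
theorem exists_extension [T2Space M] (𝓗 : FilteredManifold E M) (x₀ : M) :
    ∃ ext : TangentSpace 𝓘(ℝ, E) x₀ →ₗ[ℝ] ∀ x : M, TangentSpace 𝓘(ℝ, E) x,
      (∀ v, IsSmoothField (ext v)) ∧ (∀ v, ext v x₀ = v) ∧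
      ∀ i, ∀ v ∈ 𝓗.H i x₀, 𝓗.IsSection i (ext v) := by
  obtain ⟨n, b, X, υ, hX, hb, hspan⟩ := 𝓗.exists_frame x₀
  set ext : TangentSpace 𝓘(ℝ, E) x₀ →ₗ[ℝ] ∀ x : M, TangentSpace 𝓘(ℝ, E) x :=
    ∑ a, (b.coord a).smulRight (X a) with hext
  have hext' : ∀ v x, ext v x = ∑ a, b.repr v a • X a x := by
    intro v x
    simp [hext, LinearMap.sum_apply, Finset.sum_apply]
  have hsm : ∀ v, IsSmoothField (ext v) := by
    intro v
    have h1 : ContMDiff 𝓘(ℝ, E) 𝓘(ℝ, E).tangent ∞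
        (fun x => (⟨x, ∑ a, b.repr v a • X a x⟩ : TangentBundle 𝓘(ℝ, E) M)) :=
      ContMDiff.sum_section fun a _ => (hX a).smooth.const_smul_section
    simp only [IsSmoothField, hext']
    exact h1
  refine ⟨ext, hsm, fun v => ?_, fun i v hv => ⟨hsm v, fun x => ?_⟩⟩
  · rw [hext']
    simp only [hb]
    exact b.sum_repr v
  · rw [hext']
    refine Submodule.sum_mem _ fun a _ => ?_
    rw [hspan.self_of_nhds.2 i] at hv
    simp only [hb] at hv
    rw [Module.Basis.mem_span_image] at hv
    by_cases ha : υ a ≤ i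
    · exact Submodule.smul_mem _ _ (𝓗.mono x ha ((hX a).mem x))
    · have h0 : b.repr v a = 0 := by
        by_contra h
        exact ha (hv (Finsupp.mem_support_iff.2 h))
      rw [h0, zero_smul]
      exact zero_mem _

/-- Expand `X = ∑ c_a Z_a` in an adapted frame. In `[c Z, Y] = -(Y c) Z + c [Z, Y]` the second term
dies at `x₀`, where `c = 0`, and only frame fields of weight at most `i` occur near `x₀`. -/
theorem IsSection.mlieBracket_mem_of_eq_zero [T2Space M] {i : ℕ}
    {X : ∀ x : M, TangentSpace 𝓘(ℝ, E) x}
    (hX : 𝓗.IsSection i X) {x₀ : M} (h0 : X x₀ = 0) (Y : ∀ x : M, TangentSpace 𝓘(ℝ, E) x) :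
    VectorField.mlieBracket 𝓘(ℝ, E) X Y x₀ ∈ 𝓗.H i x₀ := by
  obtain ⟨n, b, Z, υ, hZ, hb, hspan⟩ := 𝓗.exists_frame x₀
  set e := trivializationAt E (TangentSpace 𝓘(ℝ, E) : M → Type _) x₀
  have hcoord : ∀ {W : ∀ x : M, TangentSpace 𝓘(ℝ, E) x}, IsSmoothField W →
      ContMDiffAt 𝓘(ℝ, E) 𝓘(ℝ, E) ∞ (fun x => e.continuousLinearMapAt ℝ x (W x)) x₀ := by
    intro W hW
    have h1 := (Bundle.contMDiffAt_section x₀).1 (hW x₀)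
    refine h1.congr_of_eventuallyEq ?_
    filter_upwards [(chartAt E x₀).open_source.mem_nhds (mem_chart_source E x₀)] with x hx
    rw [e.continuousLinearMapAt_apply ℝ, e.coe_linearMapAt_of_mem (R := ℝ) hx]
  -- In the chart, `Φ x` sends a coefficient vector to the corresponding combination of the frame at
  -- `x`. It is invertible at `x₀`, hence nearby, and smoothness of inversion makes the coefficients
  -- of `X` smooth.
  set Φ : M → (Fin n → ℝ) →L[ℝ] E := fun x =>
    ∑ a, (ContinuousLinearMap.proj (R := ℝ) (φ := fun _ : Fin n => ℝ) a).smulRight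
      (e.continuousLinearMapAt ℝ x (Z a x)) with hΦ
  have hΦ' : ∀ x c, Φ x c = e.continuousLinearMapAt ℝ x (∑ a, c a • Z a x) := by
    intro x c
    simp [hΦ]
  have hΦs : ContMDiffAt 𝓘(ℝ, E) 𝓘(ℝ, (Fin n → ℝ) →L[ℝ] E) ∞ Φ x₀ := by
    refine ContMDiffAt.sum fun a _ => ?_
    exact ((ContinuousLinearMap.smulRightL ℝ (Fin n → ℝ) E
      (ContinuousLinearMap.proj (R := ℝ) (φ := fun _ : Fin n => ℝ) a)).contDiff.contMDiff
      |>.contMDiffAt).comp x₀ (hcoord (hZ a).smooth)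
  have hx₀ : x₀ ∈ e.baseSet := mem_chart_source E x₀
  set Φ₀ : (Fin n → ℝ) ≃L[ℝ] E :=
    (b.equivFun.symm.trans (e.linearEquivAt ℝ x₀ hx₀)).toContinuousLinearEquiv
  have hΦ₀ : Φ x₀ = Φ₀ := by
    ext1 c
    rw [hΦ', e.continuousLinearMapAt_apply ℝ, e.coe_linearMapAt_of_mem (R := ℝ) hx₀]
    change _ = e.linearEquivAt ℝ x₀ hx₀ (b.equivFun.symm c)
    rw [b.equivFun_symm_apply]
    simp only [hb]
    rfl
  set c : M → Fin n → ℝ := fun x => (Φ x).inverse (e.continuousLinearMapAt ℝ x (X x)) with hc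
  have hcs : ContMDiffAt 𝓘(ℝ, E) 𝓘(ℝ, Fin n → ℝ) ∞ c x₀ := by
    refine ContMDiffAt.clm_apply ?_ (hcoord hX.smooth)
    have h1 : ContDiffAt ℝ ∞ ContinuousLinearMap.inverse (Φ x₀) := by
      rw [hΦ₀]
      exact contDiffAt_map_inverse Φ₀
    exact h1.contMDiffAt.comp x₀ hΦs
  have hca : ∀ a, ContMDiffAt 𝓘(ℝ, E) 𝓘(ℝ, ℝ) ∞ (fun x => c x a) x₀ := fun a =>
    ((ContinuousLinearMap.proj (R := ℝ) (φ := fun _ : Fin n => ℝ) a).contDiff.contMDiff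
      |>.contMDiffAt).comp x₀ hcs
  have hc0 : c x₀ = 0 := by
    simp [hc, h0]
  have hXc : ∀ᶠ x in 𝓝 x₀, X x = ∑ a, c x a • Z a x := by
    have h1 : ∀ᶠ x in 𝓝 x₀, Φ x ∈ Set.range
        (ContinuousLinearEquiv.toContinuousLinearMap : ((Fin n → ℝ) ≃L[ℝ] E) → _) :=
      hΦs.continuousAt.eventually_mem (hΦ₀ ▸ Φ₀.nhds)
    filter_upwards [h1, (chartAt E x₀).open_source.mem_nhds (mem_chart_source E x₀)] with x hx hxs
    have hinv : (Φ x).IsInvertible := hx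
    have h2 := congrArg (fun A : E →L[ℝ] E => A (e.continuousLinearMapAt ℝ x (X x)))
      hinv.self_comp_inverse
    simp only [ContinuousLinearMap.comp_apply, ContinuousLinearMap.id_apply] at h2
    have h3 : Φ x (c x) = _ := h2
    rw [hΦ', e.continuousLinearMapAt_apply ℝ, e.coe_linearMapAt_of_mem (R := ℝ) hxs] at h3
    exact ((e.linearEquivAt ℝ x hxs).injective h3).symm
  have hcv : ∀ a, ¬ υ a ≤ i → ∀ᶠ x in 𝓝 x₀, c x a = 0 := by
    intro a ha
    filter_upwards [hXc, hspan] with x hx ⟨hli, hH⟩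
    have h1 := hX.mem x
    rw [hH, Finsupp.mem_span_image_iff_linearCombination] at h1
    obtain ⟨l, hl, hl'⟩ := h1
    rw [hx, Finsupp.linearCombination_apply,
      Finsupp.sum_fintype l (fun a r => r • Z a x) fun a => zero_smul ℝ _] at hl'
    have h2 := Fintype.linearIndependent_iff.1 hli (fun a => l a - c x a) (by
      simp only [sub_smul, Finset.sum_sub_distrib]
      rw [hl', sub_self]) a
    rw [← sub_eq_zero.1 h2]
    by_contra h
    exact ha (hl (Finsupp.mem_support_iff.2 h))
  have hcZ : ∀ a, ContMDiffAt 𝓘(ℝ, E) 𝓘(ℝ, E).tangent ∞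
      (fun x => (⟨x, ((fun x => c x a) • Z a) x⟩ : TangentBundle 𝓘(ℝ, E) M)) x₀ := fun a =>
    (hca a).smul_section ((hZ a).smooth x₀)
  have hne : (∞ : WithTop ℕ∞) ≠ 0 := by simp
  have : CompleteSpace E := FiniteDimensional.complete ℝ E
  have key : ∀ S : Finset (Fin n), VectorField.mlieBracket 𝓘(ℝ, E)
      (∑ a ∈ S, (fun x => c x a) • Z a) Y x₀ ∈ 𝓗.H i x₀ := by
    intro S
    induction S using Finset.induction_on with
    | empty =>
      rw [Finset.sum_empty, VectorField.mlieBracket_zero_left]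
      exact zero_mem _
    | insert a S ha ih =>
      have h1 : ContMDiffAt 𝓘(ℝ, E) 𝓘(ℝ, E).tangent ∞
          (fun x => (⟨x, (∑ a ∈ S, (fun x => c x a) • Z a) x⟩ : TangentBundle 𝓘(ℝ, E) M)) x₀ := by
        simp only [Finset.sum_apply]
        exact ContMDiffAt.sum_section fun a _ => hcZ a
      rw [Finset.sum_insert ha, VectorField.mlieBracket_add_left ((hcZ a).mdifferentiableAt hne)
        (h1.mdifferentiableAt hne)]
      refine add_mem ?_ ih
      by_cases hai : υ a ≤ i
      · rw [VectorField.mlieBracket_smul_left ((hca a).mdifferentiableAt hne)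
          (((hZ a).smooth x₀).mdifferentiableAt hne), hc0, Pi.zero_apply, zero_smul, add_zero]
        exact Submodule.smul_mem _ _ (𝓗.mono x₀ hai ((hZ a).mem x₀))
      · rw [Filter.EventuallyEq.mlieBracket_vectorField_eq (V := 0) (W := Y),
          VectorField.mlieBracket_zero_left]
        · exact zero_mem _
        · filter_upwards [hcv a hai] with x hx
          change c x a • Z a x = 0
          rw [hx, zero_smul]
        · rfl
  have h1 := key Finset.univ
  rwa [Filter.EventuallyEq.mlieBracket_vectorField_eq (V := ∑ a, (fun x => c x a) • Z a) (V₁ := X)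
    (W := Y) (W₁ := Y)]
  · filter_upwards [hXc] with x hx
    rw [hx, Finset.sum_apply]
    rfl
  · rfl

omit [FiniteDimensional ℝ E] in
theorem mdifferentiableAt_of_isSmoothField {X : ∀ x : M, TangentSpace 𝓘(ℝ, E) x}
    (hX : IsSmoothField X) (x₀ : M) : MDifferentiableAt 𝓘(ℝ, E) 𝓘(ℝ, E).tangent
      (fun x => (⟨x, X x⟩ : TangentBundle 𝓘(ℝ, E) M)) x₀ :=
  (hX x₀).mdifferentiableAt (by simp)

omit [FiniteDimensional ℝ E] in
theorem IsSection.sub {i : ℕ} {X X' : ∀ x : M, TangentSpace 𝓘(ℝ, E) x} (hX : 𝓗.IsSection i X)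
    (hX' : 𝓗.IsSection i X') : 𝓗.IsSection i (X - X') :=
  ⟨ContMDiff.sub_section hX.smooth hX'.smooth, fun x => sub_mem (hX.mem x) (hX'.mem x)⟩

omit [FiniteDimensional ℝ E] in
theorem IsSection.eq_zero {X : ∀ x : M, TangentSpace 𝓘(ℝ, E) x} (hX : 𝓗.IsSection 0 X) : X = 0 := by
  funext x
  have h := hX.mem x
  rw [𝓗.zero] at h
  exact h

theorem mlieBracket_sub_left {X X' : ∀ x : M, TangentSpace 𝓘(ℝ, E) x} (hX : IsSmoothField X)
    (hX' : IsSmoothField X') (Y : ∀ x : M, TangentSpace 𝓘(ℝ, E) x) (x₀ : M) :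
    VectorField.mlieBracket 𝓘(ℝ, E) (X - X') Y x₀ =
      VectorField.mlieBracket 𝓘(ℝ, E) X Y x₀ - VectorField.mlieBracket 𝓘(ℝ, E) X' Y x₀ := by
  have : CompleteSpace E := FiniteDimensional.complete ℝ E
  rw [eq_sub_iff_add_eq, ← VectorField.mlieBracket_add_left
    (mdifferentiableAt_of_isSmoothField (ContMDiff.sub_section hX hX') x₀)
    (mdifferentiableAt_of_isSmoothField hX' x₀), sub_add_cancel]

/-- The class of the bracket of two sections depends only on the values of the sections. -/
theorem IsSection.mlieBracket_sub_mem [T2Space M] {i j : ℕ}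
    {X X' Y Y' : ∀ x : M, TangentSpace 𝓘(ℝ, E) x} (hX : 𝓗.IsSection i X) (hX' : 𝓗.IsSection i X')
    (hY : 𝓗.IsSection j Y) (hY' : 𝓗.IsSection j Y') {x₀ : M} (h : X x₀ = X' x₀)
    (h' : Y x₀ = Y' x₀) : VectorField.mlieBracket 𝓘(ℝ, E) X Y x₀ -
      VectorField.mlieBracket 𝓘(ℝ, E) X' Y' x₀ ∈ 𝓗.H (i + j - 1) x₀ := by
  have h1 : VectorField.mlieBracket 𝓘(ℝ, E) X Y x₀ - VectorField.mlieBracket 𝓘(ℝ, E) X' Y' x₀ =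
      VectorField.mlieBracket 𝓘(ℝ, E) (X - X') Y x₀ -
        VectorField.mlieBracket 𝓘(ℝ, E) (Y - Y') X' x₀ := by
    rw [mlieBracket_sub_left hX.smooth hX'.smooth, mlieBracket_sub_left hY.smooth hY'.smooth,
      VectorField.mlieBracket_swap_apply (V := Y), VectorField.mlieBracket_swap_apply (V := Y')]
    abel
  rw [h1]
  -- For `i = 0` the truncated index `i + j - 1` would be too small for the general bound. But
  -- sections of `H 0` vanish identically, and so do the brackets.
  rcases Nat.eq_zero_or_pos i with rfl | hi
  · rw [(hX.sub hX').eq_zero, hX'.eq_zero, VectorField.mlieBracket_zero_left,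
      VectorField.mlieBracket_zero_right]
    simp
  rcases Nat.eq_zero_or_pos j with rfl | hj
  · rw [(hY.sub hY').eq_zero, hY.eq_zero, VectorField.mlieBracket_zero_left,
      VectorField.mlieBracket_zero_right]
    simp
  refine sub_mem ?_ ?_
  · exact 𝓗.mono x₀ (by omega) ((hX.sub hX').mlieBracket_mem_of_eq_zero (sub_eq_zero.2 h) Y)
  · exact 𝓗.mono x₀ (by omega) ((hY.sub hY').mlieBracket_mem_of_eq_zero (sub_eq_zero.2 h') X')

variable (𝓗)

/-- Bracketing linear extensions of vectors gives a bilinear map on the tangent space that respects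
the filtration. Its graded map is independent of the extensions by `IsSection.mlieBracket_sub_mem`.
-/
theorem exists_isOscBracket [T2Space M] (x : M) : ∃ b, 𝓗.IsOscBracket x b := by
  have : CompleteSpace E := FiniteDimensional.complete ℝ E
  obtain ⟨ext, hs, hx, hi⟩ := 𝓗.exists_extension x
  have hd := fun v => mdifferentiableAt_of_isSmoothField (hs v) x
  set B : TangentSpace 𝓘(ℝ, E) x →ₗ[ℝ] TangentSpace 𝓘(ℝ, E) x →ₗ[ℝ] TangentSpace 𝓘(ℝ, E) x :=
    LinearMap.mk₂ ℝ (fun v v' => VectorField.mlieBracket 𝓘(ℝ, E) (ext v) (ext v') x)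
      (fun u v v' => by rw [map_add, VectorField.mlieBracket_add_left (hd u) (hd v)])
      (fun c v v' => by rw [map_smul, VectorField.mlieBracket_const_smul_left (hd v)])
      (fun u v v' => by rw [map_add, VectorField.mlieBracket_add_right (hd v) (hd v')])
      (fun c v v' => by rw [map_smul, VectorField.mlieBracket_const_smul_right (hd v')])
  have hB : ∀ i j, ∀ u ∈ 𝓗.fil x i, ∀ v ∈ 𝓗.fil x j, B u v ∈ 𝓗.fil x (i + j) :=
    fun i j u hu v hv => 𝓗.lie_mem i j _ _ (hs u) (hs v) (hi i u hu).mem (hi j v hv).mem x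
  obtain ⟨b, hb⟩ := exists_grBracket (𝓗.isFiltration x) B hB
  refine ⟨b, fun i j X Y hX hY hXi hYj => ?_⟩
  rw [hb]
  exact grClass_eq_of_sub_mem _ _ ((hi i _ (hXi x)).mlieBracket_sub_mem ⟨hX, hXi⟩
    (hi j _ (hYj x)) ⟨hY, hYj⟩ (hx _) (hx _))

theorem isOscBracket_oscBracket [T2Space M] (x : M) : 𝓗.IsOscBracket x (𝓗.oscBracket x) := by
  have h := 𝓗.exists_isOscBracket x
  rw [oscBracket, dif_pos h]
  exact h.choose_spec

variable {𝓗}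

/-- The osculating bracket is given by the brackets of any two sections. -/
theorem oscBracket_grClass [T2Space M] {i j : ℕ} {X Y : ∀ x : M, TangentSpace 𝓘(ℝ, E) x}
    (hX : 𝓗.IsSection i X) (hY : 𝓗.IsSection j Y) (x : M) {u v : TangentSpace 𝓘(ℝ, E) x}
    (hu : u ∈ 𝓗.fil x i) (hv : v ∈ 𝓗.fil x j) (hXu : X x = u) (hYv : Y x = v) :
    𝓗.oscBracket x (grClass (𝓗.fil x) 𝓗.depth i u hu) (grClass (𝓗.fil x) 𝓗.depth j v hv) =
      grClass (𝓗.fil x) 𝓗.depth (i + j) (VectorField.mlieBracket 𝓘(ℝ, E) X Y x)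
        (𝓗.lie_mem i j X Y hX.smooth hY.smooth hX.mem hY.mem x) := by
  subst hXu hYv
  exact 𝓗.isOscBracket_oscBracket x i j X Y hX.smooth hY.smooth hX.mem hY.mem

theorem oscBracket_swap [T2Space M] (𝓗 : FilteredManifold E M) (x : M) (u v : 𝓗.gr x) :
    𝓗.oscBracket x u v = - 𝓗.oscBracket x v u := by
  obtain ⟨ext, hs, hx, hi⟩ := 𝓗.exists_extension x
  rw [eq_sum_grClass u, eq_sum_grClass v]
  simp only [map_sum, LinearMap.sum_apply, ← Finset.sum_neg_distrib]
  rw [Finset.sum_comm]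
  refine Finset.sum_congr rfl fun l _ => Finset.sum_congr rfl fun p _ => ?_
  have h1 := hi _ _ (grSplit (𝓗.fil x) l (u l)).2
  have h2 := hi _ _ (grSplit (𝓗.fil x) p (v p)).2
  rw [oscBracket_grClass h1 h2 x _ _ (hx _) (hx _), oscBracket_grClass h2 h1 x _ _ (hx _) (hx _),
    ← grClass_neg]
  exact grClass_congr (add_comm _ _) _ _ VectorField.mlieBracket_swap_apply

end FilteredManifold

end

section

variable {E : Type*} [NormedAddCommGroup E] [NormedSpace ℝ E]
  {M : Type*} [TopologicalSpace M] [ChartedSpace E M] [IsManifold 𝓘(ℝ, E) ∞ M]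

/-! ### Cartan's formula on a manifold -/

section Cartan

variable (E) in
/-- The preferred trivialization of the tangent bundle at `x₀`. -/
abbrev tangentTriv (x₀ x : M) : TangentSpace 𝓘(ℝ, E) x →L[ℝ] E :=
  (trivializationAt E (TangentSpace 𝓘(ℝ, E) : M → Type _) x₀).continuousLinearMapAt ℝ x

/-- The expression of a vector field in the preferred chart at `x₀`. -/
def chartField (x₀ : M) (X : ∀ x : M, TangentSpace 𝓘(ℝ, E) x) (y : E) : E :=
  tangentTriv E x₀ ((chartAt E x₀).symm y) (X ((chartAt E x₀).symm y))

theorem chartField_self (x₀ : M) (X : ∀ x : M, TangentSpace 𝓘(ℝ, E) x) :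
    chartField x₀ X (chartAt E x₀ x₀) = tangentTriv E x₀ x₀ (X x₀) := by
  rw [chartField, (chartAt E x₀).left_inv (mem_chart_source E x₀)]

theorem symmL_tangentTriv {x₀ x : M} (hx : x ∈ (chartAt E x₀).source)
    (v : TangentSpace 𝓘(ℝ, E) x) :
    (trivializationAt E (TangentSpace 𝓘(ℝ, E)) x₀).symmL ℝ x (tangentTriv E x₀ x v) = v :=
  (trivializationAt E (TangentSpace 𝓘(ℝ, E)) x₀).symmL_continuousLinearMapAt (R := ℝ) hx v

theorem tangentTriv_symmL {x₀ x : M} (hx : x ∈ (chartAt E x₀).source) (v : E) :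
    tangentTriv E x₀ x ((trivializationAt E (TangentSpace 𝓘(ℝ, E)) x₀).symmL ℝ x v) = v :=
  (trivializationAt E (TangentSpace 𝓘(ℝ, E)) x₀).continuousLinearMapAt_symmL (R := ℝ) hx v

theorem symmL_inverse {x₀ x : M} (hx : x ∈ (chartAt E x₀).source) :
    ((trivializationAt E (TangentSpace 𝓘(ℝ, E)) x₀).symmL ℝ x).inverse = tangentTriv E x₀ x :=
  ContinuousLinearMap.inverse_eq (ContinuousLinearMap.ext (symmL_tangentTriv hx))
    (ContinuousLinearMap.ext (tangentTriv_symmL hx))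

theorem tangentTriv_inverse {x₀ x : M} (hx : x ∈ (chartAt E x₀).source) :
    (tangentTriv E x₀ x).inverse = (trivializationAt E (TangentSpace 𝓘(ℝ, E)) x₀).symmL ℝ x :=
  ContinuousLinearMap.inverse_eq (ContinuousLinearMap.ext (tangentTriv_symmL hx))
    (ContinuousLinearMap.ext (symmL_tangentTriv hx))

/-- The bracket on `M` is the chart bracket of the fields pulled back by the inverse chart, whose
derivative is the inverse of the trivialization. Near the base point these pullbacks are the chart
expressions. -/
theorem lieBracket_chartField (x₀ : M) (X Y : ∀ x : M, TangentSpace 𝓘(ℝ, E) x) :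
    VectorField.lieBracket ℝ (chartField x₀ X) (chartField x₀ Y) (chartAt E x₀ x₀) =
      tangentTriv E x₀ x₀ (VectorField.mlieBracket 𝓘(ℝ, E) X Y x₀) := by
  have hx₀ := mem_chart_source E x₀
  have h1 : ∀ X : ∀ x : M, TangentSpace 𝓘(ℝ, E) x,
      VectorField.mpullbackWithin 𝓘(ℝ, E) 𝓘(ℝ, E) (extChartAt 𝓘(ℝ, E) x₀).symm X
        (Set.range 𝓘(ℝ, E)) =ᶠ[𝓝 (chartAt E x₀ x₀)] chartField x₀ X := by
    intro X
    filter_upwards [(chartAt E x₀).open_target.mem_nhds (mem_chart_target E x₀)] with y hy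
    have hs := (chartAt E x₀).map_target hy
    rw [VectorField.mpullbackWithin_apply, chartField, ← symmL_inverse hs,
      TangentBundle.symmL_trivializationAt hs]
    have h2 : extChartAt 𝓘(ℝ, E) x₀ ((chartAt E x₀).symm y) = y := by
      simpa using (chartAt E x₀).right_inv hy
    rw [h2]
    rfl
  rw [← VectorField.mlieBracketWithin_univ, VectorField.mlieBracketWithin_apply,
    ← TangentBundle.continuousLinearMapAt_trivializationAt hx₀]
  refine Eq.trans ?_ (congrArg (tangentTriv E x₀ x₀)
    (DFunLike.congr_fun (tangentTriv_inverse hx₀) _)).symm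
  refine Eq.trans ?_ (tangentTriv_symmL hx₀ _).symm
  rw [Set.preimage_univ, Set.univ_inter]
  have h2 := Filter.EventuallyEq.lieBracket_vectorField_eq (𝕜 := ℝ) (h1 X) (h1 Y)
  rw [← h2]
  simp only [modelWithCornersSelf_coe, Set.range_id]
  exact (congrFun VectorField.lieBracketWithin_univ _).symm

theorem contMDiffAt_tangentTriv {X : ∀ x : M, TangentSpace 𝓘(ℝ, E) x} (hX : IsSmoothField X)
    (x₀ : M) : ContMDiffAt 𝓘(ℝ, E) 𝓘(ℝ, E) ∞ (fun x => tangentTriv E x₀ x (X x)) x₀ := by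
  have h1 := (Bundle.contMDiffAt_section x₀).1 (hX x₀)
  refine h1.congr_of_eventuallyEq ?_
  filter_upwards [(chartAt E x₀).open_source.mem_nhds (mem_chart_source E x₀)] with x hx
  rw [Bundle.Trivialization.continuousLinearMapAt_apply ℝ,
    Bundle.Trivialization.coe_linearMapAt_of_mem (R := ℝ) _ hx]

theorem differentiableAt_chartField {X : ∀ x : M, TangentSpace 𝓘(ℝ, E) x} (hX : IsSmoothField X)
    (x₀ : M) : DifferentiableAt ℝ (chartField x₀ X) (chartAt E x₀ x₀) := by
  have h1 := contMDiffAt_tangentTriv hX x₀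
  rw [contMDiffAt_iff_source_of_mem_source (mem_chart_source E x₀)] at h1
  simp only [mfld_simps] at h1
  rw [contMDiffWithinAt_univ, contMDiffAt_iff_contDiffAt] at h1
  exact h1.differentiableAt (by simp)

variable [FiniteDimensional ℝ E]

/-- The exterior derivative of a form on vector fields on which its contractions vanish. -/
theorem extD_apply_vectorField {k : ℕ} (α : DiffForm E M (k + 1))
    {V : Fin (k + 2) → ∀ x : M, TangentSpace 𝓘(ℝ, E) x} (hV : ∀ i, IsSmoothField (V i))
    (hα : ∀ (i : Fin (k + 2)) x, α x (i.removeNth fun l => V l x) = 0) (x : M) :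
    extD (k + 1) α x (fun i => V i x) = - ∑ i : Fin (k + 1), ∑ j ≥ i, (-1 : ℝ) ^ (i + j : ℕ) *
      α x (Matrix.vecCons (VectorField.mlieBracket 𝓘(ℝ, E) (V i.castSucc) (V j.succ) x)
        (j.removeNth (i.castSucc.removeNth fun l => V l x))) := by
  have hself : ∀ u : Fin (k + 1) → TangentSpace 𝓘(ℝ, E) x,
      localRep α x (chartAt E x x) (fun l => tangentTriv E x x (u l)) = α x u := by
    intro u
    rw [localRep, (chartAt E x).left_inv (mem_chart_source E x)]
    change α x _ = α x u
    congr 1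
    funext l
    exact symmL_tangentTriv (mem_chart_source E x) _
  have h1 : extD (k + 1) α x (fun i => V i x) =
      extDeriv (localRep α x) (chartAt E x x) (fun i => chartField x (V i) (chartAt E x x)) := by
    simp only [chartField_self]
    rfl
  rw [h1, extDeriv_apply_vectorField (V := fun i => chartField x (V i))
    (differentiableAt_localRep α x) (fun i => differentiableAt_chartField (hV i) x)]
  -- The derivative terms of Cartan's formula vanish, because the contractions of `α` are zero at
  -- all points of `M` and hence near the base point in the chart.
  have h2 : ∀ i : Fin (k + 2), fderiv ℝ (fun y => localRep α x y
      (i.removeNth fun l => chartField x (V l) y)) (chartAt E x x) = 0 := by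
    intro i
    have h3 : (fun y => localRep α x y (i.removeNth fun l => chartField x (V l) y))
        =ᶠ[𝓝 (chartAt E x x)] fun _ => 0 := by
      filter_upwards [(chartAt E x).open_target.mem_nhds (mem_chart_target E x)] with y hy
      rw [← hα i ((chartAt E x).symm y)]
      change α _ _ = α _ _
      congr 1
      funext l
      exact symmL_tangentTriv ((chartAt E x).map_target hy) _
    rw [h3.fderiv_eq]
    simp
  simp only [h2, zero_apply, smul_zero, Finset.sum_const_zero, zero_sub]
  congr 1
  refine Finset.sum_congr rfl fun i _ => Finset.sum_congr rfl fun j _ => ?_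
  rw [zsmul_eq_mul, Int.cast_pow, Int.cast_neg, Int.cast_one]
  refine congrArg (fun t : ℝ => (-1 : ℝ) ^ (i + j : ℕ) * t) ?_
  rw [lieBracket_chartField, ← hself]
  congr 1
  funext l
  refine Fin.cases rfl (fun l => ?_) l
  exact chartField_self x _

end Cartan

/-! ### The symbol of the exterior derivative -/

namespace FilteredManifold

variable {𝓗 : FilteredManifold E M} [FiniteDimensional ℝ E]

omit [FiniteDimensional ℝ E] in
theorem map_grClass_of_hasSymbol {x : M} {k w : ℕ} {α : (Fin k → TangentSpace 𝓘(ℝ, E) x) → ℝ}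
    {β : 𝓗.gr x [⋀^Fin k]→ₗ[ℝ] ℝ} (h : HasSymbol (𝓗.fil x) 𝓗.depth w α β) {j : Fin k → ℕ}
    {v : Fin k → TangentSpace 𝓘(ℝ, E) x} (hv : ∀ i, v i ∈ 𝓗.fil x (j i)) {u : Fin k → 𝓗.gr x}
    (hu : ∀ i, u i = grClass (𝓗.fil x) 𝓗.depth (j i) (v i) (hv i)) :
    β u = if ∑ i, j i = w then α v else 0 := by
  rw [← h.2 j v hv, ← funext hu]

omit [FiniteDimensional ℝ E] in
theorem eq_zero_of_weight_zero {k : ℕ} {x : M} (α : AltTangent E k x) {j : Fin k → ℕ}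
    {v : Fin k → TangentSpace 𝓘(ℝ, E) x} (hv : ∀ i, v i ∈ 𝓗.fil x (j i)) {i : Fin k}
    (hi : j i = 0) : α v = 0 := by
  refine α.map_coord_zero i ?_
  have h := hv i
  rw [hi] at h
  change _ ∈ 𝓗.H 0 x at h
  rw [𝓗.zero] at h
  exact h

/-- The symbol of the exterior derivative is the osculating differential. -/
theorem hasSymbol_extD [T2Space M] {k w : ℕ} {α : DiffForm E M k} (hα : 𝓗.FormWeightGE w α) (x : M)
    {β : 𝓗.gr x [⋀^Fin k]→ₗ[ℝ] ℝ} (hβ : HasSymbol (𝓗.fil x) 𝓗.depth w (fun v => α x v) β) :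
    HasSymbol (𝓗.fil x) 𝓗.depth w (fun v => extD k α x v) (𝓗.oscDiff x k β) := by
  cases k with
  | zero =>
    -- A function of weight at least `w > 0` is zero, as the empty sum of indices is `0`. For `w =
    -- 0` the single argument lies in `H 0 = 0`.
    have h0 : ∀ (j : Fin 1 → ℕ) (v : Fin 1 → TangentSpace 𝓘(ℝ, E) x),
        (∀ i, v i ∈ 𝓗.fil x (j i)) → ∑ i, j i ≤ w → extD 0 α x v = 0 := by
      intro j v hv hj
      rcases Nat.eq_zero_or_pos w with rfl | hw
      · refine eq_zero_of_weight_zero (𝓗 := 𝓗) _ hv (i := 0) ?_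
        simpa using hj
      · have h1 : α = 0 := by
          refine ContMDiffSection.ext fun y => ContinuousAlternatingMap.ext fun u => ?_
          exact hα y (fun _ => 0) u (fun i => i.elim0) (by simpa using hw)
        rw [h1, map_zero]
        rfl
    refine ⟨fun j v hv hj => h0 j v hv hj.le, fun j v hv => ?_⟩
    change (0 : ℝ) = _
    split_ifs with hj
    · exact (h0 j v hv hj.le).symm
    · rfl
  | succ k =>
    obtain ⟨ext, hs, hx, hi⟩ := 𝓗.exists_extension x
    have hsum : ∀ (j : Fin (k + 2) → ℕ) (i l : Fin (k + 1)), i ≤ l →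
        ∑ m, (Fin.cons (j i.castSucc + j l.succ) (l.removeNth (i.castSucc.removeNth j)) :
          Fin (k + 1) → ℕ) m = ∑ m, j m := by
      intro j i l hil
      rw [Fin.sum_univ_succ, Fin.sum_univ_succAbove j i.castSucc,
        Fin.sum_univ_succAbove (fun m => j (i.castSucc.succAbove m)) l,
        Fin.succAbove_of_le_castSucc i.castSucc l (Fin.castSucc_le_castSucc_iff.2 hil)]
      simp only [Fin.cons_zero, Fin.cons_succ, Fin.removeNth]
      ring
    -- Omitting one argument of positive index leaves total index below `w`, so all contractions of
    -- `α` with the extended fields vanish identically and only the bracket terms remain.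
    have main : ∀ (j : Fin (k + 2) → ℕ) (v : Fin (k + 2) → TangentSpace 𝓘(ℝ, E) x)
        (hv : ∀ i, v i ∈ 𝓗.fil x (j i)), (∀ i, j i ≠ 0) → ∑ i, j i ≤ w →
        extD (k + 1) α x v = - ∑ i : Fin (k + 1), ∑ l ≥ i, (-1 : ℝ) ^ (i + l : ℕ) *
          α x (Matrix.vecCons (VectorField.mlieBracket 𝓘(ℝ, E) (ext (v i.castSucc))
            (ext (v l.succ)) x) (l.removeNth (i.castSucc.removeNth v))) := by
      intro j v hv hj0 hj
      have h1 := extD_apply_vectorField α (V := fun i => ext (v i)) (fun i => hs _) (by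
        intro i y
        refine hα y (i.removeNth j) _ (fun l => (hi _ _ (hv _)).mem y) ?_
        rw [Fin.sum_univ_succAbove j i] at hj
        have := hj0 i
        change ∑ l, j (i.succAbove l) < w
        omega) x
      simp only [hx] at h1
      exact h1
    refine ⟨fun j v hv hj => ?_, fun j v hv => ?_⟩
    · by_cases hj0 : ∀ i, j i ≠ 0
      · refine (main j v hv hj0 hj.le).trans (neg_eq_zero.2 ?_)
        refine Finset.sum_eq_zero fun i _ => Finset.sum_eq_zero fun l hl => ?_
        refine mul_eq_zero_of_right _ (hα x
          (Fin.cons (j i.castSucc + j l.succ) (l.removeNth (i.castSucc.removeNth j))) _ ?_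
          ((hsum j i l (Finset.mem_Ici.1 hl)).trans_lt hj))
        refine Fin.cases ?_ fun m => ?_
        · exact 𝓗.lie_mem _ _ _ _ (hs _) (hs _) (hi _ _ (hv _)).mem (hi _ _ (hv _)).mem x
        · exact hv _
      · push Not at hj0
        obtain ⟨i, hi0⟩ := hj0
        exact eq_zero_of_weight_zero (𝓗 := 𝓗) _ hv hi0
    · by_cases hj0 : ∀ i, j i ≠ 0
      · have hterm : ∀ i l : Fin (k + 1), i ≤ l →
            β (Matrix.vecCons (𝓗.oscBracket x
              (grClass (𝓗.fil x) 𝓗.depth _ (v i.castSucc) (hv i.castSucc))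
              (grClass (𝓗.fil x) 𝓗.depth _ (v l.succ) (hv l.succ)))
              (l.removeNth (i.castSucc.removeNth fun i =>
                grClass (𝓗.fil x) 𝓗.depth (j i) (v i) (hv i)))) =
            if ∑ i, j i = w then α x (Matrix.vecCons (VectorField.mlieBracket 𝓘(ℝ, E)
              (ext (v i.castSucc)) (ext (v l.succ)) x) (l.removeNth (i.castSucc.removeNth v)))
            else 0 := by
          intro i l hil
          rw [← hsum j i l hil]
          refine map_grClass_of_hasSymbol hβ (Fin.cases ?_ fun m => ?_) (Fin.cases ?_ fun m => ?_)
          · exact 𝓗.lie_mem _ _ _ _ (hs _) (hs _) (hi _ _ (hv _)).mem (hi _ _ (hv _)).mem x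
          · exact hv _
          · exact oscBracket_grClass (hi _ _ (hv _)) (hi _ _ (hv _)) x _ _ (hx _) (hx _)
          · rfl
        rw [oscDiff, ceDiff_apply _ (𝓗.oscBracket_swap x)]
        split_ifs with hj
        · refine Eq.trans ?_ (main j v hv hj0 hj.le).symm
          refine congrArg Neg.neg (Finset.sum_congr rfl fun i _ =>
            Finset.sum_congr rfl fun l hl => ?_)
          rw [hterm i l (Finset.mem_Ici.1 hl), if_pos hj]
        · rw [neg_eq_zero]
          refine Finset.sum_eq_zero fun i _ => Finset.sum_eq_zero fun l hl => ?_
          rw [hterm i l (Finset.mem_Ici.1 hl), if_neg hj, mul_zero]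
      · push Not at hj0
        obtain ⟨i, hi0⟩ := hj0
        beta_reduce
        rw [eq_zero_of_weight_zero (𝓗 := 𝓗) (extD (k + 1) α x) hv hi0, ite_self]
        exact (𝓗.oscDiff x (k + 1) β).map_coord_zero i (grClass_eq_zero (Or.inl hi0))

end FilteredManifold

end

section

variable {E : Type*} [NormedAddCommGroup E] [NormedSpace ℝ E] [FiniteDimensional ℝ E]
  {M : Type*} [TopologicalSpace M] [ChartedSpace E M] [IsManifold 𝓘(ℝ, E) ∞ M] [T2Space M]
  [Bundle.RiemannianBundle (fun x : M => TangentSpace 𝓘(ℝ, E) x)]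

/-! ### The perturbation property of the box -/

namespace BasePair

variable {𝓗 : FilteredManifold E M} (B : BasePair 𝓗)

omit [T2Space M] in
theorem d0_mem_formFiltration (w : ℕ) (α : AllForms E M) (hα : α ∈ 𝓗.formFiltration w) :
    B.d0 α ∈ 𝓗.formFiltration w := by
  intro k
  cases k with
  | zero => exact fun _ _ _ _ _ => rfl
  | succ k => exact B.dOp_weight k w (α k) (hα k)

omit [T2Space M] in
theorem delta0_mem_formFiltration (w : ℕ) (α : AllForms E M) (hα : α ∈ 𝓗.formFiltration w) :
    B.delta0 α ∈ 𝓗.formFiltration w :=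
  fun k => B.deltaOp_weight k w (α (k + 1)) (hα (k + 1))

/-- Both operators send `α` to a form whose symbol at `x` is the osculating differential of the
symbol of `α`, so the difference has symbol zero. -/
theorem deRham_sub_d0_mem (w : ℕ) (α : AllForms E M) (hα : α ∈ 𝓗.formFiltration w) :
    deRham α - B.d0 α ∈ 𝓗.formFiltration (w + 1) := by
  intro k x
  cases k with
  | zero => exact fun _ _ _ _ => sub_self (0 : ℝ)
  | succ k =>
    obtain ⟨β, hβ⟩ := FilteredManifold.exists_symbol (hα k x)
    exact (FilteredManifold.hasSymbol_extD (hα k) x hβ).hasWeightGE_sub (B.gr_dOp k x w _ _ hβ)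

/-- The box is a perturbation of the base box that raises the weight. -/
theorem filteredPerturbation (hreg : ∀ k, IsLocallyConstant fun x : M =>
      Module.finrank ℝ (LinearMap.range (𝓗.oscDiff x k))) :
    FilteredPerturbation 𝓗.formFiltration (Module.finrank ℝ E * 𝓗.depth + 1) B.box0 B.box where
  anti := 𝓗.formFiltration_antitone
  zero := 𝓗.formFiltration_zero
  last := 𝓗.formFiltration_eq_bot
  mem w v hv := add_mem (B.d0_mem_formFiltration w _ (B.delta0_mem_formFiltration w v hv))
    (B.delta0_mem_formFiltration w _ (B.d0_mem_formFiltration w v hv))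
  ker _ hv := B.box0_eq_zero_of_sq hv
  range := B.exists_box0_box0 hreg
  sub w v hv := by
    have h : B.box v - B.box0 v = (deRham (B.delta0 v) - B.d0 (B.delta0 v)) +
        B.delta0 (deRham v - B.d0 v) := by
      rw [box_apply, box0_apply, map_sub]
      abel
    rw [h]
    exact add_mem (B.deRham_sub_d0_mem w _ (B.delta0_mem_formFiltration w v hv))
      (B.delta0_mem_formFiltration _ _ (B.deRham_sub_d0_mem w v hv))

end BasePair

end

end FilteredComplex

end

theorem mainTheorem6
    {E : Type*} [NormedAddCommGroup E] [NormedSpace ℝ E] [FiniteDimensional ℝ E]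
    {M : Type*} [TopologicalSpace M] [ChartedSpace E M] [IsManifold 𝓘(ℝ, E) ∞ M]
    [T2Space M] [SigmaCompactSpace M]
    [Bundle.RiemannianBundle (fun x : M => TangentSpace 𝓘(ℝ, E) x)]
    [IsContMDiffRiemannianBundle 𝓘(ℝ, E) ∞ E (fun x : M => TangentSpace 𝓘(ℝ, E) x)]
    (𝓗 : FilteredManifold E M)
    (hreg : ∀ k, IsLocallyConstant fun x : M =>
      Module.finrank ℝ (LinearMap.range (𝓗.oscDiff x k)))
    (B : BasePair 𝓗) :
    IsCompl (⨆ n : ℕ, LinearMap.ker (B.box0 ^ n)) (⨅ n : ℕ, LinearMap.range (B.box0 ^ n)) ∧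
    IsCompl (⨆ n : ℕ, LinearMap.ker (B.box ^ n)) (⨅ n : ℕ, LinearMap.range (B.box ^ n)) ∧
    IsUnit B.L ∧
    IsUnit B.box0F ∧
    (∀ k, ∀ α ∈ B.F0 ⊓ degreePart E M k,
      B.d0 α ∈ B.F0 ⊓ degreePart E M (k + 1) ∧
      B.C α ∈ B.F0 ⊓ degreePart E M (k + 1) ∧
      B.d0 (B.d0 α) = 0 ∧ B.C (B.C α) = 0) ∧
    (∃ e : B.F0 ≃ₗ[ℝ] B.F0, (∀ α : B.F0, (e α : AllForms E M) = B.g α) ∧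
      ∀ α : B.F0, B.C (e α) = (e (B.d0F α) : AllForms E M)) ∧
    ∀ k, Nonempty (Cohomology B.F0 B.C k ≃ₗ[ℝ]
        Cohomology B.F0 B.d0 k) ∧
      Subsingleton (Cohomology B.F0 B.C k) ∧
      Subsingleton (Cohomology B.F0 B.d0 k) := by
  have h := B.filteredPerturbation hreg
  have hd0 := B.d0_mem_formFiltration
  have hδ := B.delta0_mem_formFiltration
  have hd := B.deRham_sub_d0_mem
  have hdeg : ∀ (T : Module.End ℝ (AllForms E M)), IsRaising T → ∀ k, ∀ α ∈ degreePart E M k,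
      T α ∈ degreePart E M (k + 1) := by
    intro T hT k α hα
    rw [mem_degreePart_iff] at hα ⊢
    rw [← Module.End.mul_apply, ← hT.comm, Module.End.mul_apply, hα]
  refine ⟨h.isCompl_left, h.isCompl, B.isUnit_L h, B.isUnit_box0F h, fun k α hα =>
    ⟨⟨B.d0_mem α hα.1, hdeg _ B.isRaising_d0 k α hα.2⟩,
      ⟨B.C_mem_F0 h α, hdeg _ (B.isRaising_C h) k α hα.2⟩, B.d0_d0 α, B.C_C h α⟩,
    ⟨B.gEquiv h hd0 hδ hd, fun α => B.gEquiv_apply h hd0 hδ hd α,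
      fun α => B.C_gEquiv h hd0 hδ hd α⟩, fun k => ?_⟩
  have h1 := B.subsingleton_cohomology_d0 h k
  have h2 := B.subsingleton_cohomology_C h hd0 hδ hd k
  -- Between zero spaces the zero map is an isomorphism.
  exact ⟨⟨0⟩, h2, h1⟩
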